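/- Let $d\in\mathbb N$, $\sigma>0$, $T>0$, let $\mathbb T^d=\mathbb R^d/\mathbb Z^d$ and let $b:[0,T]\times\mathbb T^d\to\mathbb R^d$ be smooth. For a compact metric space $E$, $\mathcal P(E)$ denotes the set of Borel probability measures on $E$ with the topology of weak convergence (which is the one metrized by the Kantorovich distance $\mathbf d_1$). For every $m_0\in\mathcal P(\mathbb T^d)$ the Fokker–Planck equation $$\partial_t m-\sigma\Delta m+\operatorname{div}(bm)=0\ \text{ in }(0,T)\times\mathbb T^d,\qquad m|_{t=0}=m_0,$$ has exactly one solution $(m_t)_{t\in[0,T]}$ in the sense of distributions among the weakly continuous curves in $\mathcal P(\mathbb T^d)$ with $m_0$ as value at $t=0$; write $K_t(m_0)=m_t$. Each $K_t$ is a Borel map from $\mathcal P(\mathbb T^d)$ to itself. Fix $\mu_0\in\mathcal P(\mathcal P(\mathbb T^d))$ and set $\mu_t=(K_t)_\#\mu_0$ for $t\in[0,T]$. For $\phi:\mathcal P(\mathbb T^d)\to\mathbb R$ put $$\nabla_m\phi(m,x)=\lim_{\theta\to0^+}\frac{\phi((1-\theta)m+\theta\delta_x)-\phi(m)}{\theta}$$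 when the limit exists. Call $\phi:[0,T]\times\mathcal P(\mathbb T^d)\to\mathbb R$ *smooth* if $\nabla_m\phi(t,m,x)$ exists for all $(t,m,x)$, $\phi$ is smooth in $t$, $\nabla_m\phi$ is smooth in $(t,x)$, and the $t$-derivatives of $\phi$ of all orders (including $0$) are jointly continuous in $(t,m)$, and the $(t,x)$-derivatives of $\nabla_m\phi$ of all orders (including $0$) are jointly continuous in $(t,m,x)$. Then $t\mapsto\mu_t$ is weakly continuous on $[0,T]$ and, for every smooth $\phi:[0,T]\times\mathcal P(\mathbb T^d)\to\mathbb R$ with $\phi(T,\cdot)=0$, $$\int_0^T\!\int_{\mathcal P(\mathbb T^d)}\Big(-\partial_t\phi(t,m)-\int_{\mathbb T^d}\big(\sigma\Delta_x\nabla_m\phi(t,m,x)+b(t,x)\cdot\nabla_x\nabla_m\phi(t,m,x)\big)\,m(dx)\Big)\mu_t(dm)\,dt-\int_{\mathcal P(\mathbb T^d)}\phi(0,m)\,\mu_0(dm)=0 .$$ Moreover $(\mu_t)_{t\in[0,T]}$ is the unique process satisfying this relation: if $(\nu_t)_{t\in[0,T]}$ is a measurable family in $\mathcal P(\mathcal P(\mathbb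 T^d))$ which satisfies it (with $\nu_t$ in place of $\mu_t$, the same $\mu_0$, and all such $\phi$), then $\nu_t=\mu_t$ for almost every $t\in[0,T]$, and for every $t\in[0,T]$ if $t\mapsto\nu_t$ is weakly continuous. -/

import Mathlib

open MeasureTheory Set Filter Topology
open scoped ContDiff

/-- On a compact metrizable space, the Borel sigma-algebra of the (weakly topologized) space of
Borel probability measures is the sigma-algebra generated by the evaluations on Borel sets. Hence
`ProbabilityMeasure (ProbabilityMeasure X)` is the space of Borel probability measures on the
space of Borel probability measures on `X`, and it carries its weak topology. -/
instance instBorelSpaceProbabilityMeasure {X : Type*} [TopologicalSpace X] [MeasurableSpace X]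
    [BorelSpace X] [TopologicalSpace.MetrizableSpace X] [CompactSpace X] :
    BorelSpace (ProbabilityMeasure X) := by
  let := TopologicalSpace.metrizableSpaceMetric X
  have : SecondCountableTopology (ProbabilityMeasure X) := by
    let := TopologicalSpace.pseudoMetrizableSpacePseudoMetric (ProbabilityMeasure X)
    infer_instance
  refine ⟨le_antisymm ?_ ?_⟩
  · let : MeasurableSpace (ProbabilityMeasure X) := borel _
    have : BorelSpace (ProbabilityMeasure X) := ⟨rfl⟩
    have key : Measurable (fun m : ProbabilityMeasure X => (m : Measure X)) := by
      refine Measurable.measure_of_isPiSystem_of_isProbabilityMeasure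
        (S := {s : Set X | IsClosed s})
        (by rw [BorelSpace.measurable_eq (α := X), borel_eq_generateFrom_isClosed])
        isPiSystem_isClosed ?_
      intro F hF
      have hpos : ∀ n : ℕ, (0 : ℝ) < 1 / ((n : ℝ) + 1) := fun n => by positivity
      have hlim := fun m : ProbabilityMeasure X =>
        tendsto_lintegral_thickenedIndicator_of_isClosed (m : Measure X) hF hpos
          tendsto_one_div_add_atTop_nhds_zero_nat
      refine measurable_of_tendsto_metrizable (f := fun (n : ℕ) (m : ProbabilityMeasure X) =>
        ∫⁻ x, (thickenedIndicator (hpos n) F x : ENNReal) ∂(m : Measure X)) ?_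
        (tendsto_pi_nhds.2 hlim)
      intro n
      exact (ProbabilityMeasure.continuous_lintegral_boundedContinuousFunction
        (thickenedIndicator (hpos n) F)).measurable
    exact measurable_iff_comap_le.1 key
  · have htop : (inferInstance : TopologicalSpace (ProbabilityMeasure X)) =
        TopologicalSpace.generateFrom
          {s | ∃ (f : C(X, NNReal)) (U : Set ENNReal), IsOpen U ∧
            s = (fun m : ProbabilityMeasure X => ∫⁻ x, f x ∂(m : Measure X)) ⁻¹' U} := by
      refine le_antisymm (le_generateFrom ?_) ?_
      · rintro s ⟨f, U, hU, rfl⟩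
        exact hU.preimage (ProbabilityMeasure.continuous_lintegral_continuousMap f)
      · rw [← continuous_id_iff_le]
        refine (@ProbabilityMeasure.continuous_iff_forall_continuousMap_continuous_lintegral
          X _ _ _ _ (TopologicalSpace.generateFrom _) id _).2 fun f => ?_
        refine @Continuous.mk _ _ (TopologicalSpace.generateFrom _) _ _ fun U hU => ?_
        exact TopologicalSpace.isOpen_generateFrom_of_mem ⟨f, U, hU, rfl⟩
    rw [borel_eq_generateFrom_of_subbasis htop]
    refine MeasurableSpace.generateFrom_le ?_
    rintro s ⟨f, U, hU, rfl⟩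
    exact ((Measure.measurable_lintegral f.continuous.measurable.coe_nnreal_ennreal).comp
      measurable_subtype_coe) hU.measurableSet

noncomputable section

/-- The `d`-dimensional flat torus `ℝᵈ / ℤᵈ`. -/
abbrev Torus (d : ℕ) : Type := UnitAddTorus (Fin d)

namespace Torus

variable {d : ℕ}

/-- The quotient map `ℝᵈ → ℝᵈ / ℤᵈ`. -/
def proj (y : Fin d → ℝ) : Torus d := fun i => (y i : UnitAddCircle)

/-- The partial derivative in the `i`-th coordinate of a function on the torus. -/
def partialDeriv (i : Fin d) (f : Torus d → ℝ) (x : Torus d) : ℝ :=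
  deriv (fun s : ℝ => f (x + Pi.single i (s : UnitAddCircle))) 0

/-- The operator `σ Δ + β · ∇` on functions on the torus. -/
def generator (σ : ℝ) (β : Torus d → Fin d → ℝ) (f : Torus d → ℝ) (x : Torus d) : ℝ :=
  σ * ∑ i, partialDeriv i (partialDeriv i f) x + ∑ i, β x i * partialDeriv i f x

/-- Smoothness (up to the boundary in time) on `[0, T] × 𝕋ᵈ`. -/
def SmoothOnCylinder {F : Type*} [NormedAddCommGroup F] [NormedSpace ℝ F] (T : ℝ)
    (f : ℝ → Torus d → F) : Prop :=
  ContDiffOn ℝ ∞ (fun p : ℝ × (Fin d → ℝ) => f p.1 (proj p.2)) (Icc 0 T ×ˢ univ)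

end Torus

open Torus

variable {d : ℕ}

/-- The curve `m` of probability measures is a (weakly continuous, distributional) solution on
`[0, T]` of the Fokker-Planck equation `∂ₜ m - σ Δ m + div (b m) = 0`, `m|_{t = 0} = m₀`. -/
structure IsFokkerPlanckSolution (σ T : ℝ) (b : ℝ → Torus d → Fin d → ℝ)
    (m₀ : ProbabilityMeasure (Torus d)) (m : ℝ → ProbabilityMeasure (Torus d)) : Prop where
  initial : m 0 = m₀
  continuousOn : ContinuousOn m (Icc 0 T)
  distrib : ∀ ψ : ℝ → Torus d → ℝ,
    ContDiff ℝ ∞ (fun p : ℝ × (Fin d → ℝ) => ψ p.1 (proj p.2)) →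
    tsupport (fun p : ℝ × Torus d => ψ p.1 p.2) ⊆ Ioo 0 T ×ˢ univ →
    ∫ t in (0 : ℝ)..T, ∫ x, (deriv (fun s => ψ s x) t + generator σ (b t) (ψ t) x)
      ∂(m t : Measure (Torus d)) = 0

open Classical in
/-- The Fokker-Planck flow: `fokkerPlanckFlow σ T b t m₀` is the value `K_t(m₀)` at time
`t ∈ [0, T]` of the solution of the Fokker-Planck equation started from `m₀`. -/
def fokkerPlanckFlow (σ T : ℝ) (b : ℝ → Torus d → Fin d → ℝ) (t : ℝ)
    (m₀ : ProbabilityMeasure (Torus d)) : ProbabilityMeasure (Torus d) :=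
  if h : ∃ m : ℝ → ProbabilityMeasure (Torus d), IsFokkerPlanckSolution σ T b m₀ m
  then h.choose t else m₀

/-- The probability measure `(1 - θ) m + θ δ_x`, for `θ ∈ [0, 1]`. -/
def mixDirac (m : ProbabilityMeasure (Torus d)) (x : Torus d) (θ : unitInterval) :
    ProbabilityMeasure (Torus d) :=
  ⟨ENNReal.ofReal (1 - θ) • (m : Measure (Torus d)) + ENNReal.ofReal θ • Measure.dirac x, ⟨by
    simp only [Measure.coe_add, Measure.coe_smul, Pi.add_apply, Pi.smul_apply, measure_univ,
      smul_eq_mul, mul_one]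
    rw [← ENNReal.ofReal_add (sub_nonneg.2 θ.2.2) θ.2.1]
    simp⟩⟩

/-- The difference quotient of `φ` at `m` in the direction `δ_x - m`. -/
def diracQuotient (φ : ProbabilityMeasure (Torus d) → ℝ) (m : ProbabilityMeasure (Torus d))
    (x : Torus d) (θ : unitInterval) : ℝ :=
  (φ (mixDirac m x θ) - φ m) / (θ : ℝ)

/-- The derivative `∇_m φ (m, x)`, i.e. the limit of `(φ ((1 - θ) m + θ δ_x) - φ m) / θ` as
`θ → 0`, `θ > 0`. It is meaningful when the limit exists. -/
def gradM (φ : ProbabilityMeasure (Torus d) → ℝ) (m : ProbabilityMeasure (Torus d))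
    (x : Torus d) : ℝ :=
  limUnder (𝓝[>] (0 : unitInterval)) (diracQuotient φ m x)

/-- Smooth functions `φ : [0, T] × 𝒫(𝕋ᵈ) → ℝ`: the derivative `∇_m φ (t, m, x)` exists
everywhere, `φ` is smooth in `t` and `∇_m φ` is smooth in `(t, x)`, all these derivatives being
jointly continuous in all the variables, `m` included. -/
structure IsSmoothTestFunction (T : ℝ) (φ : ℝ → ProbabilityMeasure (Torus d) → ℝ) : Prop where
  smooth_time : ∀ m, ContDiffOn ℝ ∞ (fun t => φ t m) (Icc 0 T)
  continuous_time : ∀ k : ℕ, ContinuousOn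
    (fun q : ℝ × ProbabilityMeasure (Torus d) =>
      iteratedDerivWithin k (fun t => φ t q.2) (Icc 0 T) q.1) (Icc 0 T ×ˢ univ)
  exists_gradM : ∀ t ∈ Icc 0 T, ∀ m x, ∃ l : ℝ,
    Tendsto (diracQuotient (φ t) m x) (𝓝[>] (0 : unitInterval)) (𝓝 l)
  smooth_gradM : ∀ m, SmoothOnCylinder T (fun t x => gradM (φ t) m x)
  continuous_gradM : ∀ k : ℕ, ContinuousOn
    (fun q : ProbabilityMeasure (Torus d) × (ℝ × (Fin d → ℝ)) =>
      iteratedFDerivWithin ℝ k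
        (fun p : ℝ × (Fin d → ℝ) => gradM (φ p.1) q.1 (proj p.2)) (Icc 0 T ×ˢ univ) q.2)
    (univ ×ˢ (Icc 0 T ×ˢ univ))

/-- A measurable process `μ` with values in `𝒫(𝒫(𝕋ᵈ))` solves, in the dual sense, the continuity
equation `∂ₜ μ + ∇_m · ((σ Δ m - div (m b)) μ) = 0`, `μ|_{t = 0} = μ₀`. -/
structure IsWeakSolution (σ T : ℝ) (b : ℝ → Torus d → Fin d → ℝ)
    (μ₀ : ProbabilityMeasure (ProbabilityMeasure (Torus d)))
    (μ : ℝ → ProbabilityMeasure (ProbabilityMeasure (Torus d))) : Prop where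
  aemeasurable : AEMeasurable μ (volume.restrict (Icc 0 T))
  dual : ∀ φ : ℝ → ProbabilityMeasure (Torus d) → ℝ,
    IsSmoothTestFunction T φ → (∀ m, φ T m = 0) →
    (∫ t in (0 : ℝ)..T, ∫ m : ProbabilityMeasure (Torus d),
        (-derivWithin (fun s => φ s m) (Icc 0 T) t
          - ∫ x, generator σ (b t) (gradM (φ t) m) x ∂(m : Measure (Torus d)))
        ∂(μ t : Measure (ProbabilityMeasure (Torus d))))
      - ∫ m, φ 0 m ∂(μ₀ : Measure (ProbabilityMeasure (Torus d))) = 0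

end

/-!
The Fokker-Planck equation is solved by curves of measures, and the continuity equation on
`𝒫(𝒫(𝕋ᵈ))` is the linear transport of laws along these curves. The proof has three ingredients.

*Existence for the Fokker-Planck equation* (`exists_isFokkerPlanckSolution`). The laws of a Markov
chain which, during a time step `h`, drifts by `h b` and then jumps by `± √(2 (d + 1) σ h)` along
a coordinate axis satisfy the equation to first order in `h`, uniformly on smooth functions
(`Torus.SmoothOnCylinder.exists_consistency`). As `𝒫(𝕋ᵈ)` is compact, they converge along an
ultrafilter, and the limit satisfies the first order expansion `IsFlowCurve`, which is another form
of the equation.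

*The chain rule* (`IsSmoothTestFunction.integral_along_solution`). A test function is only
differentiable, at first, towards Dirac masses. The derivative being jointly continuous, this
extends to finitely supported measures, by mixing in one Dirac mass after the other, and then to
all measures, by density (`isDiffDirection_of_dirac`). The resulting mean value inequality gives
`d/dt φ(t, m_t) = ∂ₜφ + ∫ (σ Δ + b · ∇) ∇_m φ dm_t` along any solution `m`. Integrating over the
initial measure shows that the push-forward of `μ₀` by the flow is a weak solution
(`isWeakSolution_pushFlow`).

*Uniqueness of weak solutions* (`IsWeakSolution.ae_eq`). Let `e_k` be the exponentials of the
torus. By Stone-Weierstrass, a probability measure on `𝒫(𝕋ᵈ)` is determined by the integrals of the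
monomials `m ↦ ∏ⱼ ∫ e_{k j} dm` (`ext_of_integral_momentProd`), which are smooth test functions.
For the difference of two weak solutions, let `u_k(t)` be these integrals, for `k` of a fixed
length `p`. Expanding `b` in a Fourier series, which converges absolutely and uniformly in time
(`Torus.SmoothOnCylinder.exists_wiener_bound`), shows that the `u_k` satisfy a closed linear system:
diffusion damps `u_k` at the rate `4 π² σ ∑ |k j|²`, and the drift couples it to the other `u_l` with
a coefficient of size `∑ |k j|`. By Duhamel's formula, and since the damping dominates the drift up
to an additive constant (`drift_le_dampingRate`), the system is a contraction for the norm
`sup_{t, k} exp (-λ t) |u_k t|` with `λ` large. The `u_k` are bounded by `2`, hence they vanish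
(`IsWeakSolution.ae_integral_momentProd_eq`). No regularity of the measures is needed.

Uniqueness for the Fokker-Planck equation is a special case: a solution `m` provides the weak
solution `t ↦ δ_{m t}` (`IsFokkerPlanckSolution.eqOn`). Uniqueness and compactness together make the
flow continuous in the time and the initial value, so that the push-forward is weakly continuous.
-/

/-! ### Differential calculus on the torus -/

namespace Torus

variable {d : ℕ}

lemma isOpenQuotientMap_proj : IsOpenQuotientMap (proj : (Fin d → ℝ) → Torus d) :=
  IsOpenQuotientMap.piMap (fun _ => QuotientAddGroup.isOpenQuotientMap_mk)

lemma continuous_proj : Continuous (proj : (Fin d → ℝ) → Torus d) :=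
  isOpenQuotientMap_proj.continuous

lemma surjective_proj : Function.Surjective (proj : (Fin d → ℝ) → Torus d) :=
  isOpenQuotientMap_proj.surjective

lemma proj_add (y z : Fin d → ℝ) : proj (y + z) = proj y + proj z := by
  ext i; simp [proj]

lemma proj_smul_single (i : Fin d) (s : ℝ) :
    proj (s • Pi.single i 1) = Pi.single i (s : UnitAddCircle) := by
  ext j
  by_cases h : j = i
  · subst h; simp [proj]
  · simp [proj, h]

lemma proj_add_single (y : Fin d → ℝ) (i : Fin d) (s : ℝ) :
    proj y + Pi.single i (s : UnitAddCircle) = proj (y + s • Pi.single i 1) := by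
  rw [proj_add, proj_smul_single]

/-- The projection being an open quotient map, joint continuity on `s × 𝕋ᵈ` may be tested
on `s × ℝᵈ`. -/
lemma continuousOn_of_continuousOn_proj {Z F : Type*} [TopologicalSpace Z] [TopologicalSpace F]
    {s : Set Z} {G : Z → Torus d → F}
    (h : ContinuousOn (fun q : Z × (Fin d → ℝ) => G q.1 (proj q.2)) (s ×ˢ univ)) :
    ContinuousOn (fun q : Z × Torus d => G q.1 q.2) (s ×ˢ univ) := by
  rintro ⟨z, x⟩ ⟨hz, -⟩
  obtain ⟨y, rfl⟩ := surjective_proj x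
  have h1 := h (z, y) ⟨hz, mem_univ _⟩
  unfold ContinuousWithinAt at h1 ⊢
  rw [nhdsWithin_prod_eq, nhdsWithin_univ] at h1 ⊢
  rw [← isOpenQuotientMap_proj.map_nhds_eq, ← Filter.map_id (f := 𝓝[s] z), Filter.prod_map_map_eq]
  exact tendsto_map'_iff.2 h1

lemma continuous_of_continuous_proj {F : Type*} [TopologicalSpace F]
    {g : Torus d → F} (h : Continuous (fun y => g (proj y))) : Continuous g :=
  isOpenQuotientMap_proj.isQuotientMap.continuous_iff.2 h

lemma uniqueDiffOn_cylinder {T : ℝ} (hT : 0 < T) :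
    UniqueDiffOn ℝ (Icc 0 T ×ˢ (univ : Set (Fin d → ℝ))) :=
  (uniqueDiffOn_Icc hT).prod uniqueDiffOn_univ

/-- Smoothness of a function on the torus. -/
def Smooth (g : Torus d → ℝ) : Prop := ContDiff ℝ ∞ (fun y => g (proj y))

section Cylinder

variable {F : Type*} [NormedAddCommGroup F] [NormedSpace ℝ F] {T t : ℝ}

lemma SmoothOnCylinder.hasDerivAt_line {f : ℝ → Torus d → F} (hf : SmoothOnCylinder T f)
    (ht : t ∈ Icc 0 T) (y v : Fin d → ℝ) (s : ℝ) :
    HasDerivAt (fun s : ℝ => f t (proj (y + s • v)))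
      (fderivWithin ℝ (fun p : ℝ × (Fin d → ℝ) => f p.1 (proj p.2)) (Icc 0 T ×ˢ univ)
        (t, y + s • v) (0, v)) s := by
  have h1 := ((hf.differentiableOn (by simp)) (t, y + s • v)
    ⟨ht, mem_univ _⟩).hasFDerivWithinAt
  have h2 : HasDerivAt (fun s : ℝ => (t, y + s • v)) (0, v) s := by
    refine (hasDerivAt_const s t).prodMk ?_
    simpa using ((hasDerivAt_id s).smul_const v).const_add y
  have h3 := h1.comp_hasDerivWithinAt (s := univ) s h2.hasDerivWithinAt
    (fun s _ => mk_mem_prod ht (mem_univ _))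
  simpa [Function.comp_def] using h3

lemma SmoothOnCylinder.continuousOn {f : ℝ → Torus d → F} (hf : SmoothOnCylinder T f) :
    ContinuousOn (fun q : ℝ × Torus d => f q.1 q.2) (Icc 0 T ×ˢ univ) :=
  continuousOn_of_continuousOn_proj (ContDiffOn.continuousOn hf)

lemma SmoothOnCylinder.continuous {f : ℝ → Torus d → F} (hf : SmoothOnCylinder T f)
    (ht : t ∈ Icc 0 T) : Continuous (f t) := by
  rw [← continuousOn_univ]
  exact hf.continuousOn.comp (f := fun x => (t, x)) (by fun_prop) (fun x _ => ⟨ht, mem_univ _⟩)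

lemma SmoothOnCylinder.exists_bound {f : ℝ → Torus d → F} (hf : SmoothOnCylinder T f) :
    ∃ C, 0 ≤ C ∧ ∀ t ∈ Icc 0 T, ∀ x, ‖f t x‖ ≤ C := by
  obtain ⟨C, hC⟩ := (isCompact_Icc.prod isCompact_univ).exists_bound_of_continuousOn hf.continuousOn
  exact ⟨max C 0, le_max_right _ _, fun t ht x => (hC (t, x) (mk_mem_prod ht (mem_univ x))).trans
    (le_max_left _ _)⟩

/-- Functions smooth on the cylinder are continuous in time, uniformly in space. -/
lemma SmoothOnCylinder.uniform_time {f : ℝ → Torus d → F} (hf : SmoothOnCylinder T f)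
    {ε : ℝ} (hε : 0 < ε) :
    ∃ δ > 0, ∀ s ∈ Icc 0 T, ∀ t ∈ Icc 0 T, |t - s| ≤ δ → ∀ x, ‖f t x - f s x‖ ≤ ε := by
  let := TopologicalSpace.metrizableSpaceMetric (Torus d)
  have h := (isCompact_Icc.prod isCompact_univ).uniformContinuousOn_of_continuous hf.continuousOn
  obtain ⟨δ, hδ, H⟩ := Metric.uniformContinuousOn_iff.1 h ε hε
  refine ⟨δ / 2, by positivity, fun s hs t ht hst x => ?_⟩
  have := H (t, x) ⟨ht, mem_univ _⟩ (s, x) ⟨hs, mem_univ _⟩ (by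
    rw [Prod.dist_eq, dist_self, Real.dist_eq]
    exact max_lt (by linarith) hδ)
  rw [dist_eq_norm] at this
  exact this.le

end Cylinder

variable {T t : ℝ} {f g : ℝ → Torus d → ℝ}

lemma SmoothOnCylinder.partialDeriv_proj (hf : SmoothOnCylinder T f)
    (ht : t ∈ Icc 0 T) (i : Fin d) (y : Fin d → ℝ) :
    partialDeriv i (f t) (proj y) =
      fderivWithin ℝ (fun p : ℝ × (Fin d → ℝ) => f p.1 (proj p.2)) (Icc 0 T ×ˢ univ)
        (t, y) (0, Pi.single i 1) := by
  have := (hf.hasDerivAt_line ht y (Pi.single i 1) 0).deriv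
  simp only [← proj_add_single, zero_smul, add_zero] at this
  exact this

lemma SmoothOnCylinder.hasDerivAt (hf : SmoothOnCylinder T f)
    (ht : t ∈ Icc 0 T) (x : Torus d) (v : Fin d → ℝ) (s : ℝ) :
    HasDerivAt (fun s : ℝ => f t (x + proj (s • v)))
      (∑ i, v i * partialDeriv i (f t) (x + proj (s • v))) s := by
  obtain ⟨y, rfl⟩ := surjective_proj x
  simp only [← proj_add]
  refine (hf.hasDerivAt_line ht y v s).congr_deriv ?_
  have hv : ((0 : ℝ), v) = ∑ i, v i • ((0 : ℝ), (Pi.single i 1 : Fin d → ℝ)) := by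
    ext j
    · simp [Prod.fst_sum]
    · simp [Prod.snd_sum, Finset.sum_apply, Pi.single_apply]
  rw [hv, map_sum]
  refine Finset.sum_congr rfl fun i _ => ?_
  rw [hf.partialDeriv_proj ht, map_smul, smul_eq_mul]

lemma SmoothOnCylinder.hasDerivAt_single (hf : SmoothOnCylinder T f)
    (ht : t ∈ Icc 0 T) (x : Torus d) (i : Fin d) (s : ℝ) :
    HasDerivAt (fun s : ℝ => f t (x + Pi.single i (s : UnitAddCircle)))
      (partialDeriv i (f t) (x + Pi.single i (s : UnitAddCircle))) s := by
  have := hf.hasDerivAt ht x (Pi.single i 1) s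
  simp only [proj_smul_single] at this
  convert this using 1
  simp [Pi.single_apply]

lemma SmoothOnCylinder.partialDeriv (hT : 0 < T) (hf : SmoothOnCylinder T f) (i : Fin d) :
    SmoothOnCylinder T (fun t => Torus.partialDeriv i (f t)) := by
  have h : ContDiffOn ℝ ∞ (fun p : ℝ × (Fin d → ℝ) =>
      fderivWithin ℝ (fun p : ℝ × (Fin d → ℝ) => f p.1 (proj p.2)) (Icc 0 T ×ˢ univ)
        p (0, Pi.single i 1)) (Icc 0 T ×ˢ univ) :=
    (ContDiffOn.fderivWithin hf (uniqueDiffOn_cylinder hT) (by simp)).clm_apply contDiffOn_const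
  refine h.congr ?_
  rintro ⟨t, y⟩ ⟨ht, -⟩
  exact hf.partialDeriv_proj ht i y

lemma SmoothOnCylinder.add (hf : SmoothOnCylinder T f) (hg : SmoothOnCylinder T g) :
    SmoothOnCylinder T (fun t x => f t x + g t x) := ContDiffOn.add hf hg

lemma SmoothOnCylinder.sub (hf : SmoothOnCylinder T f) (hg : SmoothOnCylinder T g) :
    SmoothOnCylinder T (fun t x => f t x - g t x) := ContDiffOn.sub hf hg

lemma SmoothOnCylinder.mul (hf : SmoothOnCylinder T f) (hg : SmoothOnCylinder T g) :
    SmoothOnCylinder T (fun t x => f t x * g t x) := ContDiffOn.mul hf hg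

lemma SmoothOnCylinder.sum {ι : Type*} (s : Finset ι) {f : ι → ℝ → Torus d → ℝ}
    (hf : ∀ i ∈ s, SmoothOnCylinder T (f i)) :
    SmoothOnCylinder T (fun t x => ∑ i ∈ s, f i t x) := ContDiffOn.sum hf

lemma Smooth.smoothOnCylinder {g : Torus d → ℝ} (hg : Smooth g) (T : ℝ) :
    SmoothOnCylinder T (fun _ => g) :=
  (hg.comp contDiff_snd).contDiffOn

lemma smooth_const (c : ℝ) : Smooth (fun _ : Torus d => c) := contDiff_const

lemma smoothOnCylinder_const (c : ℝ) : SmoothOnCylinder T (fun _ (_ : Torus d) => c) :=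
  contDiffOn_const

lemma SmoothOnCylinder.smooth (hf : SmoothOnCylinder T f) (ht : t ∈ Icc 0 T) : Smooth (f t) := by
  have h : ContDiffOn ℝ ∞ (fun y : Fin d → ℝ => f t (proj y)) univ :=
    ContDiffOn.comp (t := Icc 0 T ×ˢ univ) hf (f := fun y : Fin d → ℝ => (t, y)) (by fun_prop)
      (fun y _ => ⟨ht, mem_univ _⟩)
  exact contDiffOn_univ.1 h

lemma Smooth.continuous {g : Torus d → ℝ} (hg : Smooth g) : Continuous g :=
  continuous_of_continuous_proj (ContDiff.continuous hg)

lemma Smooth.partialDeriv {g : Torus d → ℝ} (hg : Smooth g) (i : Fin d) :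
    Smooth (Torus.partialDeriv i g) :=
  ((hg.smoothOnCylinder 1).partialDeriv one_pos i).smooth (t := 0) (by simp)

lemma SmoothOnCylinder.component {b : ℝ → Torus d → Fin d → ℝ} (hb : SmoothOnCylinder T b)
    (i : Fin d) : SmoothOnCylinder T (fun t x => b t x i) :=
  contDiffOn_pi.1 hb i

lemma SmoothOnCylinder.generator (hT : 0 < T) (σ : ℝ) {b : ℝ → Torus d → Fin d → ℝ}
    (hb : SmoothOnCylinder T b) (hf : SmoothOnCylinder T f) :
    SmoothOnCylinder T (fun t => generator σ (b t) (f t)) :=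
  ((smoothOnCylinder_const σ).mul (SmoothOnCylinder.sum _
    fun i _ => (hf.partialDeriv hT i).partialDeriv hT i)).add
    (SmoothOnCylinder.sum _ fun i _ => (hb.component i).mul (hf.partialDeriv hT i))

/-- The generator at any time `r`, applied to a family smooth on the cylinder, is bounded uniformly
in `r` and in the parameter of the family. -/
lemma SmoothOnCylinder.exists_bound_generator (hT : 0 < T) (σ : ℝ) {b : ℝ → Torus d → Fin d → ℝ}
    (hb : SmoothOnCylinder T b) (hf : SmoothOnCylinder T f) :
    ∃ C, 0 ≤ C ∧ ∀ r ∈ Icc 0 T, ∀ t ∈ Icc 0 T, ∀ x, |Torus.generator σ (b r) (f t) x| ≤ C := by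
  choose B hB0 hB using fun i => (hb.component i).exists_bound
  choose C hC0 hC using fun i => (hf.partialDeriv hT i).exists_bound
  choose D hD0 hD using fun i => ((hf.partialDeriv hT i).partialDeriv hT i).exists_bound
  refine ⟨|σ| * ∑ i, D i + ∑ i, B i * C i, add_nonneg (mul_nonneg (abs_nonneg _)
    (Finset.sum_nonneg fun i _ => hD0 i)) (Finset.sum_nonneg fun i _ =>
    mul_nonneg (hB0 i) (hC0 i)), fun r hr t ht x => ?_⟩
  refine (abs_add_le _ _).trans (add_le_add ?_ ?_)
  · rw [abs_mul]
    gcongr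
    refine (Finset.abs_sum_le_sum_abs _ _).trans (Finset.sum_le_sum fun i _ => hD i t ht x)
  · refine (Finset.abs_sum_le_sum_abs _ _).trans (Finset.sum_le_sum fun i _ => ?_)
    rw [abs_mul]
    exact mul_le_mul (hB i r hr x) (hC i t ht x) (abs_nonneg _) (hB0 i)

lemma Smooth.generator_add {β : Torus d → Fin d → ℝ} {σ : ℝ} {g₁ g₂ : Torus d → ℝ}
    (h₁ : Smooth g₁) (h₂ : Smooth g₂) (c₁ c₂ : ℝ) (x : Torus d) :
    generator σ β (fun x => c₁ * g₁ x + c₂ * g₂ x) x =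
      c₁ * generator σ β g₁ x + c₂ * generator σ β g₂ x := by
  have key : ∀ {g₁ g₂ : Torus d → ℝ}, Smooth g₁ → Smooth g₂ → ∀ i : Fin d,
      Torus.partialDeriv i (fun x => c₁ * g₁ x + c₂ * g₂ x) =
        fun x => c₁ * Torus.partialDeriv i g₁ x + c₂ * Torus.partialDeriv i g₂ x := by
    intro g₁ g₂ h₁ h₂ i
    ext x
    have e₁ := (h₁.smoothOnCylinder 1).hasDerivAt_single (t := 0) (by simp) x i 0
    have e₂ := (h₂.smoothOnCylinder 1).hasDerivAt_single (t := 0) (by simp) x i 0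
    have := ((e₁.const_mul c₁).add (e₂.const_mul c₂)).deriv
    simpa using! this
  simp only [generator, key h₁ h₂, key (h₁.partialDeriv _) (h₂.partialDeriv _), mul_add,
    Finset.sum_add_distrib, Finset.mul_sum]
  have : ∀ a b c e a' b' c' e' : ℝ, a = a' → b = b' → c = c' → e = e' →
    (a + b) + (c + e) = (a' + c') + (b' + e') := by intros; subst_vars; ring
  apply this <;> refine Finset.sum_congr rfl fun i _ => ?_ <;> ring

lemma SmoothOnCylinder.partialDeriv_eq_iteratedFDerivWithin (hT : 0 < T)
    (hf : SmoothOnCylinder T f) (ht : t ∈ Icc 0 T) (i : Fin d) (y : Fin d → ℝ) :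
    Torus.partialDeriv i (f t) (proj y) =
      iteratedFDerivWithin ℝ 1 (fun p : ℝ × (Fin d → ℝ) => f p.1 (proj p.2)) (Icc 0 T ×ˢ univ)
        (t, y) (fun _ => (0, Pi.single i 1)) := by
  rw [hf.partialDeriv_proj ht, iteratedFDerivWithin_one_apply
    (uniqueDiffOn_cylinder hT _ ⟨ht, mem_univ _⟩)]

lemma SmoothOnCylinder.partialDeriv_partialDeriv_eq_iteratedFDerivWithin (hT : 0 < T)
    (hf : SmoothOnCylinder T f) (ht : t ∈ Icc 0 T) (i : Fin d) (y : Fin d → ℝ) :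
    Torus.partialDeriv i (Torus.partialDeriv i (f t)) (proj y) =
      iteratedFDerivWithin ℝ 2 (fun p : ℝ × (Fin d → ℝ) => f p.1 (proj p.2)) (Icc 0 T ×ˢ univ)
        (t, y) (fun _ => (0, Pi.single i 1)) := by
  have hmem : (t, y) ∈ Icc 0 T ×ˢ (univ : Set (Fin d → ℝ)) := ⟨ht, mem_univ _⟩
  have hu := uniqueDiffOn_cylinder (d := d) hT
  rw [(hf.partialDeriv hT i).partialDeriv_proj ht, iteratedFDerivWithin_two_apply _ hu hmem]
  have h1 : DifferentiableWithinAt ℝ (fderivWithin ℝ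
      (fun p : ℝ × (Fin d → ℝ) => f p.1 (proj p.2)) (Icc 0 T ×ˢ univ)) (Icc 0 T ×ˢ univ) (t, y) :=
    (ContDiffOn.fderivWithin hf hu (m := ∞) (by simp)).differentiableOn (by simp) _ hmem
  rw [fderivWithin_congr (f₁ := fun p : ℝ × (Fin d → ℝ) => Torus.partialDeriv i (f p.1) (proj p.2))
    (f := fun p => fderivWithin ℝ (fun p : ℝ × (Fin d → ℝ) => f p.1 (proj p.2)) (Icc 0 T ×ˢ univ)
      p (0, Pi.single i 1)) (fun p hp => hf.partialDeriv_proj hp.1 i p.2)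
    (hf.partialDeriv_proj ht i y)]
  rw [fderivWithin_clm_apply (hu _ hmem) h1 (differentiableWithinAt_const _)]
  simp

end Torus

/-! ### Integrals against varying probability measures on a compact space -/

section CompactIntegral

lemma ProbabilityMeasure.ext_of_forall_integral {X : Type*} [TopologicalSpace X]
    [MeasurableSpace X] [BorelSpace X] [TopologicalSpace.MetrizableSpace X]
    {μ ν : ProbabilityMeasure X}
    (h : ∀ f : C(X, ℝ), ∫ x, f x ∂(μ : Measure X) = ∫ x, f x ∂(ν : Measure X)) : μ = ν := by
  apply ProbabilityMeasure.toMeasure_injective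
  refine ext_of_forall_integral_eq_of_IsFiniteMeasure fun f => ?_
  exact h f.toContinuousMap

lemma abs_integral_le_of_forall_abs_le {X : Type*} [MeasurableSpace X] {f : X → ℝ} {C : ℝ}
    (hf : ∀ x, |f x| ≤ C)
    (μ : ProbabilityMeasure X) : |∫ x, f x ∂(μ : Measure X)| ≤ C := by
  have := norm_integral_le_of_norm_le_const (μ := (μ : Measure X)) (f := f) (C := C)
    (Eventually.of_forall fun x => by simpa using hf x)
  simpa using this

variable {X : Type*} [TopologicalSpace X] [MeasurableSpace X] [BorelSpace X]
  [TopologicalSpace.MetrizableSpace X] [CompactSpace X]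

instance instSecondCountableTopologyProbabilityMeasure :
    SecondCountableTopology (ProbabilityMeasure X) := by
  let := TopologicalSpace.metrizableSpaceMetric X
  let := TopologicalSpace.pseudoMetrizableSpacePseudoMetric (ProbabilityMeasure X)
  infer_instance

instance instMetrizableSpaceProbabilityMeasure :
    TopologicalSpace.MetrizableSpace (ProbabilityMeasure X) := by
  let := TopologicalSpace.metrizableSpaceMetric X
  let := TopologicalSpace.pseudoMetrizableSpacePseudoMetric (ProbabilityMeasure X)
  exact TopologicalSpace.metrizableSpace_of_t3_secondCountable _

lemma Continuous.integrable_of_compactSpace {E : Type*} [NormedAddCommGroup E]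
    {f : X → E} (hf : Continuous f) (μ : Measure X) [IsFiniteMeasure μ] : Integrable f μ :=
  hf.integrable_of_hasCompactSupport (HasCompactSupport.of_compactSpace f)

/-- The integral of a jointly continuous function is jointly continuous in the parameter and the
measure. -/
lemma continuous_integral_parametric {𝕜 Y : Type*} [RCLike 𝕜] [TopologicalSpace Y]
    {G : Y → X → 𝕜} (hG : Continuous (fun q : Y × X => G q.1 q.2)) :
    Continuous (fun q : Y × ProbabilityMeasure X => ∫ x, G q.1 x ∂(q.2 : Measure X)) := by
  let F : C(Y, C(X, 𝕜)) := ContinuousMap.curry ⟨fun q : Y × X => G q.1 q.2, hG⟩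
  have hF : ∀ y x, F y x = G y x := fun _ _ => rfl
  rw [continuous_iff_continuousAt]
  rintro ⟨y₀, μ₀⟩
  have h1 : Tendsto (fun q : Y × ProbabilityMeasure X => ∫ x, F y₀ x ∂(q.2 : Measure X))
      (𝓝 (y₀, μ₀)) (𝓝 (∫ x, F y₀ x ∂(μ₀ : Measure X))) :=
    ((ProbabilityMeasure.tendsto_iff_forall_integral_rclike_tendsto 𝕜).1
      (continuous_snd.tendsto (y₀, μ₀))) (BoundedContinuousFunction.mkOfCompact (F y₀))
  have h2 : Tendsto (fun q : Y × ProbabilityMeasure X => ∫ x, (F q.1 - F y₀) x ∂(q.2 : Measure X))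
      (𝓝 (y₀, μ₀)) (𝓝 0) := by
    refine squeeze_zero_norm (a := fun q => ‖F q.1 - F y₀‖) (fun q => ?_) ?_
    · simpa using norm_integral_le_of_norm_le_const (μ := (q.2 : Measure X))
        (Eventually.of_forall fun x => (F q.1 - F y₀).norm_coe_le_norm x)
    · have : Continuous fun q : Y × ProbabilityMeasure X => ‖F q.1 - F y₀‖ := by fun_prop
      simpa using this.tendsto (y₀, μ₀)
  have h3 := h2.add h1
  rw [zero_add] at h3
  refine h3.congr fun q => ?_
  rw [← integral_add ((F q.1 - F y₀).continuous.integrable_of_compactSpace _)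
    ((F y₀).continuous.integrable_of_compactSpace _)]
  simp [hF]

lemma continuousOn_integral_parametric {𝕜 Y : Type*} [RCLike 𝕜] [TopologicalSpace Y] {s : Set Y}
    {G : Y → X → 𝕜} (hG : ContinuousOn (fun q : Y × X => G q.1 q.2) (s ×ˢ univ)) :
    ContinuousOn (fun q : Y × ProbabilityMeasure X => ∫ x, G q.1 x ∂(q.2 : Measure X))
      (s ×ˢ univ) := by
  have h : Continuous (fun q : s × X => G q.1 q.2) :=
    hG.comp_continuous (f := fun q : s × X => ((q.1 : Y), q.2)) (by fun_prop)
      (fun q => ⟨q.1.2, mem_univ _⟩)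
  have h2 := continuous_integral_parametric (G := fun (y : s) x => G y x) h
  rw [continuousOn_iff_continuous_domRestrict]
  exact h2.comp (f := fun q : ↥(s ×ˢ (univ : Set (ProbabilityMeasure X))) =>
    ((⟨q.1.1, q.2.1⟩ : s), q.1.2)) (by fun_prop)

lemma continuous_integral_probabilityMeasure {𝕜 : Type*} [RCLike 𝕜] {f : X → 𝕜}
    (hf : Continuous f) :
    Continuous (fun μ : ProbabilityMeasure X => ∫ x, f x ∂(μ : Measure X)) :=
  (continuous_integral_parametric (Y := Unit) (G := fun _ => f) (by fun_prop)).comp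
    (f := fun μ => ((), μ)) (by fun_prop)

end CompactIntegral

/-! ### Shortcut instances for the torus -/

namespace Torus

variable {d : ℕ}

scoped instance instBorelSpace : BorelSpace (Torus d) := inferInstance

scoped instance instOpensMeasurableSpace : OpensMeasurableSpace (Torus d) := inferInstance

scoped instance instCompactSpace : CompactSpace (Torus d) := inferInstance

scoped instance instMetrizableSpace : TopologicalSpace.MetrizableSpace (Torus d) := inferInstance

noncomputable scoped instance instTopologicalSpaceProbabilityMeasure :
    TopologicalSpace (ProbabilityMeasure (Torus d)) := inferInstance

end Torus

/-! ### Mixtures of probability measures -/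

section Mixture

variable {X : Type*} [MeasurableSpace X]

/-- The mixture `(1 - s) m + s m'`, the weight `s` being clamped to `[0, 1]`. -/
noncomputable def mixture (m m' : ProbabilityMeasure X) (s : ℝ) : ProbabilityMeasure X :=
  ⟨ENNReal.ofReal (1 - projIcc 0 1 zero_le_one s) • (m : Measure X) +
    ENNReal.ofReal (projIcc 0 1 zero_le_one s) • (m' : Measure X), ⟨by
    simp only [Measure.coe_add, Measure.coe_smul, Pi.add_apply, Pi.smul_apply, measure_univ,
      smul_eq_mul, mul_one]
    rw [← ENNReal.ofReal_add (sub_nonneg.2 (projIcc 0 1 zero_le_one s).2.2)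
      (projIcc 0 1 zero_le_one s).2.1]
    simp⟩⟩

lemma mixDirac_eq_mixture {d : ℕ} (m : ProbabilityMeasure (Torus d)) (x : Torus d)
    (θ : unitInterval) : mixDirac m x θ = mixture m (diracProba x) θ := by
  have : projIcc 0 1 zero_le_one (θ : ℝ) = θ := projIcc_val _ θ
  simp only [mixDirac, mixture, this]
  rfl

variable [TopologicalSpace X] [BorelSpace X] [TopologicalSpace.MetrizableSpace X] [CompactSpace X]

lemma integral_mixture_projIcc {𝕜 : Type*} [RCLike 𝕜] {f : X → 𝕜} (hf : Continuous f)
    (m m' : ProbabilityMeasure X) (s : ℝ) :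
    ∫ x, f x ∂(mixture m m' s : Measure X) =
      ((1 - projIcc (0 : ℝ) 1 zero_le_one s : ℝ) : 𝕜) * ∫ x, f x ∂(m : Measure X) +
        ((projIcc (0 : ℝ) 1 zero_le_one s : ℝ) : 𝕜) * ∫ x, f x ∂(m' : Measure X) := by
  have h := (projIcc (0 : ℝ) 1 zero_le_one s).2
  simp only [mixture, ProbabilityMeasure.coe_mk]
  rw [integral_add_measure, integral_smul_measure, integral_smul_measure,
    ENNReal.toReal_ofReal h.1, ENNReal.toReal_ofReal (sub_nonneg.2 h.2),
    RCLike.real_smul_eq_coe_mul,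
    RCLike.real_smul_eq_coe_mul]
  · exact (hf.integrable_of_compactSpace _).smul_measure ENNReal.ofReal_ne_top
  · exact (hf.integrable_of_compactSpace _).smul_measure ENNReal.ofReal_ne_top

lemma integral_mixture {f : X → ℝ} (hf : Continuous f)
    (m m' : ProbabilityMeasure X) {s : ℝ} (hs : s ∈ Icc (0 : ℝ) 1) :
    ∫ x, f x ∂(mixture m m' s : Measure X) =
      (1 - s) * ∫ x, f x ∂(m : Measure X) + s * ∫ x, f x ∂(m' : Measure X) := by
  rw [integral_mixture_projIcc hf, projIcc_of_mem _ hs]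
  simp

lemma mixture_zero (m m' : ProbabilityMeasure X) : mixture m m' 0 = m := by
  refine ProbabilityMeasure.ext_of_forall_integral fun f => ?_
  rw [integral_mixture f.continuous _ _ (by simp)]; simp

lemma mixture_one (m m' : ProbabilityMeasure X) : mixture m m' 1 = m' := by
  refine ProbabilityMeasure.ext_of_forall_integral fun f => ?_
  rw [integral_mixture f.continuous _ _ (by simp)]; simp

lemma mixture_self (m : ProbabilityMeasure X) (s : ℝ) : mixture m m s = m := by
  refine ProbabilityMeasure.ext_of_forall_integral fun f => ?_
  rw [integral_mixture_projIcc f.continuous]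
  simp only [RCLike.ofReal_real_eq_id, id]
  ring

lemma mixture_mixture (m m' : ProbabilityMeasure X) {s η : ℝ} (hs : s ∈ Icc (0 : ℝ) 1)
    (hη : η ∈ Icc (0 : ℝ) 1) :
    mixture (mixture m m' s) m' η = mixture m m' (s + η * (1 - s)) := by
  refine ProbabilityMeasure.ext_of_forall_integral fun f => ?_
  have h : s + η * (1 - s) ∈ Icc (0 : ℝ) 1 := by
    obtain ⟨⟨h1, h2⟩, h3, h4⟩ := And.intro hs hη
    constructor <;> nlinarith
  rw [integral_mixture f.continuous _ _ hη, integral_mixture f.continuous _ _ hs,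
    integral_mixture f.continuous _ _ h]
  ring

lemma continuous_mixture :
    Continuous (fun q : ℝ × ProbabilityMeasure X × ProbabilityMeasure X =>
      mixture q.2.1 q.2.2 q.1) := by
  refine ProbabilityMeasure.continuous_iff_forall_continuousMap_continuous_integral.2 fun f => ?_
  simp only [integral_mixture_projIcc f.continuous]
  have h := continuous_integral_probabilityMeasure f.continuous
  have h1 : Continuous fun q : ℝ × ProbabilityMeasure X × ProbabilityMeasure X =>
    ((projIcc (0 : ℝ) 1 zero_le_one q.1 : unitInterval) : ℝ) :=
    (continuous_subtype_val.comp continuous_projIcc).comp continuous_fst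
  have h2 := h.comp (continuous_fst.comp
    (continuous_snd (X := ℝ) (Y := ProbabilityMeasure X × ProbabilityMeasure X)))
  have h3 := h.comp (continuous_snd.comp
    (continuous_snd (X := ℝ) (Y := ProbabilityMeasure X × ProbabilityMeasure X)))
  exact ((continuous_const.sub h1).mul h2).add (h1.mul h3)

end Mixture

/-! ### Directional derivatives of functionals of probability measures -/

section DirectionalDerivative

variable {X : Type*} [TopologicalSpace X] [MeasurableSpace X] [BorelSpace X]
  [TopologicalSpace.MetrizableSpace X] [CompactSpace X]

/-- `n` is a direction of differentiability of `Φ` with derivative `D`: moving any `m` towards `n`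
by mixing, the right derivative of `Φ` is the integral of `D m` against `n`. -/
def IsDiffDirection (Φ : ProbabilityMeasure X → ℝ) (D : ProbabilityMeasure X → X → ℝ)
    (n : ProbabilityMeasure X) : Prop :=
  ∀ m, HasDerivWithinAt (fun θ : ℝ => Φ (mixture m n θ)) (∫ x, D m x ∂(n : Measure X)) (Ici 0) 0

variable {Φ : ProbabilityMeasure X → ℝ} {D : ProbabilityMeasure X → X → ℝ}

lemma IsDiffDirection.hasDerivWithinAt {n : ProbabilityMeasure X} (hn : IsDiffDirection Φ D n)
    (m : ProbabilityMeasure X) {s : ℝ} (hs : s ∈ Ico (0 : ℝ) 1) :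
    HasDerivWithinAt (fun θ : ℝ => Φ (mixture m n θ))
      ((1 - s)⁻¹ * ∫ x, D (mixture m n s) x ∂(n : Measure X)) (Ici s) s := by
  have h1s : 0 < 1 - s := sub_pos.2 hs.2
  have hlin : HasDerivWithinAt (fun θ : ℝ => (θ - s) / (1 - s)) (1 - s)⁻¹ (Ici s) s := by
    simpa [one_div] using ((hasDerivWithinAt_id s (Ici s)).sub_const s).div_const (1 - s)
  have h := (hn (mixture m n s))
  have h0 : (s - s) / (1 - s) = 0 := by simp
  rw [← h0] at h
  have hc := HasDerivWithinAt.comp s h hlin (fun θ hθ => by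
    simp only [sub_self, zero_div, mem_Ici]; exact div_nonneg (sub_nonneg.2 hθ) h1s.le)
  rw [mul_comm] at hc
  refine hc.congr_of_eventuallyEq_of_mem ?_ (self_mem_Ici)
  have : Ico s 1 ∈ 𝓝[≥] s := Ico_mem_nhdsGE hs.2
  filter_upwards [this] with θ hθ
  have : mixture (mixture m n s) n ((θ - s) / (1 - s)) = mixture m n θ := by
    rw [mixture_mixture _ _ ⟨hs.1, hs.2.le⟩ ⟨div_nonneg (sub_nonneg.2 hθ.1) h1s.le,
      (div_le_one h1s).2 (by linarith [hθ.2])⟩]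
    congr 1
    field_simp
    ring
  simp [Function.comp, this]

lemma IsDiffDirection.abs_sub_le (hΦ : Continuous Φ) {n : ProbabilityMeasure X}
    (hn : IsDiffDirection Φ D n) (m : ProbabilityMeasure X) {θ A ε : ℝ} (hθ : θ ∈ Icc (0 : ℝ) 1)
    (h : ∀ s ∈ Ico (0 : ℝ) θ,
      |(1 - s)⁻¹ * ∫ x, D (mixture m n s) x ∂(n : Measure X) - A| ≤ ε) :
    |Φ (mixture m n θ) - Φ m - θ * A| ≤ θ * ε := by
  have hc : Continuous fun s : ℝ => Φ (mixture m n s) - s * A := by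
    have : Continuous fun s : ℝ => Φ (mixture m n s) :=
      hΦ.comp (continuous_mixture.comp (f := fun s : ℝ => (s, m, n)) (by fun_prop))
    exact this.sub (by fun_prop)
  have := norm_image_sub_le_of_norm_deriv_right_le_segment (a := 0) (b := θ) (C := ε)
    hc.continuousOn (f' := fun s =>
      (1 - s)⁻¹ * ∫ x, D (mixture m n s) x ∂(n : Measure X) - A)
    (fun s hs => by
      have := (hn.hasDerivWithinAt m (s := s) ⟨hs.1, hs.2.trans_le hθ.2⟩).sub
        ((hasDerivWithinAt_id s (Ici s)).mul_const A)
      simpa using! this)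
    (fun s hs => h s hs) θ ⟨hθ.1, le_rfl⟩
  simp only [mixture_zero, zero_mul, sub_zero, Real.norm_eq_abs] at this
  rw [mul_comm θ ε]
  convert this using 2
  ring

/-- Continuity of the derivative along segments, uniformly for nearby end points. -/
lemma eventually_abs_slope_integral_sub_le
    (hD : Continuous fun q : ProbabilityMeasure X × X => D q.1 q.2)
    (m n : ProbabilityMeasure X) {ε : ℝ} (hε : 0 < ε) :
    ∃ δ ∈ Ioc (0 : ℝ) 1, ∀ᶠ q : ProbabilityMeasure X × ProbabilityMeasure X in 𝓝 (m, n),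
      ∀ s ∈ Ico (0 : ℝ) δ, |(1 - s)⁻¹ * ∫ x, D (mixture q.1 q.2 s) x ∂(q.2 : Measure X)
        - ∫ x, D m x ∂(n : Measure X)| ≤ ε := by
  have hc : ContinuousAt (fun q : ℝ × ProbabilityMeasure X × ProbabilityMeasure X =>
      (1 - q.1)⁻¹ * ∫ x, D (mixture q.2.1 q.2.2 q.1) x ∂(q.2.2 : Measure X)) (0, m, n) := by
    refine ContinuousAt.mul (ContinuousAt.inv₀ (by fun_prop) (by simp)) ?_
    have := (continuous_integral_parametric hD).comp
      (f := fun q : ℝ × ProbabilityMeasure X × ProbabilityMeasure X =>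
        (mixture q.2.1 q.2.2 q.1, q.2.2)) (continuous_mixture.prodMk (by fun_prop))
    exact this.continuousAt
  have hev := Metric.tendsto_nhds.1 hc.tendsto ε hε
  rw [nhds_prod_eq] at hev
  obtain ⟨pa, hpa, pb, hpb, H⟩ := eventually_prod_iff.1 hev
  obtain ⟨δ, hδ, hδ'⟩ := Metric.eventually_nhds_iff.1 hpa
  refine ⟨min δ 1, ⟨lt_min hδ one_pos, min_le_right _ _⟩, ?_⟩
  filter_upwards [hpb] with q hq s hs
  have := H (hδ' (y := s) (by
    rw [Real.dist_eq, sub_zero, abs_of_nonneg hs.1]; exact hs.2.trans_le (min_le_left _ _))) hq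
  simp only [sub_zero, inv_one, one_mul, mixture_zero, Real.dist_eq] at this
  exact this.le

/-- Mixing towards a mixture of two directions amounts to mixing towards each of them in turn,
with adjusted weights. -/
lemma mixture_mixture_eq (m p q : ProbabilityMeasure X) {a ε : ℝ} (ha : a ∈ Icc (0 : ℝ) 1)
    (hε : ε ∈ Icc (0 : ℝ) 1) (hεa : ε * a < 1) :
    mixture m (mixture q p a) ε =
      mixture (mixture m q (ε * (1 - a) / (1 - ε * a))) p (ε * a) := by
  have h1 : 0 < 1 - ε * a := by linarith
  have h2 : 0 ≤ ε * (1 - a) := mul_nonneg hε.1 (sub_nonneg.2 ha.2)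
  refine ProbabilityMeasure.ext_of_forall_integral fun f => ?_
  rw [integral_mixture f.continuous _ _ hε, integral_mixture f.continuous _ _ ha,
    integral_mixture f.continuous _ _ ⟨mul_nonneg hε.1 ha.1, hεa.le⟩,
    integral_mixture f.continuous _ _ ⟨div_nonneg h2 h1.le, (div_le_one h1).2 (by nlinarith [hε.2])⟩]
  field_simp
  ring

lemma isDiffDirection_mixture (hΦ : Continuous Φ)
    (hD : Continuous fun q : ProbabilityMeasure X × X => D q.1 q.2)
    {p q : ProbabilityMeasure X} (hp : IsDiffDirection Φ D p) (hq : IsDiffDirection Φ D q)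
    {a : ℝ} (ha : a ∈ Icc (0 : ℝ) 1) : IsDiffDirection Φ D (mixture q p a) := by
  intro m
  set r : ℝ → ℝ := fun ε => ε * (1 - a) / (1 - ε * a)
  have hr0 : r 0 = 0 := by simp [r]
  have hr : HasDerivAt r (1 - a) 0 := by
    have := ((hasDerivAt_id (0 : ℝ)).mul_const (1 - a)).div
      (((hasDerivAt_id (0 : ℝ)).mul_const a).const_sub 1) (by simp)
    simpa using! this
  have hev : ∀ᶠ ε : ℝ in 𝓝[≥] 0, ε ∈ Ico (0 : ℝ) 1 := Ico_mem_nhdsGE one_pos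
  -- the first of the two successive mixings
  have h1 : HasDerivWithinAt (fun ε => Φ (mixture m q (r ε)))
      ((1 - a) * ∫ x, D m x ∂(q : Measure X)) (Ici 0) 0 := by
    have hq' := hq m
    rw [← hr0] at hq'
    have hr' : HasDerivWithinAt r (1 - a) (Ico 0 1) 0 := hr.hasDerivWithinAt
    have := HasDerivWithinAt.comp (0 : ℝ) hq' hr' (fun ε hε => by
      rw [hr0]
      exact div_nonneg (mul_nonneg hε.1 (sub_nonneg.2 ha.2)) (by nlinarith [hε.1, hε.2, ha.2]))
    rw [mul_comm] at this
    exact this.mono_of_mem_nhdsWithin hev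
  -- the second one, started from a moving point
  have h2 : HasDerivWithinAt (fun ε => Φ (mixture (mixture m q (r ε)) p (ε * a))
      - Φ (mixture m q (r ε))) (a * ∫ x, D m x ∂(p : Measure X)) (Ici 0) 0 := by
    rw [hasDerivWithinAt_iff_isLittleO, Asymptotics.isLittleO_iff]
    intro c hc
    obtain ⟨δ, hδ, hU⟩ := eventually_abs_slope_integral_sub_le hD m p hc
    have ht : Tendsto (fun ε : ℝ => (mixture m q (r ε), p)) (𝓝[≥] 0) (𝓝 (m, p)) := by
      have hcont : ContinuousAt (fun ε : ℝ => (mixture m q (r ε), p)) 0 := by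
        refine ContinuousAt.prodMk ?_ continuousAt_const
        exact (continuous_mixture.comp (f := fun s : ℝ => (s, m, q)) (by fun_prop)).continuousAt.comp
          hr.continuousAt
      have := hcont.tendsto.mono_left (nhdsWithin_le_nhds (s := Ici 0))
      rwa [hr0, mixture_zero] at this
    have hδ' : ∀ᶠ ε : ℝ in 𝓝[≥] 0, ε ∈ Ico (0 : ℝ) δ := Ico_mem_nhdsGE hδ.1
    filter_upwards [ht.eventually hU, hδ', hev] with ε h3 h4 h5
    have h6 : ε * a ≤ ε := mul_le_of_le_one_right h5.1 ha.2
    have h7 : 0 ≤ ε * a := mul_nonneg h5.1 ha.1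
    have := hp.abs_sub_le hΦ (mixture m q (r ε)) (θ := ε * a)
      ⟨h7, h6.trans h5.2.le⟩ (fun s hs => h3 s ⟨hs.1, by linarith [hs.2, h4.2]⟩)
    simp only [hr0, zero_mul, mixture_zero, sub_self, sub_zero, smul_eq_mul, Real.norm_eq_abs]
    rw [← mul_assoc]
    refine this.trans ?_
    rw [abs_of_nonneg h5.1, mul_comm]
    gcongr
  have h3 := h2.add h1
  have hval : ∫ x, D m x ∂(mixture q p a : Measure X) =
      a * ∫ x, D m x ∂(p : Measure X) + (1 - a) * ∫ x, D m x ∂(q : Measure X) := by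
    rw [integral_mixture (f := D m) (hD.comp (f := fun x => (m, x)) (by fun_prop)) _ _ ha]
    ring
  rw [hval]
  refine h3.congr_of_eventuallyEq_of_mem ?_ self_mem_Ici
  filter_upwards [hev] with ε hε
  rw [mixture_mixture_eq m p q ha ⟨hε.1, hε.2.le⟩ (by nlinarith [hε.1, hε.2, ha.1, ha.2])]
  simp [r]

lemma IsDiffDirection.of_mem_closure (hΦ : Continuous Φ)
    (hD : Continuous fun q : ProbabilityMeasure X × X => D q.1 q.2) {n : ProbabilityMeasure X}
    (hn : n ∈ closure {n | IsDiffDirection Φ D n}) : IsDiffDirection Φ D n := by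
  intro m
  rw [hasDerivWithinAt_iff_isLittleO, Asymptotics.isLittleO_iff]
  intro c hc
  obtain ⟨δ, hδ, hU⟩ := eventually_abs_slope_integral_sub_le hD m n hc
  have hδ' : ∀ᶠ ε : ℝ in 𝓝[≥] 0, ε ∈ Ico (0 : ℝ) δ := Ico_mem_nhdsGE hδ.1
  filter_upwards [hδ'] with θ hθ
  have hU' : ∀ᶠ p : ProbabilityMeasure X in 𝓝 n, ∀ s ∈ Ico (0 : ℝ) δ,
      |(1 - s)⁻¹ * ∫ x, D (mixture m p s) x ∂(p : Measure X)
        - ∫ x, D m x ∂(n : Measure X)| ≤ c :=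
    (Continuous.tendsto (f := fun p : ProbabilityMeasure X => (m, p)) (by fun_prop) n).eventually hU
  have hcl : IsClosed {p | |Φ (mixture m p θ) - Φ m - θ * ∫ x, D m x ∂(n : Measure X)|
      ≤ θ * c} := by
    have : Continuous fun p => Φ (mixture m p θ) :=
      hΦ.comp (continuous_mixture.comp (f := fun p => (θ, m, p)) (by fun_prop))
    exact isClosed_le ((this.sub continuous_const).sub continuous_const).abs continuous_const
  have := hcl.mem_of_frequently_of_tendsto
    ((mem_closure_iff_frequently.1 hn).and_eventually hU' |>.mono fun p hp =>
      IsDiffDirection.abs_sub_le hΦ hp.1 m ⟨hθ.1, hθ.2.le.trans hδ.2⟩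
        fun s hs => hp.2 s ⟨hs.1, hs.2.trans hθ.2⟩) tendsto_id
  simpa [mixture_zero, abs_of_nonneg hθ.1, mul_comm] using this

/-- Any finite convex combination of Dirac masses is a direction of differentiability, as soon as
the Dirac masses are. -/
lemma exists_isDiffDirection_of_mem_stdSimplex (hΦ : Continuous Φ)
    (hD : Continuous fun q : ProbabilityMeasure X × X => D q.1 q.2)
    (hδ : ∀ x, IsDiffDirection Φ D (diracProba x)) {ι : Type*} [Fintype ι] (x : ι → X)
    {a : ι → ℝ} (ha : a ∈ stdSimplex ℝ ι) :
    ∃ n, IsDiffDirection Φ D n ∧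
      ∀ f : C(X, ℝ), ∫ y, f y ∂(n : Measure X) = ∑ i, a i * f (x i) := by
  classical
  have hconv : Convex ℝ {a : ι → ℝ | ∃ n, IsDiffDirection Φ D n ∧
      ∀ f : C(X, ℝ), ∫ y, f y ∂(n : Measure X) = ∑ i, a i * f (x i)} := by
    rintro a ⟨n, hn, hna⟩ a' ⟨n', hn', hna'⟩ u v hu hv huv
    refine ⟨mixture n n' v, isDiffDirection_mixture hΦ hD hn' hn ⟨hv, by linarith⟩,
      fun f => ?_⟩
    rw [integral_mixture f.continuous _ _ ⟨hv, by linarith⟩, hna, hna', Finset.mul_sum,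
      Finset.mul_sum, ← Finset.sum_add_distrib]
    refine Finset.sum_congr rfl fun i _ => ?_
    simp only [Pi.add_apply, Pi.smul_apply, smul_eq_mul]
    rw [show u = 1 - v by linarith]
    ring
  rw [← convexHull_basis_eq_stdSimplex] at ha
  refine convexHull_min ?_ hconv ha
  rintro _ ⟨i, rfl⟩
  refine ⟨diracProba (x i), hδ _, fun f => ?_⟩
  have : ((diracProba (x i) : ProbabilityMeasure X) : Measure X) = Measure.dirac (x i) := rfl
  rw [this, integral_dirac]
  simp [Finset.sum_ite_eq]

/-- If `Φ` is differentiable along Dirac masses with a continuous derivative, then it is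
differentiable along all probability measures: finitely supported measures are dense. -/
theorem isDiffDirection_of_dirac (hΦ : Continuous Φ)
    (hD : Continuous fun q : ProbabilityMeasure X × X => D q.1 q.2)
    (hδ : ∀ x, IsDiffDirection Φ D (diracProba x)) (n : ProbabilityMeasure X) :
    IsDiffDirection Φ D n := by
  refine IsDiffDirection.of_mem_closure hΦ hD ?_
  let := TopologicalSpace.metrizableSpaceMetric X
  -- the laws under `n` of simple functions approximating the identity
  have hs : StronglyMeasurable (id : X → X) := stronglyMeasurable_id
  have hm : ∀ k, AEMeasurable (hs.approx k) (n : Measure X) := fun k =>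
    (hs.approx k).measurable.aemeasurable
  refine mem_closure_of_tendsto (f := fun k => n.map (hm k)) (b := atTop) ?_
    (Eventually.of_forall fun k => ?_)
  · refine ProbabilityMeasure.tendsto_iff_forall_integral_tendsto.2 fun f => ?_
    simp only [ProbabilityMeasure.toMeasure_map]
    have e : ∀ k, ∫ x, f x ∂((n : Measure X).map (hs.approx k)) =
        ∫ x, f (hs.approx k x) ∂(n : Measure X) := fun k =>
      integral_map (hm k) f.continuous.aestronglyMeasurable
    simp only [e]
    refine tendsto_integral_of_dominated_convergence (fun _ => ‖f‖)
      (fun k => (f.continuous.measurable.comp (hs.approx k).measurable).aestronglyMeasurable)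
      (integrable_const _) (fun k => Eventually.of_forall fun x => f.norm_coe_le_norm _)
      (Eventually.of_forall fun x => (f.continuous.tendsto _).comp (hs.tendsto_approx x))
  · set g := hs.approx k
    obtain ⟨p, hp, hpg⟩ := exists_isDiffDirection_of_mem_stdSimplex hΦ hD hδ
      (ι := g.range) (fun y => (y : X)) (a := fun y => (n : Measure X).real (g ⁻¹' {(y : X)}))
      ⟨fun y => measureReal_nonneg, by
        have := SimpleFunc.sum_range_measure_preimage_singleton g (n : Measure X)
        rw [measure_univ] at this
        simp only [Measure.real]
        rw [← ENNReal.toReal_sum (fun _ _ => measure_ne_top _ _),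
          Finset.sum_coe_sort g.range (fun y => (n : Measure X) (g ⁻¹' {y})), this,
          ENNReal.toReal_one]⟩
    have : p = n.map (hm k) := by
      refine ProbabilityMeasure.ext_of_forall_integral fun f => ?_
      rw [hpg, ProbabilityMeasure.toMeasure_map, integral_map (hm k)
        f.continuous.aestronglyMeasurable]
      have h1 : ∀ x, f (g x) = ∑ y : g.range, (g ⁻¹' {(y : X)}).indicator (fun _ => f y) x := by
        intro x
        rw [Finset.sum_eq_single ⟨g x, SimpleFunc.mem_range_self g x⟩]
        · simp
        · rintro ⟨y, hy⟩ - hne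
          refine indicator_of_notMem (fun h => hne ?_) _
          simp only [mem_preimage, mem_singleton_iff] at h
          exact Subtype.ext h.symm
        · simp
      refine Eq.trans ?_ (integral_congr_ae (Eventually.of_forall h1)).symm
      rw [integral_finsetSum _ fun y _ =>
        (integrable_const _).indicator (g.measurableSet_fiber _)]
      refine Finset.sum_congr rfl fun y _ => ?_
      rw [integral_indicator_const _ (g.measurableSet_fiber _), smul_eq_mul]
    exact this ▸ hp

/-- The derivative of a functional has zero integral against the base point, since mixing a measure
with itself does nothing. -/
lemma integral_derivative_self (hΦ : Continuous Φ)
    (hD : Continuous fun q : ProbabilityMeasure X × X => D q.1 q.2)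
    (hδ : ∀ x, IsDiffDirection Φ D (diracProba x)) (m : ProbabilityMeasure X) :
    ∫ x, D m x ∂(m : Measure X) = 0 := by
  have h := isDiffDirection_of_dirac hΦ hD hδ m m
  simp only [mixture_self] at h
  exact (uniqueDiffWithinAt_Ici (0 : ℝ)).eq_deriv _ h (hasDerivWithinAt_const _ _ _)

/-- Mean value inequality for functionals of probability measures. -/
theorem abs_sub_sub_le_of_forall_mixture (hΦ : Continuous Φ)
    (hD : Continuous fun q : ProbabilityMeasure X × X => D q.1 q.2)
    (hδ : ∀ x, IsDiffDirection Φ D (diracProba x)) (m n : ProbabilityMeasure X) {A ε : ℝ}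
    (h : ∀ s ∈ Ico (0 : ℝ) 1, |∫ x, D (mixture m n s) x ∂(n : Measure X)
      - ∫ x, D (mixture m n s) x ∂(m : Measure X) - A| ≤ ε) :
    |Φ n - Φ m - A| ≤ ε := by
  have := (isDiffDirection_of_dirac hΦ hD hδ n).abs_sub_le hΦ m (θ := 1) (A := A) (ε := ε)
    (by simp) (fun s hs => ?_)
  · simpa [mixture_one] using this
  · convert h s hs using 2
    have h0 := integral_derivative_self hΦ hD hδ (mixture m n s)
    rw [integral_mixture (f := D (mixture m n s))
      (hD.comp (f := fun x => (mixture m n s, x)) (by fun_prop)) _ _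
      ⟨hs.1, hs.2.le⟩] at h0
    have h1 : 1 - s ≠ 0 := (sub_pos.2 hs.2).ne'
    field_simp
    linarith

end DirectionalDerivative

/-! ### The du Bois-Reymond lemma -/

section DuBoisReymond

variable {T : ℝ}

lemma integral_Icc_eq_integral_of_tsupport_subset {E : Type*} [NormedAddCommGroup E]
    [NormedSpace ℝ E] (hT : 0 ≤ T) {η : ℝ → ℝ} (h : tsupport η ⊆ Ioo 0 T) (w : ℝ → E) :
    ∫ t in (0 : ℝ)..T, η t • w t = ∫ t, η t • w t := by
  rw [intervalIntegral.integral_of_le hT]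
  refine setIntegral_eq_integral_of_forall_compl_eq_zero fun t ht => ?_
  have : η t = 0 := image_eq_zero_of_notMem_tsupport fun h' => ht ⟨(h h').1, (h h').2.le⟩
  simp [this]

/-- A smooth function of integral zero, compactly supported in `(0, T)`, has a primitive with the
same properties. -/
lemma exists_primitive_tsupport_subset (hT : 0 < T) {η : ℝ → ℝ} (hη : ContDiff ℝ ∞ η)
    (hc : HasCompactSupport η) (hs : tsupport η ⊆ Ioo 0 T) (h0 : ∫ t, η t = 0) :
    ∃ a : ℝ → ℝ, ContDiff ℝ ∞ a ∧ tsupport a ⊆ Ioo 0 T ∧ deriv a = η := by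
  have hd : ∀ t, HasDerivAt (fun t => ∫ r in (0 : ℝ)..t, η r) (η t) t := fun t =>
    intervalIntegral.integral_hasDerivAt_right (hη.continuous.intervalIntegrable _ _)
      (hη.continuous.stronglyMeasurableAtFilter _ _) hη.continuous.continuousAt
  have hder : deriv (fun t => ∫ r in (0 : ℝ)..t, η r) = η := funext fun t => (hd t).deriv
  refine ⟨fun t => ∫ r in (0 : ℝ)..t, η r, ?_, ?_, hder⟩
  · rw [contDiff_infty_iff_deriv, hder]
    exact ⟨fun t => (hd t).differentiableAt, hη⟩
  · obtain ⟨α, β, hα, hβ, hK⟩ : ∃ α β : ℝ, 0 < α ∧ β < T ∧ tsupport η ⊆ Icc α β := by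
      rcases (tsupport η).eq_empty_or_nonempty with he | hne
      · exact ⟨T / 2, T / 2, by linarith, by linarith, by simp [he]⟩
      · have hcK : IsCompact (tsupport η) := hc
        exact ⟨_, _, (hs (hcK.sInf_mem hne)).1, (hs (hcK.sSup_mem hne)).2, fun x hx =>
          ⟨csInf_le hcK.bddBelow hx, le_csSup hcK.bddAbove hx⟩⟩
    have hz : ∀ r, r ∉ Icc α β → η r = 0 := fun r hr =>
      image_eq_zero_of_notMem_tsupport fun h => hr (hK h)
    refine (closure_minimal ?_ isClosed_Icc).trans (Icc_subset_Ioo hα hβ)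
    intro t ht
    by_contra hcon
    refine ht ?_
    rcases lt_or_ge t α with h | h
    · refine (intervalIntegral.integral_congr (g := fun _ => 0) fun r hr => hz r fun h' => ?_).trans
        (by simp)
      have := hr.2
      have : r < α := this.trans_lt (max_lt hα h)
      linarith [h'.1]
    · have hβt : β < t := by by_contra h'; exact hcon ⟨h, not_lt.1 h'⟩
      by_cases ht0 : 0 ≤ t
      · refine Eq.trans ?_ h0
        simp only
        rw [intervalIntegral.integral_of_le ht0]
        refine setIntegral_eq_integral_of_forall_compl_eq_zero fun r hr => hz r fun h' => hr
          ⟨hα.trans_le h'.1, h'.2.trans hβt.le⟩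
      · linarith

lemma eq_add_integral_of_forall_integral_deriv_mul_add (hT : 0 < T) {u v : ℝ → ℝ}
    (hu : ContinuousOn u (Icc 0 T)) (hv : ContinuousOn v (Icc 0 T))
    (h : ∀ a : ℝ → ℝ, ContDiff ℝ ∞ a → tsupport a ⊆ Ioo 0 T →
      ∫ t in (0 : ℝ)..T, (deriv a t * u t + a t * v t) = 0) :
    ∀ t ∈ Icc 0 T, u t = u 0 + ∫ r in (0 : ℝ)..t, v r := by
  set u' : ℝ → ℝ := fun t => u (projIcc 0 T hT.le t) with hu'
  set v' : ℝ → ℝ := fun t => v (projIcc 0 T hT.le t) with hv'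
  have hpu : ∀ t ∈ Icc 0 T, u' t = u t := fun t ht => by simp [hu', projIcc_of_mem _ ht]
  have hpv : ∀ t ∈ Icc 0 T, v' t = v t := fun t ht => by simp [hv', projIcc_of_mem _ ht]
  have hcu : Continuous u' := hu.comp_continuous (continuous_subtype_val.comp continuous_projIcc)
    fun t => (projIcc 0 T hT.le t).2
  have hcv : Continuous v' := hv.comp_continuous (continuous_subtype_val.comp continuous_projIcc)
    fun t => (projIcc 0 T hT.le t).2
  set V : ℝ → ℝ := fun t => ∫ r in (0 : ℝ)..t, v' r with hV
  have hVd : ∀ t, HasDerivAt V (v' t) t := fun t =>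
    intervalIntegral.integral_hasDerivAt_right (hcv.intervalIntegrable _ _)
      (hcv.stronglyMeasurableAtFilter _ _) hcv.continuousAt
  have hVc : Continuous V := continuous_iff_continuousAt.2 fun t => (hVd t).continuousAt
  set w : ℝ → ℝ := fun t => u' t - V t with hw
  have hwc : Continuous w := hcu.sub hVc
  have hwz : ∀ η : ℝ → ℝ, ContDiff ℝ ∞ η → HasCompactSupport η → tsupport η ⊆ Ioo 0 T →
      ∫ t, η t = 0 → ∫ t, η t * w t = 0 := by
    intro η hη hηc hηs hη0
    obtain ⟨a, ha, has, hda⟩ := exists_primitive_tsupport_subset hT hη hηc hηs hη0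
    have h1 := h a ha has
    have ha0 : a 0 = 0 := image_eq_zero_of_notMem_tsupport fun h' => (has h').1.false
    have haT : a T = 0 := image_eq_zero_of_notMem_tsupport fun h' => (has h').2.false
    have hda' : ∀ t, HasDerivAt a (η t) t := fun t => hda ▸
      (ha.differentiable (by simp) t).hasDerivAt
    have h2 := intervalIntegral.integral_deriv_mul_eq_sub (a := 0) (b := T)
      (fun t _ => hda' t) (fun t _ => hVd t) (hη.continuous.intervalIntegrable _ _)
      (hcv.intervalIntegrable _ _)
    rw [ha0, haT, zero_mul, zero_mul, sub_zero] at h2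
    rw [hda] at h1
    have h3 : ∫ t in (0 : ℝ)..T, (η t * u t + a t * v t) =
        ∫ t in (0 : ℝ)..T, (η t * u' t + a t * v' t) := by
      refine intervalIntegral.integral_congr fun t ht => ?_
      rw [uIcc_of_le hT.le] at ht
      simp only [hpu t ht, hpv t ht]
    rw [h3] at h1
    have hac := ha.continuous
    have hηcont := hη.continuous
    have h4 : ∫ t in (0 : ℝ)..T, η t * w t = 0 := by
      have : ∀ t, η t * w t = (η t * u' t + a t * v' t) - (η t * V t + a t * v' t) := fun t => by
        simp only [hw]; ring
      simp only [this]
      rw [intervalIntegral.integral_sub (Continuous.intervalIntegrable (by fun_prop) _ _)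
        (Continuous.intervalIntegrable (by fun_prop) _ _), h1, h2, sub_zero]
    rw [← h4]
    exact (integral_Icc_eq_integral_of_tsupport_subset hT.le hηs w).symm
  -- a fixed bump function of integral one
  let f : ContDiffBump (T / 2) := ⟨T / 8, T / 4, by positivity, by linarith⟩
  set ρ : ℝ → ℝ := f.normed volume
  have hρ : ContDiff ℝ ∞ ρ := f.contDiff_normed
  have hρ1 : ∫ t, ρ t = 1 := f.integral_normed
  have hρc : HasCompactSupport ρ := f.hasCompactSupport_normed
  have hρs : tsupport ρ ⊆ Ioo 0 T := by
    rw [f.tsupport_normed_eq]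
    intro x hx
    have hx' : |x - T / 2| ≤ T / 4 := by rwa [Metric.mem_closedBall, Real.dist_eq] at hx
    rw [abs_le] at hx'
    constructor <;> linarith
  set c : ℝ := ∫ t, ρ t * w t
  have hcs : ∀ η : ℝ → ℝ, ContDiff ℝ ∞ η → HasCompactSupport η → ∀ z : ℝ → ℝ, Continuous z →
      Integrable (fun t => η t * z t) := fun η hη hηc z hz =>
    (hη.continuous.mul hz).integrable_of_hasCompactSupport hηc.mul_right
  have hρi : Integrable ρ := by simpa using hcs ρ hρ hρc (fun _ => 1) continuous_const
  have hae : ∀ᵐ t, t ∈ Ioo 0 T → w t - c = 0 := by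
    refine isOpen_Ioo.ae_eq_zero_of_integral_contDiff_smul_eq_zero
      ((hwc.sub continuous_const).locallyIntegrable.locallyIntegrableOn _) fun η hη hηc hηs => ?_
    have hint := hcs η hη hηc (fun _ => 1) continuous_const
    have h1 := hwz (fun t => η t - (∫ r, η r) * ρ t) (hη.sub (contDiff_const.mul hρ))
      (hηc.sub hρc.mul_left) ((tsupport_sub _ _).trans (union_subset hηs
        ((closure_mono (Function.support_mul_subset_right _ _)).trans hρs))) (by
        rw [integral_sub (by simpa using hint) (hρi.const_mul _), integral_const_mul, hρ1]
        ring)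
    simp only [sub_mul, mul_assoc] at h1
    rw [integral_sub (hcs η hη hηc w hwc) ((hcs ρ hρ hρc w hwc).const_mul _),
      integral_const_mul] at h1
    simp only [smul_eq_mul, mul_sub]
    rw [integral_sub (hcs η hη hηc w hwc) (hcs η hη hηc _ continuous_const), integral_mul_const]
    exact h1
  have hEq : EqOn w (fun _ => c) (Icc 0 T) := by
    refine Measure.eqOn_Icc_of_ae_eq (μ := volume) hT.ne ?_ hwc.continuousOn continuousOn_const
    rw [restrict_Ioo_eq_restrict_Icc.symm]
    refine (ae_restrict_iff' measurableSet_Ioo).2 ?_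
    filter_upwards [hae] with t ht h' using sub_eq_zero.1 (ht h')
  intro t ht
  have h1 := hEq ht
  have h2 := hEq (left_mem_Icc.2 hT.le)
  simp only [hw, hV, intervalIntegral.integral_same, sub_zero, hpu _ ht,
    hpu _ (left_mem_Icc.2 hT.le)] at h1 h2
  have h3 : ∫ r in (0 : ℝ)..t, v' r = ∫ r in (0 : ℝ)..t, v r := by
    refine intervalIntegral.integral_congr fun r hr => hpv r ?_
    rw [uIcc_of_le ht.1] at hr
    exact ⟨hr.1, hr.2.trans ht.2⟩
  rw [h3] at h1
  linarith

end DuBoisReymond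

/-! ### Solutions of the Fokker-Planck equation -/

section FokkerPlanck

variable {d : ℕ} {σ T : ℝ} {b : ℝ → Torus d → Fin d → ℝ}
  {m₀ : ProbabilityMeasure (Torus d)} {m : ℝ → ProbabilityMeasure (Torus d)} {g : Torus d → ℝ}

open Torus

lemma Torus.Smooth.generator_const_mul {β : Torus d → Fin d → ℝ} (hg : Smooth g) (c : ℝ)
    (x : Torus d) : generator σ β (fun x => c * g x) x = c * generator σ β g x := by
  simpa using Smooth.generator_add (σ := σ) (β := β) hg hg c 0 x

/-- Integrals of smooth families against a continuous curve of measures are continuous in time. -/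
lemma continuousOn_integral_curve {f : ℝ → Torus d → ℝ} (hf : SmoothOnCylinder T f)
    (hm : ContinuousOn m (Icc 0 T)) :
    ContinuousOn (fun t => ∫ x, f t x ∂(m t : Measure (Torus d))) (Icc 0 T) :=
  (continuousOn_integral_parametric hf.continuousOn).comp (f := fun t => (t, m t))
    (continuousOn_id.prodMk hm) fun _ ht => ⟨ht, mem_univ _⟩

/-- Along a distributional solution, the integral of a smooth function is a primitive of the
integral of its image by the generator. -/
lemma IsFokkerPlanckSolution.integral_sub_integral (hT : 0 < T) (hb : SmoothOnCylinder T b)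
    (hm : IsFokkerPlanckSolution σ T b m₀ m) (hg : Smooth g) {s t : ℝ} (hs : s ∈ Icc 0 T)
    (ht : t ∈ Icc 0 T) :
    ∫ x, g x ∂(m t : Measure (Torus d)) - ∫ x, g x ∂(m s : Measure (Torus d)) =
      ∫ r in s..t, ∫ x, generator σ (b r) g x ∂(m r : Measure (Torus d)) := by
  have hgc := hg.smoothOnCylinder T
  have hLc := hb.generator hT σ hgc
  have hv := continuousOn_integral_curve hLc hm.continuousOn
  have key := eq_add_integral_of_forall_integral_deriv_mul_add hT
    (u := fun t => ∫ x, g x ∂(m t : Measure (Torus d)))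
    (v := fun t => ∫ x, generator σ (b t) g x ∂(m t : Measure (Torus d)))
    (continuousOn_integral_curve hgc hm.continuousOn) hv (fun a ha has => by
    refine Eq.trans ?_ (hm.distrib (fun t x => a t * g x) ?_ ?_)
    · refine intervalIntegral.integral_congr fun t ht => ?_
      rw [uIcc_of_le hT.le] at ht
      have h1 : ∀ x, deriv (fun s => a s * g x) t = deriv a t * g x := fun x =>
        ((ha.differentiable (by simp) t).hasDerivAt.mul_const _).deriv
      simp only [h1, hg.generator_const_mul]
      rw [integral_add ((hg.continuous.const_mul _).integrable_of_compactSpace _)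
        (((hLc.continuous ht).const_mul _).integrable_of_compactSpace _), integral_const_mul,
        integral_const_mul]
    · exact (ha.comp contDiff_fst).mul (hg.comp contDiff_snd)
    · refine (closure_minimal (t := tsupport a ×ˢ univ) ?_
        ((isClosed_tsupport a).prod isClosed_univ)).trans (prod_mono has subset_rfl)
      rintro ⟨t, x⟩ h
      exact ⟨subset_tsupport a (left_ne_zero_of_mul h), mem_univ _⟩)
  have hint : ∀ t ∈ Icc 0 T, IntervalIntegrable
      (fun r => ∫ x, generator σ (b r) g x ∂(m r : Measure (Torus d))) volume 0 t := fun t ht =>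
    (hv.mono (Icc_subset_Icc_right ht.2)).intervalIntegrable_of_Icc ht.1
  rw [key t ht, key s hs, ← intervalIntegral.integral_interval_sub_left (hint t ht) (hint s hs)]
  ring

/-- A curve of measures satisfies the Fokker-Planck equation to first order: on short intervals,
increments of integrals of smooth functions are given by the generator, up to a small error. -/
def IsFlowCurve (σ T : ℝ) (b : ℝ → Torus d → Fin d → ℝ)
    (m : ℝ → ProbabilityMeasure (Torus d)) : Prop :=
  ∀ g : Torus d → ℝ, Smooth g → ∀ ε > 0, ∃ δ > 0, ∀ s ∈ Icc 0 T, ∀ t ∈ Icc 0 T, s ≤ t →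
    t - s ≤ δ → |∫ x, g x ∂(m t : Measure (Torus d)) - ∫ x, g x ∂(m s : Measure (Torus d))
      - (t - s) * ∫ x, generator σ (b s) g x ∂(m s : Measure (Torus d))| ≤ ε * (t - s)

lemma abs_integral_sub_integral_le {f g : Torus d → ℝ} {C : ℝ} (hf : Continuous f)
    (hg : Continuous g) (h : ∀ x, |f x - g x| ≤ C) (n : ProbabilityMeasure (Torus d)) :
    |∫ x, f x ∂(n : Measure (Torus d)) - ∫ x, g x ∂(n : Measure (Torus d))| ≤ C := by
  rw [← integral_sub (hf.integrable_of_compactSpace _) (hg.integrable_of_compactSpace _)]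
  exact abs_integral_le_of_forall_abs_le h n

/-- Solutions of the Fokker-Planck equation satisfy the first order expansion of `IsFlowCurve`,
uniformly over all solutions. -/
lemma exists_uniform_expansion (hT : 0 < T) (hb : SmoothOnCylinder T b) (hg : Smooth g)
    {ε : ℝ} (hε : 0 < ε) :
    ∃ δ > 0, ∀ m₀ m, IsFokkerPlanckSolution σ T b m₀ m → ∀ s ∈ Icc 0 T, ∀ t ∈ Icc 0 T, s ≤ t →
    t - s ≤ δ → |∫ x, g x ∂(m t : Measure (Torus d)) - ∫ x, g x ∂(m s : Measure (Torus d))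
      - (t - s) * ∫ x, generator σ (b s) g x ∂(m s : Measure (Torus d))| ≤ ε * (t - s) := by
  have hgc := hg.smoothOnCylinder T
  have hLc := hb.generator hT σ hgc
  obtain ⟨C, hC0, hC⟩ := hb.exists_bound_generator hT σ hLc
  obtain ⟨δ, hδ, H⟩ := hLc.uniform_time (half_pos hε)
  refine ⟨min δ (ε / 2 / (C + 1)), by positivity, fun m₀ m hm s hs t ht hst hle => ?_⟩
  have hv := continuousOn_integral_curve hLc hm.continuousOn
  have hsub : Icc s t ⊆ Icc 0 T := Icc_subset_Icc hs.1 ht.2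
  have hint := (hv.mono hsub).intervalIntegrable_of_Icc (μ := volume) hst
  rw [hm.integral_sub_integral hT hb hg hs ht, ← smul_eq_mul (t - s),
    ← intervalIntegral.integral_const, ← intervalIntegral.integral_sub hint
      intervalIntegrable_const]
  have := intervalIntegral.norm_integral_le_of_norm_le_const (a := s) (b := t) (C := ε)
    (f := fun r => ∫ x, generator σ (b r) g x ∂(m r : Measure (Torus d)) -
      ∫ x, generator σ (b s) g x ∂(m s : Measure (Torus d))) (fun r hr => ?_)
  · rwa [Real.norm_eq_abs, abs_of_nonneg (sub_nonneg.2 hst)] at this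
  rw [uIoc_of_le hst] at hr
  have hr' : r ∈ Icc 0 T := hsub ⟨hr.1.le, hr.2⟩
  have h1 := abs_integral_sub_integral_le (hLc.continuous hr') (hLc.continuous hs)
    (H s hs r hr' (by
      rw [abs_of_nonneg (by linarith [hr.1])]
      exact (by linarith [hr.2] : r - s ≤ t - s).trans (hle.trans (min_le_left _ _)))) (m r)
  have h2 := hm.integral_sub_integral hT hb (hLc.smooth hs) hs hr'
  have h3 := intervalIntegral.norm_integral_le_of_norm_le_const (a := s) (b := r) (C := C)
    (f := fun q => ∫ x, generator σ (b q) (generator σ (b s) g) x ∂(m q : Measure (Torus d)))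
    (fun q hq => by
      rw [uIoc_of_le hr.1.le] at hq
      exact abs_integral_le_of_forall_abs_le
        (fun x => hC q (hsub ⟨hq.1.le, hq.2.trans hr.2⟩) s hs x) _)
  rw [← h2, Real.norm_eq_abs, abs_of_nonneg (sub_nonneg.2 hr.1.le)] at h3
  have h4 : C * (r - s) ≤ ε / 2 := by
    have h5 : r - s ≤ ε / 2 / (C + 1) := by
      linarith [hr.2, hle.trans (min_le_right δ (ε / 2 / (C + 1)))]
    rw [le_div_iff₀ (by positivity)] at h5
    nlinarith [hr.1]
  rw [Real.norm_eq_abs]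
  calc _ ≤ _ := abs_sub_le _ (∫ x, generator σ (b s) g x ∂(m r : Measure (Torus d))) _
    _ ≤ ε / 2 + ε / 2 := add_le_add h1 (h3.trans h4)
    _ = ε := by ring

end FokkerPlanck

/-! ### Chain rule along solutions -/

section ChainRule

lemma ContinuousOn.multilinearMap_apply {Z E F : Type*} [TopologicalSpace Z]
    [NormedAddCommGroup E] [NormedSpace ℝ E] [NormedAddCommGroup F] [NormedSpace ℝ F] {k : ℕ}
    {s : Set Z} {A : Z → ContinuousMultilinearMap ℝ (fun _ : Fin k => E) F}
    (hA : ContinuousOn A s) (v : Fin k → E) : ContinuousOn (fun z => A z v) s :=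
  (ContinuousMultilinearMap.apply ℝ (fun _ : Fin k => E) F v).continuous.comp_continuousOn hA

/-- The chain rule for a function of time and of a moving point, when only the partial map
`r ↦ f t (y r)` is known to be differentiable from the right at `r = t`. -/
lemma hasDerivWithinAt_moving {Y : Type*} [TopologicalSpace Y] {T t B : ℝ} {f f' : ℝ → Y → ℝ}
    {y : ℝ → Y} (hf' : ContinuousOn (fun q : ℝ × Y => f' q.1 q.2) (Icc 0 T ×ˢ univ))
    (hf : ∀ z, ∀ t ∈ Icc 0 T, HasDerivWithinAt (fun s => f s z) (f' t z) (Icc 0 T) t)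
    (hy : ContinuousOn y (Icc 0 T)) (ht : t ∈ Ico 0 T)
    (hB : HasDerivWithinAt (fun r => f t (y r)) B (Ici t) t) :
    HasDerivWithinAt (fun r => f r (y r)) (f' t (y t) + B) (Ici t) t := by
  have htT : t ∈ Icc 0 T := Ico_subset_Icc_self ht
  have hnhds : 𝓝[≥] t ≤ 𝓝[Icc 0 T] t := by
    rw [← nhdsWithin_Icc_eq_nhdsGE ht.2]
    exact nhdsWithin_mono _ (Icc_subset_Icc_left ht.1)
  have h1 : HasDerivWithinAt (fun r => f r (y r) - f t (y r)) (f' t (y t)) (Ici t) t := by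
    rw [hasDerivWithinAt_iff_isLittleO, Asymptotics.isLittleO_iff]
    intro c hc
    have hat := hf' (t, y t) ⟨htT, mem_univ _⟩
    unfold ContinuousWithinAt at hat
    rw [nhdsWithin_prod_eq, nhdsWithin_univ] at hat
    obtain ⟨pa, hpa, pb, hpb, H⟩ := eventually_prod_iff.1 (Metric.tendsto_nhds.1 hat c hc)
    obtain ⟨u, hu, hpu⟩ := (mem_nhdsGE_iff_exists_Ico_subset).1 (hnhds hpa)
    have hyt : ∀ᶠ r in 𝓝[≥] t, pb (y r) := hnhds ((hy t htT).eventually hpb)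
    filter_upwards [hyt, Ico_mem_nhdsGE hu, Ico_mem_nhdsGE ht.2] with r hr hru hrT
    have hsub : Icc t r ⊆ Icc 0 T := Icc_subset_Icc ht.1 hrT.2.le
    have := Convex.norm_image_sub_le_of_norm_hasDerivWithin_le (s := Icc t r) (C := c)
      (f := fun q => f q (y r) - q * f' t (y t)) (f' := fun q => f' q (y r) - f' t (y t))
      (fun q hq => by
        have := ((hf (y r) q (hsub hq)).mono hsub).sub
          ((hasDerivWithinAt_id q (Icc t r)).mul_const (f' t (y t)))
        simpa using! this)
      (fun q hq => (H (hpu ⟨hq.1, hq.2.trans_lt hru.2⟩) hr).le) (convex_Icc _ _)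
      (left_mem_Icc.2 hru.1) (right_mem_Icc.2 hru.1)
    convert this using 2
    simp only [smul_eq_mul]
    ring
  refine (h1.add hB).congr_of_eventuallyEq_of_mem (Eventually.of_forall fun r => ?_) self_mem_Ici
  simp

variable {d : ℕ} {σ T : ℝ} {b : ℝ → Torus d → Fin d → ℝ}
  {m₀ : ProbabilityMeasure (Torus d)} {m : ℝ → ProbabilityMeasure (Torus d)} {g : Torus d → ℝ}
  {φ : ℝ → ProbabilityMeasure (Torus d) → ℝ}

open Torus

lemma IsSmoothTestFunction.continuousOn (hφ : IsSmoothTestFunction T φ) :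
    ContinuousOn (fun q : ℝ × ProbabilityMeasure (Torus d) => φ q.1 q.2) (Icc 0 T ×ˢ univ) := by
  simpa using hφ.continuous_time 0

lemma IsSmoothTestFunction.continuousOn_derivWithin (hφ : IsSmoothTestFunction T φ) :
    ContinuousOn (fun q : ℝ × ProbabilityMeasure (Torus d) =>
      derivWithin (fun t => φ t q.2) (Icc 0 T) q.1) (Icc 0 T ×ˢ univ) := by
  simpa [iteratedDerivWithin_one] using hφ.continuous_time 1

lemma IsSmoothTestFunction.hasDerivWithinAt (hφ : IsSmoothTestFunction T φ)
    (n : ProbabilityMeasure (Torus d)) {t : ℝ} (ht : t ∈ Icc 0 T) :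
    HasDerivWithinAt (fun s => φ s n) (derivWithin (fun s => φ s n) (Icc 0 T) t) (Icc 0 T) t :=
  ((hφ.smooth_time n).differentiableOn (by simp) t ht).hasDerivWithinAt

lemma IsSmoothTestFunction.continuous (hφ : IsSmoothTestFunction T φ) {t : ℝ}
    (ht : t ∈ Icc 0 T) : Continuous (φ t) :=
  hφ.continuousOn.comp_continuous (f := fun n => (t, n)) (by fun_prop) fun _ => ⟨ht, mem_univ _⟩

lemma IsSmoothTestFunction.continuousOn_iteratedFDerivWithin_gradM
    (hφ : IsSmoothTestFunction T φ) (k : ℕ) (v : Fin k → ℝ × (Fin d → ℝ)) :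
    ContinuousOn (fun q : (ℝ × ProbabilityMeasure (Torus d)) × (Fin d → ℝ) =>
      iteratedFDerivWithin ℝ k (fun p : ℝ × (Fin d → ℝ) => gradM (φ p.1) q.1.2 (proj p.2))
        (Icc 0 T ×ˢ univ) (q.1.1, q.2) v) ((Icc 0 T ×ˢ univ) ×ˢ univ) := by
  have hf : ContinuousOn (fun q : (ℝ × ProbabilityMeasure (Torus d)) × (Fin d → ℝ) =>
     (q.1.2, (q.1.1, q.2))) ((Icc 0 T ×ˢ univ) ×ˢ univ) := by fun_prop
  have hm : MapsTo (fun q : (ℝ × ProbabilityMeasure (Torus d)) × (Fin d → ℝ) =>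
     (q.1.2, (q.1.1, q.2))) ((Icc 0 T ×ˢ univ) ×ˢ univ) (univ ×ˢ (Icc 0 T ×ˢ univ)) :=
    fun q hq => ⟨mem_univ _, hq.1.1, mem_univ _⟩
  have h := (hφ.continuous_gradM k).comp hf hm
  exact h.multilinearMap_apply v

lemma IsSmoothTestFunction.continuousOn_gradM (hφ : IsSmoothTestFunction T φ) :
    ContinuousOn (fun q : (ℝ × ProbabilityMeasure (Torus d)) × Torus d =>
      gradM (φ q.1.1) q.1.2 q.2) ((Icc 0 T ×ˢ univ) ×ˢ univ) := by
  refine continuousOn_of_continuousOn_proj (s := Icc 0 T ×ˢ univ)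
    (G := fun (z : ℝ × ProbabilityMeasure (Torus d)) x => gradM (φ z.1) z.2 x) ?_
  refine (hφ.continuousOn_iteratedFDerivWithin_gradM 0 0).congr fun q _ => ?_
  beta_reduce
  rw [iteratedFDerivWithin_zero_apply]

lemma IsSmoothTestFunction.continuousOn_generator_gradM (hT : 0 < T) (hb : SmoothOnCylinder T b)
    (hφ : IsSmoothTestFunction T φ) :
    ContinuousOn (fun q : (ℝ × ℝ × ProbabilityMeasure (Torus d)) × Torus d =>
      generator σ (b q.1.1) (gradM (φ q.1.2.1) q.1.2.2) q.2)
      ((Icc 0 T ×ˢ (Icc 0 T ×ˢ univ)) ×ˢ univ) := by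
  have hpull : ∀ {F : (ℝ × ProbabilityMeasure (Torus d)) × Torus d → ℝ},
      ContinuousOn F ((Icc 0 T ×ˢ univ) ×ˢ univ) →
      ContinuousOn (fun q : (ℝ × ℝ × ProbabilityMeasure (Torus d)) × Torus d => F (q.1.2, q.2))
        ((Icc 0 T ×ˢ (Icc 0 T ×ˢ univ)) ×ˢ univ) := fun hF =>
    hF.comp (by fun_prop) fun q hq => ⟨hq.1.2, mem_univ _⟩
  have h1 : ∀ i : Fin d, ContinuousOn (fun q : (ℝ × ProbabilityMeasure (Torus d)) × Torus d =>
      partialDeriv i (gradM (φ q.1.1) q.1.2) q.2) ((Icc 0 T ×ˢ univ) ×ˢ univ) := fun i => by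
    refine continuousOn_of_continuousOn_proj
      (s := Icc 0 T ×ˢ univ)
      (G := fun (z : ℝ × ProbabilityMeasure (Torus d)) x => partialDeriv i (gradM (φ z.1) z.2) x) ?_
    refine (hφ.continuousOn_iteratedFDerivWithin_gradM 1
      (fun _ => (0, Pi.single i 1))).congr fun q hq => ?_
    exact (hφ.smooth_gradM q.1.2).partialDeriv_eq_iteratedFDerivWithin hT hq.1.1 i q.2
  have h2 : ∀ i : Fin d, ContinuousOn (fun q : (ℝ × ProbabilityMeasure (Torus d)) × Torus d =>
      partialDeriv i (partialDeriv i (gradM (φ q.1.1) q.1.2)) q.2)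
      ((Icc 0 T ×ˢ univ) ×ˢ univ) := fun i => by
    refine continuousOn_of_continuousOn_proj
      (s := Icc 0 T ×ˢ univ)
      (G := fun (z : ℝ × ProbabilityMeasure (Torus d)) x =>
        partialDeriv i (partialDeriv i (gradM (φ z.1) z.2)) x) ?_
    refine (hφ.continuousOn_iteratedFDerivWithin_gradM 2
      (fun _ => (0, Pi.single i 1))).congr fun q hq => ?_
    exact (hφ.smooth_gradM q.1.2).partialDeriv_partialDeriv_eq_iteratedFDerivWithin hT hq.1.1 i q.2
  have h3 : ∀ i : Fin d, ContinuousOn (fun q : (ℝ × ℝ × ProbabilityMeasure (Torus d)) × Torus d =>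
      b q.1.1 q.2 i) ((Icc 0 T ×ˢ (Icc 0 T ×ˢ univ)) ×ˢ univ) := fun i =>
    (hb.component i).continuousOn.comp (t := Icc 0 T ×ˢ univ)
      (f := fun q : (ℝ × ℝ × ProbabilityMeasure (Torus d)) × Torus d => (q.1.1, q.2))
      (by fun_prop) (fun q hq => ⟨hq.1.1, mem_univ _⟩)
  exact (continuousOn_const.mul (continuousOn_finsetSum _ fun i _ => hpull (h2 i))).add
    (continuousOn_finsetSum _ fun i _ => (h3 i).mul (hpull (h1 i)))

lemma IsSmoothTestFunction.isDiffDirection_dirac (hφ : IsSmoothTestFunction T φ) {t : ℝ}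
    (ht : t ∈ Icc 0 T) (x : Torus d) :
    IsDiffDirection (φ t) (gradM (φ t)) (diracProba x) := by
  intro n
  obtain ⟨l, hl⟩ := hφ.exists_gradM t ht n x
  have hne : (𝓝[>] (0 : unitInterval)).NeBot := nhdsGT_neBot_of_exists_gt ⟨1, zero_lt_one⟩
  have hl' : Tendsto (diracQuotient (φ t) n x) (𝓝[>] (0 : unitInterval))
      (𝓝 (gradM (φ t) n x)) := tendsto_nhds_limUnder ⟨l, hl⟩
  have hint : ∫ y, gradM (φ t) n y ∂((diracProba x : ProbabilityMeasure (Torus d)) :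
      Measure (Torus d)) = gradM (φ t) n x := integral_dirac _ _
  rw [hint, hasDerivWithinAt_iff_tendsto_slope, Ici_sdiff_left]
  have hcomp : Tendsto (projIcc (0 : ℝ) 1 zero_le_one) (𝓝[>] 0) (𝓝[>] (0 : unitInterval)) := by
    refine tendsto_nhdsWithin_iff.2 ⟨?_, ?_⟩
    · have := (continuous_projIcc (h := zero_le_one (α := ℝ))).tendsto 0
      rw [projIcc_left] at this
      exact this.mono_left nhdsWithin_le_nhds
    · filter_upwards [Ioo_mem_nhdsGT (zero_lt_one (α := ℝ))] with s hs
      rw [projIcc_of_mem _ ⟨hs.1.le, hs.2.le⟩]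
      exact hs.1
  refine (hl'.comp hcomp).congr' ?_
  filter_upwards [Ioo_mem_nhdsGT (zero_lt_one (α := ℝ))] with s hs
  have hp : ((projIcc (0 : ℝ) 1 zero_le_one s : unitInterval) : ℝ) = s := by
    rw [projIcc_of_mem _ ⟨hs.1.le, hs.2.le⟩]
  simp only [Function.comp, diracQuotient, mixDirac_eq_mixture, hp, slope_def_field, sub_zero,
    mixture_zero]

/-- A smooth test function is differentiable along solutions of the Fokker-Planck equation. -/
lemma IsSmoothTestFunction.hasDerivWithinAt_curve (hT : 0 < T) (hb : SmoothOnCylinder T b)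
    (hφ : IsSmoothTestFunction T φ) (hm : IsFokkerPlanckSolution σ T b m₀ m) {t : ℝ}
    (ht : t ∈ Ico 0 T) :
    HasDerivWithinAt (fun r => φ t (m r))
      (∫ x, generator σ (b t) (gradM (φ t) (m t)) x ∂(m t : Measure (Torus d))) (Ici t) t := by
  have htT : t ∈ Icc 0 T := Ico_subset_Icc_self ht
  have hnhds : 𝓝[≥] t ≤ 𝓝[Icc 0 T] t := by
    rw [← nhdsWithin_Icc_eq_nhdsGE ht.2]
    exact nhdsWithin_mono _ (Icc_subset_Icc_left ht.1)
  have hD : Continuous fun q : ProbabilityMeasure (Torus d) × Torus d => gradM (φ t) q.1 q.2 :=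
    hφ.continuousOn_gradM.comp_continuous
      (f := fun q : ProbabilityMeasure (Torus d) × Torus d => ((t, q.1), q.2)) (by fun_prop)
      fun q => ⟨⟨htT, mem_univ _⟩, mem_univ _⟩
  set H : ℝ → ProbabilityMeasure (Torus d) → ProbabilityMeasure (Torus d) → ℝ := fun r n n' =>
    ∫ x, generator σ (b r) (gradM (φ t) n) x ∂(n' : Measure (Torus d)) with hH
  have hHc : ContinuousOn (fun q : (ℝ × ProbabilityMeasure (Torus d)) ×
      ProbabilityMeasure (Torus d) => H q.1.1 q.1.2 q.2) ((Icc 0 T ×ˢ univ) ×ˢ univ) := by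
    refine continuousOn_integral_parametric (s := Icc 0 T ×ˢ univ)
      (G := fun (z : ℝ × ProbabilityMeasure (Torus d)) x =>
        generator σ (b z.1) (gradM (φ t) z.2) x) ?_
    have hf : ContinuousOn (fun q : (ℝ × ProbabilityMeasure (Torus d)) × Torus d =>
        ((q.1.1, t, q.1.2), q.2)) ((Icc 0 T ×ˢ univ) ×ˢ univ) := by fun_prop
    have hmaps : MapsTo (fun q : (ℝ × ProbabilityMeasure (Torus d)) × Torus d =>
        ((q.1.1, t, q.1.2), q.2)) ((Icc 0 T ×ˢ univ) ×ˢ univ)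
        ((Icc 0 T ×ˢ (Icc 0 T ×ˢ univ)) ×ˢ univ) :=
      fun q hq => ⟨⟨hq.1.1, htT, mem_univ _⟩, mem_univ _⟩
    have h := (hφ.continuousOn_generator_gradM (σ := σ) hT hb).comp hf hmaps
    exact h
  rw [hasDerivWithinAt_iff_isLittleO, Asymptotics.isLittleO_iff]
  intro c hc
  have hat := hHc ((t, m t), m t) ⟨⟨htT, mem_univ _⟩, mem_univ _⟩
  unfold ContinuousWithinAt at hat
  rw [nhdsWithin_prod_eq, nhdsWithin_univ, nhdsWithin_prod_eq, nhdsWithin_univ] at hat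
  obtain ⟨pab, hpab, pc, hpc, K⟩ := eventually_prod_iff.1 (Metric.tendsto_nhds.1 hat c hc)
  obtain ⟨pa, hpa, pb, hpb, K'⟩ := eventually_prod_iff.1 hpab
  have hmt : Tendsto m (𝓝[≥] t) (𝓝 (m t)) := (hm.continuousOn t htT).mono_left hnhds
  -- the whole segment from `m t` to `m r` is close to `m t`
  have htube : ∀ᶠ n in 𝓝 (m t), ∀ s ∈ Icc (0 : ℝ) 1, pb (mixture (m t) n s) := by
    refine isCompact_Icc.eventually_forall_of_forall_eventually fun s _ => ?_
    have hc : Continuous fun z : ProbabilityMeasure (Torus d) × ℝ => mixture (m t) z.1 z.2 :=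
      continuous_mixture.comp (f := fun z : ProbabilityMeasure (Torus d) × ℝ =>
        (z.2, m t, z.1)) (by fun_prop)
    have := hc.tendsto (m t, s)
    simp only [mixture_self] at this
    exact this.eventually hpb
  obtain ⟨u, hu, hpu⟩ := (mem_nhdsGE_iff_exists_Ico_subset).1
    (inter_mem (hnhds hpa) (hmt.eventually hpc))
  filter_upwards [hmt.eventually htube, Ico_mem_nhdsGE hu, Ico_mem_nhdsGE ht.2] with r hr hru hrT
  have hrI : r ∈ Icc 0 T := ⟨ht.1.trans hrT.1, hrT.2.le⟩
  have hsub : Icc t r ⊆ Icc 0 T := Icc_subset_Icc ht.1 hrT.2.le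
  have := abs_sub_sub_le_of_forall_mixture (hφ.continuous htT) hD (hφ.isDiffDirection_dirac htT)
    (m t) (m r) (A := (r - t) * H t (m t) (m t)) (ε := c * (r - t)) (fun s hs => by
      have hg : Smooth (gradM (φ t) (mixture (m t) (m r) s)) := (hφ.smooth_gradM _).smooth htT
      have hint := ((continuousOn_integral_curve (hb.generator hT σ (hg.smoothOnCylinder T))
        hm.continuousOn).mono hsub).intervalIntegrable_of_Icc (μ := volume) hru.1
      rw [hm.integral_sub_integral hT hb hg htT hrI, ← smul_eq_mul (r - t),
        ← intervalIntegral.integral_const, ← intervalIntegral.integral_sub hint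
          intervalIntegrable_const]
      have := intervalIntegral.norm_integral_le_of_norm_le_const (a := t) (b := r) (C := c)
        (f := fun q => H q (mixture (m t) (m r) s) (m q) - H t (m t) (m t)) (fun q hq => ?_)
      · rwa [Real.norm_eq_abs, abs_of_nonneg (sub_nonneg.2 hru.1)] at this
      · rw [uIoc_of_le hru.1] at hq
        have hqu := hpu ⟨hq.1.le, hq.2.trans_lt hru.2⟩
        exact (K (K' hqu.1 (hr s ⟨hs.1, hs.2.le⟩)) hqu.2).le)
  rw [Real.norm_eq_abs, Real.norm_eq_abs, abs_of_nonneg (sub_nonneg.2 hru.1), smul_eq_mul]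
  exact this

/-- Fundamental theorem of calculus for a smooth test function along a solution of the
Fokker-Planck equation. -/
theorem IsSmoothTestFunction.integral_along_solution (hT : 0 < T) (hb : SmoothOnCylinder T b)
    (hφ : IsSmoothTestFunction T φ) (hm : IsFokkerPlanckSolution σ T b m₀ m) :
    ∫ t in (0 : ℝ)..T, (derivWithin (fun s => φ s (m t)) (Icc 0 T) t
      + ∫ x, generator σ (b t) (gradM (φ t) (m t)) x ∂(m t : Measure (Torus d))) =
      φ T (m T) - φ 0 (m 0) := by
  have hpair : ContinuousOn (fun t => (t, m t)) (Icc 0 T) := continuousOn_id.prodMk hm.continuousOn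
  have hmaps : MapsTo (fun t => (t, m t)) (Icc 0 T) (Icc 0 T ×ˢ univ) :=
    fun t ht => ⟨ht, mem_univ _⟩
  refine intervalIntegral.integral_eq_sub_of_hasDeriv_right_of_le hT.le
    (f := fun t => φ t (m t)) (hφ.continuousOn.comp hpair hmaps) (fun t ht => ?_) ?_
  · exact (hasDerivWithinAt_moving hφ.continuousOn_derivWithin (fun n t ht =>
      hφ.hasDerivWithinAt n ht) hm.continuousOn (Ioo_subset_Ico_self ht)
      (hφ.hasDerivWithinAt_curve hT hb hm (Ioo_subset_Ico_self ht))).mono Ioi_subset_Ici_self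
  · refine ContinuousOn.intervalIntegrable_of_Icc hT.le (ContinuousOn.add ?_ ?_)
    · exact hφ.continuousOn_derivWithin.comp hpair hmaps
    · have := continuousOn_integral_parametric (s := Icc 0 T ×ˢ (Icc 0 T ×ˢ univ))
        (G := fun (z : ℝ × ℝ × ProbabilityMeasure (Torus d)) x =>
          generator σ (b z.1) (gradM (φ z.2.1) z.2.2) x)
        (hφ.continuousOn_generator_gradM (σ := σ) hT hb)
      exact this.comp (f := fun t => ((t, t, m t), m t))
        ((continuousOn_id.prodMk hpair).prodMk hm.continuousOn)
        fun t ht => ⟨⟨ht, ht, mem_univ _⟩, mem_univ _⟩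

end ChainRule

/-! ### Trigonometric functions on the torus -/

namespace Torus

open UnitAddTorus

variable {d : ℕ}

lemma mFourier_add_apply (k : Fin d → ℤ) (x y : Torus d) :
    mFourier k (x + y) = mFourier k x * mFourier k y := by
  simp only [mFourier, ContinuousMap.coe_mk, Pi.add_apply, fourier_apply, smul_add,
    AddCircle.toCircle_add, Circle.coe_mul, Finset.prod_mul_distrib]

lemma mFourier_proj (k : Fin d → ℤ) (y : Fin d → ℝ) :
    mFourier k (proj y) = Complex.exp (2 * Real.pi * Complex.I * ∑ i, (k i : ℂ) * (y i : ℂ)) := by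
  simp only [mFourier, ContinuousMap.coe_mk, proj, Finset.mul_sum, Complex.exp_sum]
  refine Finset.prod_congr rfl fun i _ => ?_
  rw [fourier_coe_apply]
  congr 1
  push_cast
  ring

lemma norm_mFourier_apply (k : Fin d → ℤ) (x : Torus d) : ‖mFourier k x‖ = 1 := by
  simp only [mFourier, ContinuousMap.coe_mk, fourier_apply, norm_prod]
  exact Finset.prod_eq_one fun i _ => Circle.norm_coe _

/-- The real trigonometric function `Re (ζ e_k)`. -/
noncomputable def trig (ζ : ℂ) (k : Fin d → ℤ) (x : Torus d) : ℝ := (ζ * mFourier k x).re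

lemma smooth_trig (ζ : ℂ) (k : Fin d → ℤ) : Smooth (trig ζ k) := by
  have h : ContDiff ℝ ∞ fun y : Fin d → ℝ => Complex.exp (2 * Real.pi * Complex.I *
      ∑ i, (k i : ℂ) * (y i : ℂ)) := by
    refine ContDiff.cexp (contDiff_const.mul (ContDiff.sum fun i _ => contDiff_const.mul ?_))
    exact Complex.ofRealCLM.contDiff.comp (contDiff_apply ℝ ℝ i)
  have h2 := Complex.reCLM.contDiff.comp (contDiff_const (c := ζ).mul h)
  unfold Smooth trig
  simp only [mFourier_proj]
  exact h2

lemma partialDeriv_trig (ζ : ℂ) (k : Fin d → ℤ) (i : Fin d) :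
    partialDeriv i (trig ζ k) = trig (2 * Real.pi * Complex.I * k i * ζ) k := by
  ext x
  have h : ∀ s : ℝ, mFourier k (x + Pi.single i (s : UnitAddCircle)) =
      mFourier k x * Complex.exp (2 * Real.pi * Complex.I * k i * s) := by
    intro s
    have h0 : ∑ j, (k j : ℂ) * ((s • (Pi.single i 1 : Fin d → ℝ)) j : ℂ) = k i * s := by
      rw [Finset.sum_eq_single i]
      · simp
      · intro j _ hj; simp [hj]
      · simp
    rw [mFourier_add_apply, ← proj_smul_single, mFourier_proj, h0, mul_assoc _ (k i : ℂ)]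
  have hd : HasDerivAt (fun s : ℝ => ζ * (mFourier k x *
      Complex.exp (2 * Real.pi * Complex.I * k i * s)))
      (ζ * (mFourier k x * (2 * Real.pi * Complex.I * k i))) 0 := by
    have h1 : HasDerivAt (fun s : ℝ => 2 * Real.pi * Complex.I * k i * (s : ℂ))
        (2 * Real.pi * Complex.I * k i) 0 := by
      simpa using (Complex.ofRealCLM.hasDerivAt (x := (0 : ℝ))).const_mul
        (2 * Real.pi * Complex.I * k i)
    simpa using ((h1.cexp).const_mul (mFourier k x)).const_mul ζ
  have h3 := (Complex.reCLM.hasFDerivAt.comp_hasDerivAt (0 : ℝ) hd).deriv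
  unfold partialDeriv trig
  simp only [h]
  refine h3.trans ?_
  simp only [Complex.reCLM_apply]
  congr 1
  ring

/-- The symbol of `σ Δ + β · ∇`. -/
noncomputable def symbol (σ : ℝ) (β : Fin d → ℝ) (k : Fin d → ℤ) : ℂ :=
  -(4 * Real.pi ^ 2 * σ * ∑ i, (k i : ℂ) ^ 2) + 2 * Real.pi * Complex.I * ∑ i, (β i : ℂ) * k i

lemma generator_trig (σ : ℝ) (β : Torus d → Fin d → ℝ) (ζ : ℂ) (k : Fin d → ℤ) (x : Torus d) :
    generator σ β (trig ζ k) x = (ζ * (symbol σ (β x) k * mFourier k x)).re := by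
  simp only [generator, partialDeriv_trig, trig]
  have h1 : ∀ z : ℂ, ∀ s : ℝ, s * z.re = ((s : ℂ) * z).re := fun z s => by simp
  simp only [h1, Finset.mul_sum, ← Complex.re_sum, ← Complex.add_re]
  congr 1
  simp only [symbol, Finset.mul_sum, Finset.sum_mul, add_mul, mul_add, neg_mul, mul_neg,
    ← Finset.sum_neg_distrib]
  congr 1 <;> refine Finset.sum_congr rfl fun i _ => ?_
  · linear_combination (4 * Real.pi ^ 2 * σ * k i ^ 2 * ζ * mFourier k x) * Complex.I_sq
  · ring

lemma re_mul_integral_mFourier (n : ProbabilityMeasure (Torus d)) (ζ : ℂ) (k : Fin d → ℤ) :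
    (ζ * ∫ x, mFourier k x ∂(n : Measure (Torus d))).re =
      ∫ x, trig ζ k x ∂(n : Measure (Torus d)) := by
  rw [← integral_const_mul, ← Complex.reCLM_apply, ← ContinuousLinearMap.integral_comp_comm]
  · rfl
  · exact ((mFourier k).continuous.const_mul ζ).integrable_of_compactSpace _

/-- A probability measure on the torus is determined by its Fourier coefficients. -/
lemma ext_of_integral_mFourier {m n : ProbabilityMeasure (Torus d)}
    (h : ∀ k, ∫ x, mFourier k x ∂(m : Measure (Torus d)) =
      ∫ x, mFourier k x ∂(n : Measure (Torus d))) : m = n := by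
  have hc : ∀ m : ProbabilityMeasure (Torus d),
      Continuous fun f : C(Torus d, ℂ) => ∫ x, f x ∂(m : Measure (Torus d)) := fun m =>
    (continuous_integral_parametric (Y := C(Torus d, ℂ)) (G := fun f x => f x)
      (by fun_prop)).comp (f := fun f => (f, m)) (by fun_prop)
  have key : ∀ f : C(Torus d, ℂ), ∫ x, f x ∂(m : Measure (Torus d)) =
      ∫ x, f x ∂(n : Measure (Torus d)) := by
    have hcl : IsClosed {f : C(Torus d, ℂ) | ∫ x, f x ∂(m : Measure (Torus d)) =
        ∫ x, f x ∂(n : Measure (Torus d))} := isClosed_eq (hc m) (hc n)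
    have hsub : (Submodule.span ℂ (range (mFourier (d := Fin d))) : Set C(Torus d, ℂ)) ⊆
        {f : C(Torus d, ℂ) | ∫ x, f x ∂(m : Measure (Torus d)) =
        ∫ x, f x ∂(n : Measure (Torus d))} := by
      intro f hf
      induction hf using Submodule.span_induction with
      | mem f hf => obtain ⟨k, rfl⟩ := hf; exact h k
      | zero => simp
      | add f g _ _ hf hg =>
        simp only [mem_ofPred_eq, ContinuousMap.add_apply] at hf hg ⊢
        rw [integral_add (f.continuous.integrable_of_compactSpace _)
          (g.continuous.integrable_of_compactSpace _), integral_add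
          (f.continuous.integrable_of_compactSpace _) (g.continuous.integrable_of_compactSpace _),
          hf, hg]
      | smul c f _ hf =>
        simp only [mem_ofPred_eq, ContinuousMap.smul_apply] at hf ⊢
        rw [integral_smul, integral_smul, hf]
    have hcl' := closure_minimal hsub hcl
    intro f
    have hf : f ∈ (Submodule.span ℂ (range (mFourier (d := Fin d)))).topologicalClosure := by
      rw [span_mFourier_closure_eq_top]; trivial
    exact hcl' hf
  refine ProbabilityMeasure.ext_of_forall_integral fun f => ?_
  have := key ⟨fun x => (f x : ℂ), by fun_prop⟩
  simp only [ContinuousMap.coe_mk, integral_complex_ofReal] at this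
  exact_mod_cast this

lemma ext_of_integral_smooth {m n : ProbabilityMeasure (Torus d)}
    (h : ∀ g, Smooth g → ∫ x, g x ∂(m : Measure (Torus d)) =
      ∫ x, g x ∂(n : Measure (Torus d))) : m = n := by
  refine ext_of_integral_mFourier fun k => ?_
  have key : ∀ ζ : ℂ, (ζ * ∫ x, mFourier k x ∂(m : Measure (Torus d))).re =
      (ζ * ∫ x, mFourier k x ∂(n : Measure (Torus d))).re := fun ζ => by
    rw [re_mul_integral_mFourier, re_mul_integral_mFourier, h _ (smooth_trig ζ k)]
  apply Complex.ext
  · simpa using key 1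
  · simpa using key (-Complex.I)

/-- Weak convergence on the torus may be tested on smooth functions. -/
lemma tendsto_iff_forall_smooth {ι : Type*} {l : Filter ι} {m : ι → ProbabilityMeasure (Torus d)}
    {n : ProbabilityMeasure (Torus d)} :
    Tendsto m l (𝓝 n) ↔ ∀ g, Smooth g → Tendsto (fun i => ∫ x, g x ∂(m i : Measure (Torus d))) l
      (𝓝 (∫ x, g x ∂(n : Measure (Torus d)))) := by
  let e : ProbabilityMeasure (Torus d) → ({g : Torus d → ℝ // Smooth g} → ℝ) := fun n g =>
    ∫ x, g.1 x ∂(n : Measure (Torus d))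
  have hec : Continuous e := continuous_pi fun g =>
    continuous_integral_probabilityMeasure g.2.continuous
  have hei : Function.Injective e := fun m n h =>
    ext_of_integral_smooth fun g hg => congr_fun h ⟨g, hg⟩
  have hemb := (hec.isClosedEmbedding hei).isEmbedding
  rw [hemb.tendsto_nhds_iff, tendsto_pi_nhds]
  exact ⟨fun h g hg => h ⟨g, hg⟩, fun h g => h g.1 g.2⟩

lemma continuousOn_iff_forall_smooth {Y : Type*} [TopologicalSpace Y] {s : Set Y}
    {m : Y → ProbabilityMeasure (Torus d)} :
    ContinuousOn m s ↔ ∀ g, Smooth g →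
      ContinuousOn (fun y => ∫ x, g x ∂(m y : Measure (Torus d))) s := by
  simp only [ContinuousOn, ContinuousWithinAt, tendsto_iff_forall_smooth]
  exact ⟨fun h g hg y hy => h y hy g hg, fun h y hy g hg => h g hg y hy⟩

end Torus

/-! ### From first-order expansions to the Fokker-Planck equation -/

section FlowCurve

open Torus

variable {d : ℕ} {σ T : ℝ} {b : ℝ → Torus d → Fin d → ℝ} {m : ℝ → ProbabilityMeasure (Torus d)}

lemma IsFlowCurve.continuousOn (hT : 0 < T) (hb : SmoothOnCylinder T b)
    (hm : IsFlowCurve σ T b m) : ContinuousOn m (Icc 0 T) := by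
  refine continuousOn_iff_forall_smooth.2 fun g hg => ?_
  obtain ⟨C, hC0, hC⟩ := (hb.generator hT σ (hg.smoothOnCylinder T)).exists_bound
  obtain ⟨δ, hδ, H⟩ := hm g hg 1 one_pos
  have key : ∀ s ∈ Icc 0 T, ∀ t ∈ Icc 0 T, s ≤ t → t - s ≤ δ →
      |∫ x, g x ∂(m t : Measure (Torus d)) - ∫ x, g x ∂(m s : Measure (Torus d))|
        ≤ (C + 1) * (t - s) := by
    intro s hs t ht hst hle
    have h1 := H s hs t ht hst hle
    have h2 : |∫ x, generator σ (b s) g x ∂(m s : Measure (Torus d))| ≤ C :=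
      abs_integral_le_of_forall_abs_le (fun x => hC s hs x) _
    rw [abs_le] at *
    constructor <;> nlinarith
  rw [Metric.continuousOn_iff]
  intro t ht ε hε
  refine ⟨min δ (ε / (C + 1)), by positivity, fun s hs hst => ?_⟩
  rw [Real.dist_eq] at *
  have h1 : |s - t| < δ := hst.trans_le (min_le_left _ _)
  have h2 : (C + 1) * |s - t| < ε := by
    have := hst.trans_le (min_le_right _ _)
    rw [lt_div_iff₀ (by positivity)] at this
    linarith
  rcases le_total s t with h | h
  · rw [abs_sub_comm s t, abs_of_nonneg (sub_nonneg.2 h)] at h1 h2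
    rw [abs_sub_comm]
    exact (key s hs t ht h h1.le).trans_lt h2
  · rw [abs_of_nonneg (sub_nonneg.2 h)] at h1 h2
    exact (key t ht s hs h h1.le).trans_lt h2

lemma IsFlowCurve.hasDerivWithinAt (hm : IsFlowCurve σ T b m) {g : Torus d → ℝ} (hg : Smooth g)
    {t : ℝ} (ht : t ∈ Ico 0 T) :
    HasDerivWithinAt (fun r => ∫ x, g x ∂(m r : Measure (Torus d)))
      (∫ x, generator σ (b t) g x ∂(m t : Measure (Torus d))) (Ici t) t := by
  rw [hasDerivWithinAt_iff_isLittleO, Asymptotics.isLittleO_iff]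
  intro c hc
  obtain ⟨δ, hδ, H⟩ := hm g hg c hc
  filter_upwards [Ico_mem_nhdsGE ht.2, Ico_mem_nhdsGE (lt_add_of_pos_right t hδ)] with r hr hr'
  have := H t (Ico_subset_Icc_self ht) r ⟨ht.1.trans hr.1, hr.2.le⟩ hr.1 (by linarith [hr'.2])
  rw [Real.norm_eq_abs, Real.norm_eq_abs, abs_of_nonneg (sub_nonneg.2 hr.1), smul_eq_mul]
  exact this

lemma Torus.contDiff_deriv_time {ψ : ℝ → Torus d → ℝ}
    (hψ : ContDiff ℝ ∞ (fun p : ℝ × (Fin d → ℝ) => ψ p.1 (proj p.2))) :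
    (∀ t x, HasDerivAt (fun s => ψ s x) (deriv (fun s => ψ s x) t) t) ∧
    Continuous (fun q : ℝ × Torus d => deriv (fun s => ψ s q.2) q.1) := by
  have h1 : ∀ t y, HasDerivAt (fun s => ψ s (proj y))
      (fderiv ℝ (fun p : ℝ × (Fin d → ℝ) => ψ p.1 (proj p.2)) (t, y) (1, 0)) t := fun t y => by
    have := ((hψ.differentiable (by simp) (t, y)).hasFDerivAt).comp_hasDerivAt t
      ((hasDerivAt_id t).prodMk (hasDerivAt_const t y))
    exact this
  refine ⟨fun t x => ?_, ?_⟩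
  · obtain ⟨y, rfl⟩ := surjective_proj x
    exact (h1 t y).differentiableAt.hasDerivAt
  · have h2 : Continuous fun q : ℝ × (Fin d → ℝ) => deriv (fun s => ψ s (proj q.2)) q.1 := by
      simp only [(h1 _ _).deriv]
      exact (hψ.continuous_fderiv (by simp)).clm_apply continuous_const
    have h3 := continuousOn_of_continuousOn_proj (s := univ) (Z := ℝ)
      (G := fun t (x : Torus d) => deriv (fun s => ψ s x) t) h2.continuousOn
    rwa [univ_prod_univ, continuousOn_univ] at h3

/-- Curves satisfying the first order expansion are distributional solutions. -/
theorem IsFlowCurve.isFokkerPlanckSolution (hT : 0 < T) (hb : SmoothOnCylinder T b)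
    (hm : IsFlowCurve σ T b m) : IsFokkerPlanckSolution σ T b (m 0) m := by
  have hmc := hm.continuousOn hT hb
  refine ⟨rfl, hmc, fun ψ hψ hψs => ?_⟩
  obtain ⟨hd, hdc⟩ := contDiff_deriv_time hψ
  have hψS : SmoothOnCylinder T ψ := ContDiff.contDiffOn hψ
  have hψ0 : ∀ t, t ∉ Ioo 0 T → ∀ x, ψ t x = 0 := fun t ht x =>
    image_eq_zero_of_notMem_tsupport (f := fun p : ℝ × Torus d => ψ p.1 p.2) (x := (t, x))
      fun h => ht (hψs h).1
  have hψc : ∀ t, Continuous (ψ t) := fun t => continuous_of_continuous_proj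
    (ContDiff.continuous (hψ.comp (contDiff_const (c := t).prodMk contDiff_id)))
  have hdt : ∀ t, Continuous fun x => deriv (fun s => ψ s x) t := fun t =>
    hdc.comp (f := fun x => (t, x)) (by fun_prop)
  have hint : ∀ (n : ProbabilityMeasure (Torus d)) t, HasDerivAt
      (fun s => ∫ x, ψ s x ∂(n : Measure (Torus d)))
      (∫ x, deriv (fun s => ψ s x) t ∂(n : Measure (Torus d))) t := by
    intro n t
    obtain ⟨C, hC⟩ := ((isCompact_closedBall t 1).prod
      (isCompact_univ (X := Torus d))).exists_bound_of_continuousOn hdc.continuousOn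
    exact (hasDerivAt_integral_of_dominated_loc_of_deriv_le (bound := fun _ => C)
      (Metric.ball_mem_nhds t one_pos)
      (Eventually.of_forall fun s => (hψc s).aestronglyMeasurable)
      ((hψc t).integrable_of_compactSpace _) (hdt t).aestronglyMeasurable
      (Eventually.of_forall fun x s hs => hC (s, x) ⟨Metric.ball_subset_closedBall hs, mem_univ _⟩)
      (integrable_const C) (Eventually.of_forall fun x s _ => hd s x)).2
  have hf' : Continuous (fun q : ℝ × ProbabilityMeasure (Torus d) =>
      ∫ x, deriv (fun s => ψ s x) q.1 ∂(q.2 : Measure (Torus d))) :=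
    continuous_integral_parametric (G := fun t (x : Torus d) => deriv (fun s => ψ s x) t) hdc
  have hderiv : ∀ t ∈ Ico 0 T, HasDerivWithinAt (fun r => ∫ x, ψ r x ∂(m r : Measure (Torus d)))
      (∫ x, (deriv (fun s => ψ s x) t + generator σ (b t) (ψ t) x) ∂(m t : Measure (Torus d)))
      (Ici t) t := by
    intro t ht
    have htT := Ico_subset_Icc_self ht
    rw [integral_add ((hdt t).integrable_of_compactSpace _)
      (((hb.generator hT σ hψS).continuous htT).integrable_of_compactSpace _)]
    exact hasDerivWithinAt_moving (f := fun s (n : ProbabilityMeasure (Torus d)) =>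
      ∫ x, ψ s x ∂(n : Measure (Torus d))) hf'.continuousOn
      (fun n t _ => (hint n t).hasDerivWithinAt) hmc ht
      (hm.hasDerivWithinAt (hψS.smooth htT) ht)
  rw [intervalIntegral.integral_eq_sub_of_hasDeriv_right_of_le hT.le
    (continuousOn_integral_curve hψS hmc)
    (fun t ht => (hderiv t (Ioo_subset_Ico_self ht)).mono Ioi_subset_Ici_self)]
  · simp [hψ0 T (by simp), hψ0 0 (by simp)]
  · refine ContinuousOn.intervalIntegrable_of_Icc hT.le ?_
    refine (((hf'.comp_continuousOn (continuousOn_id.prodMk hmc))).add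
      (continuousOn_integral_curve (hb.generator hT σ hψS) hmc)).congr fun t ht => ?_
    exact integral_add ((hdt t).integrable_of_compactSpace _)
      (((hb.generator hT σ hψS).continuous ht).integrable_of_compactSpace _)

end FlowCurve

/-! ### A Markov chain consistent with the Fokker-Planck equation -/

section MarkovChain

open Torus

lemma abs_sub_le_mul_of_hasDerivAt {f f' : ℝ → ℝ} {K ρ : ℝ} (hf : ∀ s, HasDerivAt f (f' s) s)
    (hρ : 0 ≤ ρ) (hK : ∀ s ∈ Icc 0 ρ, |f' s| ≤ K) : |f ρ - f 0| ≤ K * ρ := by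
  have := Convex.norm_image_sub_le_of_norm_hasDerivWithin_le (s := Icc 0 ρ)
    (fun s _ => (hf s).hasDerivWithinAt) hK (convex_Icc _ _)
    (left_mem_Icc.2 hρ) (right_mem_Icc.2 hρ)
  rwa [Real.norm_eq_abs, Real.norm_eq_abs, sub_zero, abs_of_nonneg hρ] at this

/-- Second order symmetric Taylor estimate. -/
lemma abs_symmetric_difference_le {q q' q'' q''' : ℝ → ℝ} {C ρ : ℝ}
    (h1 : ∀ s, HasDerivAt q (q' s) s) (h2 : ∀ s, HasDerivAt q' (q'' s) s)
    (h3 : ∀ s, HasDerivAt q'' (q''' s) s) (hC : ∀ s, |q''' s| ≤ C) (hρ : 0 ≤ ρ) :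
    |q ρ + q (-ρ) - 2 * q 0 - ρ ^ 2 * q'' 0| ≤ 2 * C * ρ ^ 3 := by
  have hC0 : 0 ≤ C := (abs_nonneg _).trans (hC 0)
  have a1 : ∀ s, 0 ≤ s → |q'' s - q'' 0| ≤ C * s := fun s hs =>
    abs_sub_le_mul_of_hasDerivAt h3 hs fun r _ => hC r
  have hneg : ∀ {p p' : ℝ → ℝ}, (∀ s, HasDerivAt p (p' s) s) → ∀ s,
      HasDerivAt (fun s => p (-s)) (-p' (-s)) s := fun {p p'} hp s => by
    have := (hp (-s)).scomp s (hasDerivAt_neg s)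
    simpa [Function.comp_def] using! this
  have a2 : ∀ s, 0 ≤ s → |q'' (-s) - q'' 0| ≤ C * s := fun s hs => by
    have := abs_sub_le_mul_of_hasDerivAt (hneg h3) hs (K := C) fun r _ => by
      rw [abs_neg]; exact hC _
    simpa using this
  have b1 : ∀ s ∈ Icc 0 ρ, |q' s - q' (-s) - 2 * s * q'' 0| ≤ 2 * C * ρ ^ 2 := by
    intro s hs
    have hd : ∀ s, HasDerivAt (fun s => q' s - q' (-s) - 2 * s * q'' 0)
        (q'' s + q'' (-s) - 2 * q'' 0) s := fun s => by
      have := ((h2 s).sub (hneg h2 s)).sub (((hasDerivAt_id s).const_mul 2).mul_const (q'' 0))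
      simpa using! this
    have := abs_sub_le_mul_of_hasDerivAt hd hs.1 (K := 2 * C * ρ) fun r hr => by
      have e : q'' r + q'' (-r) - 2 * q'' 0 = (q'' r - q'' 0) + (q'' (-r) - q'' 0) := by ring
      rw [e]
      refine (abs_add_le _ _).trans ?_
      have := a1 r hr.1
      have := a2 r hr.1
      nlinarith [hr.2, hs.2]
    simp only [neg_zero, sub_self, mul_zero, zero_mul, sub_zero] at this
    refine this.trans ?_
    rw [pow_two, ← mul_assoc]
    exact mul_le_mul_of_nonneg_left hs.2 (by positivity)
  have hd : ∀ s, HasDerivAt (fun s => q s + q (-s) - s ^ 2 * q'' 0)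
      (q' s - q' (-s) - 2 * s * q'' 0) s := fun s => by
    have := ((h1 s).add (hneg h1 s)).sub ((hasDerivAt_pow 2 s).mul_const (q'' 0))
    simpa [sub_eq_add_neg] using! this
  have := abs_sub_le_mul_of_hasDerivAt hd hρ b1
  rw [show q ρ + q (-ρ) - 2 * q 0 - ρ ^ 2 * q'' 0 = q ρ + q (-ρ) - ρ ^ 2 * q'' 0 -
    (q 0 + q (-0) - 0 ^ 2 * q'' 0) by rw [neg_zero]; ring]
  exact this.trans (le_of_eq (by ring))

variable {d : ℕ} {σ T : ℝ} {b : ℝ → Torus d → Fin d → ℝ} {f : ℝ → Torus d → ℝ}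

lemma Torus.proj_zero : proj (0 : Fin d → ℝ) = 0 := by
  ext i
  simp [proj]

lemma Torus.SmoothOnCylinder.exists_lipschitz (hT : 0 < T) (hf : SmoothOnCylinder T f) {B : ℝ}
    (hB : 0 ≤ B) :
    ∃ K, 0 ≤ K ∧ ∀ t ∈ Icc 0 T, ∀ x, ∀ v : Fin d → ℝ, (∀ i, |v i| ≤ B) → ∀ h, 0 ≤ h →
      |f t (x + proj (h • v)) - f t x| ≤ K * h := by
  choose C hC0 hC using fun i => (hf.partialDeriv hT i).exists_bound
  refine ⟨∑ i, B * C i, Finset.sum_nonneg fun i _ => mul_nonneg hB (hC0 i),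
    fun t ht x v hv h hh => ?_⟩
  have := abs_sub_le_mul_of_hasDerivAt (hf.hasDerivAt ht x v) hh (K := ∑ i, B * C i) fun s _ =>
    (Finset.abs_sum_le_sum_abs _ _).trans (Finset.sum_le_sum fun i _ => by
      rw [abs_mul]
      exact mul_le_mul (hv i) (hC i t ht _) (abs_nonneg _) hB)
  simpa [proj_zero] using this

lemma Torus.SmoothOnCylinder.exists_taylor_drift (hT : 0 < T) (hf : SmoothOnCylinder T f) {B : ℝ}
    (hB : 0 ≤ B) :
    ∃ K, 0 ≤ K ∧ ∀ t ∈ Icc 0 T, ∀ x, ∀ v : Fin d → ℝ, (∀ i, |v i| ≤ B) → ∀ h, 0 ≤ h →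
      |f t (x + proj (h • v)) - f t x - h * ∑ i, v i * Torus.partialDeriv i (f t) x| ≤ K * h ^ 2 := by
  choose C hC0 hC using fun i => (hf.partialDeriv hT i).exists_lipschitz hT hB
  refine ⟨∑ i, B * C i, Finset.sum_nonneg fun i _ => mul_nonneg hB (hC0 i),
    fun t ht x v hv h hh => ?_⟩
  have := abs_sub_le_mul_of_hasDerivAt (f := fun s => f t (x + proj (s • v)) -
      s * ∑ i, v i * Torus.partialDeriv i (f t) x) (K := (∑ i, B * C i) * h)
      (f' := fun s => ∑ i, v i * Torus.partialDeriv i (f t) (x + proj (s • v)) -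
        ∑ i, v i * Torus.partialDeriv i (f t) x) (fun s => by
        have := (hf.hasDerivAt ht x v s).sub
          ((hasDerivAt_id s).mul_const (∑ i, v i * Torus.partialDeriv i (f t) x))
        simpa using! this) hh fun s hs => by
    rw [← Finset.sum_sub_distrib, Finset.sum_mul]
    refine (Finset.abs_sum_le_sum_abs _ _).trans (Finset.sum_le_sum fun i _ => ?_)
    rw [← mul_sub, abs_mul, mul_assoc]
    refine mul_le_mul (hv i) ((hC i t ht x v hv s hs.1).trans ?_) (abs_nonneg _) hB
    exact mul_le_mul_of_nonneg_left hs.2 (hC0 i)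
  simp only [zero_smul, proj_zero, add_zero, zero_mul, sub_zero] at this
  rw [show f t (x + proj (h • v)) - f t x - h * ∑ i, v i * Torus.partialDeriv i (f t) x =
    f t (x + proj (h • v)) - h * ∑ i, v i * Torus.partialDeriv i (f t) x - f t x by ring]
  exact this.trans (le_of_eq (by ring))

/-- The direction of the random part of a jump: a coordinate direction or, to keep the index set
nonempty in dimension `0`, no motion at all. -/
def jumpDirection (j : Option (Fin d)) : Fin d → ℝ := j.elim 0 fun i => Pi.single i 1

/-- One jump of the Markov chain: drift along `h β` and a symmetric displacement of size `ρ`. -/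
def jump (β : Torus d → Fin d → ℝ) (h ρ : ℝ) (j : Option (Fin d) × Bool) (x : Torus d) : Torus d :=
  x + proj (h • β x) + proj ((if j.2 then ρ else -ρ) • jumpDirection j.1)

lemma continuous_jump {β : Torus d → Fin d → ℝ} (hβ : Continuous β) (h ρ : ℝ)
    (j : Option (Fin d) × Bool) : Continuous (jump β h ρ j) := by
  unfold jump
  exact (continuous_id.add (continuous_proj.comp (hβ.const_smul h))).add continuous_const

/-- The law after one step of the Markov chain, all jumps being equally likely. -/
noncomputable def chainStep (β : Torus d → Fin d → ℝ) (hβ : Continuous β) (h ρ : ℝ)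
    (m : ProbabilityMeasure (Torus d)) : ProbabilityMeasure (Torus d) :=
  ⟨(Fintype.card (Option (Fin d) × Bool) : ENNReal)⁻¹ • ∑ j, (m : Measure (Torus d)).map
    (jump β h ρ j), ⟨by
    have : ∀ j, (m : Measure (Torus d)).map (jump β h ρ j) univ = 1 := fun j => by
      rw [Measure.map_apply (continuous_jump hβ h ρ j).measurable MeasurableSet.univ]
      simp
    simp only [Measure.smul_apply, Measure.finsetSum_apply, this, Finset.sum_const,
      Finset.card_univ, smul_eq_mul, nsmul_eq_mul, mul_one]
    exact ENNReal.inv_mul_cancel (by simp) (ENNReal.natCast_ne_top _)⟩⟩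

lemma integral_chainStep {β : Torus d → Fin d → ℝ} (hβ : Continuous β) (h ρ : ℝ)
    (m : ProbabilityMeasure (Torus d)) {g : Torus d → ℝ} (hg : Continuous g) :
    ∫ x, g x ∂(chainStep β hβ h ρ m : Measure (Torus d)) =
      ∫ x, (2 * ((d : ℝ) + 1))⁻¹ * ∑ j, g (jump β h ρ j x) ∂(m : Measure (Torus d)) := by
  have hm : ∀ j, AEMeasurable (jump β h ρ j) (m : Measure (Torus d)) := fun j =>
    (continuous_jump hβ h ρ j).measurable.aemeasurable
  have : ∀ j, IsProbabilityMeasure ((m : Measure (Torus d)).map (jump β h ρ j)) := fun j =>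
    Measure.isProbabilityMeasure_map (hm j)
  rw [integral_const_mul, integral_finsetSum (f := fun j x => g (jump β h ρ j x)) _ fun j _ =>
    (hg.comp (continuous_jump hβ h ρ j)).integrable_of_compactSpace _]
  simp only [chainStep, ProbabilityMeasure.coe_mk]
  rw [integral_smul_measure, integral_finsetSum_measure fun j _ =>
    hg.integrable_of_compactSpace _]
  simp only [integral_map (hm _) hg.aestronglyMeasurable]
  rw [smul_eq_mul, ENNReal.toReal_inv, ENNReal.toReal_natCast]
  congr 2
  simp
  ring

/-- Consistency of the Markov chain with the generator, uniformly over families of functions that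
are smooth on the cylinder. The variance `ρ ^ 2 = 2 (d + 1) σ h` accounts for the `2 (d + 1)`
equally likely jumps, two of which move in any given coordinate direction. -/
lemma Torus.SmoothOnCylinder.exists_consistency (hT : 0 < T) (hσ : 0 < σ)
    (hb : SmoothOnCylinder T b) (hf : SmoothOnCylinder T f) :
    ∃ K, 0 ≤ K ∧ ∀ t ∈ Icc 0 T, ∀ r ∈ Icc 0 T, ∀ h, 0 ≤ h → ∀ x,
      |(2 * ((d : ℝ) + 1))⁻¹ *
        ∑ j, f t (jump (b r) h (√(2 * (d + 1) * σ * h)) j x)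
        - f t x - h * Torus.generator σ (b r) (f t) x| ≤ K * (h * √h + h ^ 2) := by
  obtain ⟨B, hB0, hB⟩ := hb.exists_bound
  choose C₃ hC₃0 hC₃ using fun i =>
    (((hf.partialDeriv hT i).partialDeriv hT i).partialDeriv hT i).exists_bound
  obtain ⟨K₁, hK₁0, hK₁⟩ := hf.exists_taylor_drift hT hB0
  choose K₂ hK₂0 hK₂ using fun i =>
    ((hf.partialDeriv hT i).partialDeriv hT i).exists_lipschitz hT hB0
  set N : ℝ := 2 * ((d : ℝ) + 1) with hN
  have hNpos : 0 < N := by positivity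
  set S : ℝ := √(N * σ) with hS
  have hbv : ∀ r ∈ Icc 0 T, ∀ x i, |b r x i| ≤ B := fun r hr x i =>
    (norm_le_pi_norm (b r x) i).trans (hB r hr x)
  refine ⟨N⁻¹ * (∑ i, 2 * C₃ i) * S ^ 3 + K₁ + σ * ∑ i, K₂ i, by
    have := Finset.sum_nonneg fun i (_ : i ∈ Finset.univ) => hC₃0 i
    have := Finset.sum_nonneg fun i (_ : i ∈ Finset.univ) => hK₂0 i
    rw [← Finset.mul_sum]
    positivity, fun t ht r hr h hh x => ?_⟩
  set ρ : ℝ := √(2 * (d + 1) * σ * h) with hρ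
  have hρ0 : 0 ≤ ρ := Real.sqrt_nonneg _
  have hρS : ρ = S * √h := by
    rw [hρ, hS, ← Real.sqrt_mul (by positivity)]
  have hρ2 : ρ ^ 2 = N * σ * h := by
    rw [hρ, Real.sq_sqrt (by positivity)]
  set y : Torus d := x + proj (h • b r x) with hy
  -- the random displacements
  have hsum : ∑ j, f t (jump (b r) h ρ j x) = N * f t y + ∑ i, (f t (y + proj (ρ • Pi.single i 1))
      + f t (y + proj (-ρ • Pi.single i 1)) - 2 * f t y) := by
    rw [Fintype.sum_prod_type, Fintype.sum_option, Finset.sum_sub_distrib]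
    simp only [Fintype.sum_bool, Fintype.card_bool, Nat.cast_ofNat, jump, jumpDirection,
      if_true, Option.elim, smul_zero, proj_zero, ← hy, add_zero,
      Finset.sum_const, Finset.card_univ, Fintype.card_fin, nsmul_eq_mul, hN,
      Bool.false_eq_true, if_false]
    ring
  have e1 : |∑ i, (f t (y + proj (ρ • Pi.single i 1)) + f t (y + proj (-ρ • Pi.single i 1))
      - 2 * f t y) - ρ ^ 2 * ∑ i, Torus.partialDeriv i (Torus.partialDeriv i (f t)) y|
      ≤ (∑ i, 2 * C₃ i) * ρ ^ 3 := by
    rw [Finset.mul_sum, ← Finset.sum_sub_distrib, Finset.sum_mul]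
    refine (Finset.abs_sum_le_sum_abs _ _).trans (Finset.sum_le_sum fun i _ => ?_)
    simp only [proj_smul_single]
    have := abs_symmetric_difference_le (fun s => hf.hasDerivAt_single ht y i s)
      (fun s => (hf.partialDeriv hT i).hasDerivAt_single ht y i s)
      (fun s => ((hf.partialDeriv hT i).partialDeriv hT i).hasDerivAt_single ht y i s)
      (fun s => hC₃ i t ht _) hρ0
    simpa using this
  have e2 := hK₁ t ht x (b r x) (hbv r hr x) h hh
  have e3 : |∑ i, Torus.partialDeriv i (Torus.partialDeriv i (f t)) y -
      ∑ i, Torus.partialDeriv i (Torus.partialDeriv i (f t)) x| ≤ (∑ i, K₂ i) * h := by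
    rw [← Finset.sum_sub_distrib, Finset.sum_mul]
    exact (Finset.abs_sum_le_sum_abs _ _).trans (Finset.sum_le_sum fun i _ =>
      hK₂ i t ht x (b r x) (hbv r hr x) h hh)
  rw [hsum]
  set D := ∑ i, (f t (y + proj (ρ • Pi.single i 1)) + f t (y + proj (-ρ • Pi.single i 1))
      - 2 * f t y)
  set Ly := ∑ i, Torus.partialDeriv i (Torus.partialDeriv i (f t)) y
  set Lx := ∑ i, Torus.partialDeriv i (Torus.partialDeriv i (f t)) x with hLx
  set G := ∑ i, b r x i * Torus.partialDeriv i (f t) x with hG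
  have hgen : Torus.generator σ (b r) (f t) x = σ * Lx + G := rfl
  have split : N⁻¹ * (N * f t y + D) - f t x - h * Torus.generator σ (b r) (f t) x =
      N⁻¹ * (D - ρ ^ 2 * Ly) + (f t y - f t x - h * G) + h * σ * (Ly - Lx) := by
    rw [hgen, hρ2]
    field_simp
    ring
  have hρ3 : ρ ^ 3 = S ^ 3 * (h * √h) := by
    rw [hρS, mul_pow]
    congr 1
    rw [pow_succ, Real.sq_sqrt hh]
  rw [split]
  refine (abs_add_three _ _ _).trans ?_
  rw [abs_mul, abs_mul, abs_of_nonneg (inv_nonneg.2 hNpos.le),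
    abs_of_nonneg (show 0 ≤ h * σ by positivity)]
  have hsq : 0 ≤ h * √h := mul_nonneg hh (Real.sqrt_nonneg _)
  have hC0 : 0 ≤ N⁻¹ * (∑ i, 2 * C₃ i) * S ^ 3 := by
    have := Finset.sum_nonneg fun i (_ : i ∈ Finset.univ) => hC₃0 i
    rw [← Finset.mul_sum]
    positivity
  have hK0 : 0 ≤ σ * ∑ i, K₂ i := mul_nonneg hσ.le (Finset.sum_nonneg fun i _ => hK₂0 i)
  have t1 : N⁻¹ * |D - ρ ^ 2 * Ly| ≤ N⁻¹ * (∑ i, 2 * C₃ i) * S ^ 3 * (h * √h) := by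
    have := mul_le_mul_of_nonneg_left e1 (inv_nonneg.2 hNpos.le)
    rw [hρ3] at this
    exact this.trans (le_of_eq (by ring))
  have t3 : h * σ * |Ly - Lx| ≤ σ * (∑ i, K₂ i) * h ^ 2 := by
    have := mul_le_mul_of_nonneg_left e3 (mul_nonneg hh hσ.le)
    exact this.trans (le_of_eq (by ring))
  nlinarith [mul_nonneg hC0 (sq_nonneg h), mul_nonneg hK0 hsq, mul_nonneg hK₁0 hsq]

end MarkovChain

/-! ### Existence for the Fokker-Planck equation -/

section Existence

open Torus

variable {d : ℕ} {σ T h : ℝ} {b : ℝ → Torus d → Fin d → ℝ} {f : ℝ → Torus d → ℝ}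
  {g : Torus d → ℝ} {M : ℕ → ProbabilityMeasure (Torus d)}

/-- The laws `M k` of the Markov chain with time step `h`, the drift being frozen at time `k h`
(clamped to `[0, T]`) during the `k`-th step. -/
def IsMarkovChain (σ T : ℝ) (b : ℝ → Torus d → Fin d → ℝ) (h : ℝ)
    (M : ℕ → ProbabilityMeasure (Torus d)) : Prop :=
  ∀ k : ℕ, ∃ hβ : Continuous (b (min (k * h) T)),
    M (k + 1) = chainStep (b (min (k * h) T)) hβ h (√(2 * (d + 1) * σ * h)) (M k)

lemma min_mem_Icc (hT : 0 < T) (hh : 0 ≤ h) (k : ℕ) : min (k * h) T ∈ Icc 0 T :=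
  ⟨le_min (by positivity) hT.le, min_le_right _ _⟩

lemma exists_isMarkovChain (hT : 0 < T) (hb : SmoothOnCylinder T b) (hh : 0 ≤ h)
    (m₀ : ProbabilityMeasure (Torus d)) : ∃ M, M 0 = m₀ ∧ IsMarkovChain σ T b h M := by
  have hc : ∀ k : ℕ, Continuous (b (min (k * h) T)) := fun k => hb.continuous (min_mem_Icc hT hh k)
  exact ⟨fun k => Nat.rec m₀ (fun k n => chainStep (b (min (k * h) T)) (hc k) h
    (√(2 * (d + 1) * σ * h)) n) k, rfl, fun k => ⟨hc k, rfl⟩⟩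

lemma exists_chain_expansion (hT : 0 < T) (hσ : 0 < σ) (hb : SmoothOnCylinder T b)
    (hf : SmoothOnCylinder T f) :
    ∃ K, 0 ≤ K ∧ ∀ h, 0 ≤ h → ∀ M, IsMarkovChain σ T b h M → ∀ k : ℕ, ∀ t ∈ Icc 0 T,
      |∫ x, f t x ∂(M (k + 1) : Measure (Torus d)) - ∫ x, f t x ∂(M k : Measure (Torus d))
        - h * ∫ x, generator σ (b (min (k * h) T)) (f t) x ∂(M k : Measure (Torus d))|
        ≤ K * (h * √h + h ^ 2) := by
  obtain ⟨K, hK0, hK⟩ := SmoothOnCylinder.exists_consistency hT hσ hb hf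
  refine ⟨K, hK0, fun h hh M hM k t ht => ?_⟩
  obtain ⟨hβ, hMk⟩ := hM k
  have hr := min_mem_Icc hT hh k
  have hft := hf.continuous ht
  have hgen : Continuous (generator σ (b (min (k * h) T)) (f t)) :=
    (hb.generator hT σ ((hf.smooth ht).smoothOnCylinder T)).continuous hr
  have hc1 : Continuous fun x => (2 * ((d : ℝ) + 1))⁻¹ * ∑ j, f t
      (jump (b (min (k * h) T)) h (√(2 * (d + 1) * σ * h)) j x) :=
    continuous_const.mul (continuous_finsetSum _ fun j _ => hft.comp (continuous_jump hβ _ _ j))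
  have hc2 : Continuous fun x => (2 * ((d : ℝ) + 1))⁻¹ * ∑ j, f t
      (jump (b (min (k * h) T)) h (√(2 * (d + 1) * σ * h)) j x) - f t x := hc1.sub hft
  rw [hMk, integral_chainStep hβ _ _ _ hft, ← integral_sub (hc1.integrable_of_compactSpace _)
    (hft.integrable_of_compactSpace _), ← integral_const_mul, ← integral_sub
    (hc2.integrable_of_compactSpace _)
    ((hgen.const_mul h).integrable_of_compactSpace _)]
  exact abs_integral_le_of_forall_abs_le (hK t ht _ hr h hh) _

lemma exists_chain_lipschitz (hT : 0 < T) (hσ : 0 < σ) (hb : SmoothOnCylinder T b)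
    (hf : SmoothOnCylinder T f) :
    ∃ K, 0 ≤ K ∧ ∀ h, 0 ≤ h → h ≤ 1 → ∀ M, IsMarkovChain σ T b h M → ∀ k j : ℕ, ∀ t ∈ Icc 0 T,
      |∫ x, f t x ∂(M (k + j) : Measure (Torus d)) - ∫ x, f t x ∂(M k : Measure (Torus d))|
        ≤ K * (j * h) := by
  obtain ⟨K, hK0, hK⟩ := exists_chain_expansion hT hσ hb hf
  obtain ⟨C, hC0, hC⟩ := hb.exists_bound_generator hT σ hf
  refine ⟨2 * K + C, by positivity, fun h hh hh1 M hM k j t ht => ?_⟩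
  induction j with
  | zero => simp
  | succ j ih =>
    have h1 := hK h hh M hM (k + j) t ht
    have h2 := abs_integral_le_of_forall_abs_le (hC _ (min_mem_Icc hT hh (k + j)) t ht) (M (k + j))
    have h3 : √h ≤ 1 := Real.sqrt_le_one.2 hh1
    have h4 : h * √h + h ^ 2 ≤ 2 * h := by nlinarith
    have h5 := mul_le_mul_of_nonneg_left h4 hK0
    have h6 := mul_le_mul_of_nonneg_left h2 hh
    rw [← abs_of_nonneg hh, ← abs_mul, abs_of_nonneg hh] at h6
    rw [show k + (j + 1) = k + j + 1 by ring]
    push_cast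
    rw [abs_le] at *
    constructor <;> linarith

/-- The expansion of `IsFlowCurve` for the Markov chain at times `⌊t / h⌋ h`, up to errors
vanishing with the time step. -/
lemma exists_chain_flow_expansion (hT : 0 < T) (hσ : 0 < σ) (hb : SmoothOnCylinder T b)
    (hg : Smooth g) :
    ∃ K, 0 ≤ K ∧ ∀ ε > 0, ∃ δ > 0, ∀ h, 0 < h → h ≤ 1 → h ≤ δ → ∀ M, IsMarkovChain σ T b h M →
      ∀ s ∈ Icc 0 T, ∀ t ∈ Icc 0 T, s ≤ t → t - s ≤ δ →
      |∫ x, g x ∂(M ⌊t / h⌋₊ : Measure (Torus d)) - ∫ x, g x ∂(M ⌊s / h⌋₊ : Measure (Torus d))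
        - (t - s) * ∫ x, generator σ (b s) g x ∂(M ⌊s / h⌋₊ : Measure (Torus d))|
        ≤ (t - s + h) * (K * (√h + h) + ε + K * (t - s + h)) + K * h := by
  have hgc := hg.smoothOnCylinder T
  have hLc := hb.generator hT σ hgc
  obtain ⟨K₁, hK₁0, hK₁⟩ := exists_chain_expansion hT hσ hb hgc
  obtain ⟨K₂, hK₂0, hK₂⟩ := exists_chain_lipschitz hT hσ hb hLc
  obtain ⟨C, hC0, hC⟩ := hb.exists_bound_generator hT σ hgc
  refine ⟨K₁ + K₂ + C, by positivity, fun ε hε => ?_⟩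
  obtain ⟨δ, hδ, H⟩ := hLc.uniform_time hε
  refine ⟨δ, hδ, fun h hh hh1 hhδ M hM s hs t ht hst hts => ?_⟩
  set a := ⌊s / h⌋₊ with ha
  set c := ⌊t / h⌋₊ with hc
  have hac : a ≤ c := Nat.floor_mono (by gcongr)
  obtain ⟨n, hn⟩ := Nat.exists_eq_add_of_le hac
  have ha1 : a * h ≤ s := by
    rw [← le_div_iff₀ hh]; exact Nat.floor_le (div_nonneg hs.1 hh.le)
  have ha2 : s < (a + 1) * h := by
    rw [← div_lt_iff₀ hh]; exact Nat.lt_floor_add_one _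
  have hc1 : c * h ≤ t := by
    rw [← le_div_iff₀ hh]; exact Nat.floor_le (div_nonneg ht.1 hh.le)
  have hc2 : t < (c + 1) * h := by
    rw [← div_lt_iff₀ hh]; exact Nat.lt_floor_add_one _
  have hcn : (c : ℝ) = a + n := by rw [hn]; push_cast; ring
  set A := ∫ x, generator σ (b s) g x ∂(M a : Measure (Torus d)) with hA
  have hAC : |A| ≤ C := abs_integral_le_of_forall_abs_le (hC s hs s hs) _
  set E := K₁ * (√h + h) + ε + K₂ * (t - s + h) with hE
  have hE0 : 0 ≤ E := by
    have : 0 ≤ t - s := sub_nonneg.2 hst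
    positivity
  have key : ∀ j : ℕ, j ≤ n → |∫ x, g x ∂(M (a + j) : Measure (Torus d)) -
      ∫ x, g x ∂(M a : Measure (Torus d)) - j * h * A| ≤ j * h * E := by
    intro j
    induction j with
    | zero => intro _; simp
    | succ j ih =>
      intro hj
      have ih := ih (by omega)
      have hjn : (j : ℝ) + 1 ≤ n := by exact_mod_cast hj
      have hjt : (a + j : ℕ) * h ≤ t - h := by
        push_cast
        nlinarith
      have hjs : s - h ≤ (a + j : ℕ) * h := by
        push_cast
        have : 0 ≤ (j : ℝ) * h := by positivity
        nlinarith
      have hr : min ((a + j : ℕ) * h) T = (a + j : ℕ) * h := min_eq_left (by linarith [ht.2])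
      have h1 := hK₁ h hh.le M hM (a + j) s hs
      have hrT := min_mem_Icc hT hh.le (a + j)
      rw [hr] at h1 hrT
      have hcont : ∀ r ∈ Icc 0 T, Continuous (generator σ (b r) g) := fun r hr => hLc.continuous hr
      have h2 : |∫ x, generator σ (b ((a + j : ℕ) * h)) g x ∂(M (a + j) : Measure (Torus d)) -
          ∫ x, generator σ (b s) g x ∂(M (a + j) : Measure (Torus d))| ≤ ε := by
        rw [← integral_sub ((hcont _ hrT).integrable_of_compactSpace _)
          ((hcont _ hs).integrable_of_compactSpace _)]
        refine abs_integral_le_of_forall_abs_le (H s hs _ hrT ?_) _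
        rw [abs_le]
        constructor <;> linarith
      have h3 := hK₂ h hh.le hh1 M hM a j s hs
      have h4 : K₂ * (j * h) ≤ K₂ * (t - s + h) := by
        refine mul_le_mul_of_nonneg_left ?_ hK₂0
        push_cast at hjt
        nlinarith
      set A₁ := ∫ x, generator σ (b ((a + j : ℕ) * h)) g x ∂(M (a + j) : Measure (Torus d))
      set A₂ := ∫ x, generator σ (b s) g x ∂(M (a + j) : Measure (Torus d))
      have h5 : |A₁ - A| ≤ ε + K₂ * (t - s + h) := by
        have : A₁ - A = (A₁ - A₂) + (A₂ - A) := by ring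
        rw [this]
        exact (abs_add_le _ _).trans (add_le_add h2 (h3.trans h4))
      have h6 := mul_le_mul_of_nonneg_left h5 hh.le
      rw [← abs_of_nonneg hh.le, ← abs_mul, abs_of_nonneg hh.le] at h6
      rw [show a + (j + 1) = a + j + 1 by ring]
      push_cast
      rw [hE] at ih ⊢
      rw [abs_le] at ih h1 h6 ⊢
      constructor <;> linarith
  have h1 := key n le_rfl
  rw [← hn] at h1
  have h2 : |(n * h - (t - s)) * A| ≤ h * C := by
    rw [abs_mul]
    refine mul_le_mul ?_ hAC (abs_nonneg _) hh.le
    rw [abs_le]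
    constructor <;> nlinarith
  have h3 : n * h * E ≤ (t - s + h) * E := by
    refine mul_le_mul_of_nonneg_right ?_ hE0
    nlinarith
  have h4 : (t - s + h) * E + h * C ≤ (t - s + h) * ((K₁ + K₂ + C) * (√h + h) + ε +
      (K₁ + K₂ + C) * (t - s + h)) + (K₁ + K₂ + C) * h := by
    have e0 : 0 ≤ t - s + h := by linarith
    have e1 : 0 ≤ √h + h := by positivity
    have e2 : E ≤ (K₁ + K₂ + C) * (√h + h) + ε + (K₁ + K₂ + C) * (t - s + h) := by
      have := mul_nonneg (add_nonneg hK₂0 hC0) e1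
      have := mul_nonneg (add_nonneg hK₁0 hC0) e0
      rw [hE]
      linarith
    have e3 := mul_le_mul_of_nonneg_left e2 e0
    have e4 := mul_nonneg (add_nonneg hK₁0 hK₂0) hh.le
    linarith
  rw [abs_le] at h1 h2 ⊢
  constructor <;> linarith

/-- Existence for the Fokker-Planck equation: by compactness, the laws of the Markov chains have
a limit point as the time step vanishes. -/
theorem exists_isFokkerPlanckSolution (hT : 0 < T) (hσ : 0 < σ) (hb : SmoothOnCylinder T b)
    (m₀ : ProbabilityMeasure (Torus d)) : ∃ m, IsFokkerPlanckSolution σ T b m₀ m := by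
  let h : ℕ → ℝ := fun n => 1 / ((n : ℝ) + 1)
  have hh : ∀ n, 0 < h n := fun n => by positivity
  have hh1 : ∀ n, h n ≤ 1 := fun n => by
    rw [div_le_one (by positivity)]
    linarith [(Nat.cast_nonneg n : (0 : ℝ) ≤ n)]
  choose M hM0 hM using fun n => exists_isMarkovChain (σ := σ) hT hb (hh n).le m₀
  -- a limit along an ultrafilter is defined at all times at once
  let U : Ultrafilter ℕ := hyperfilter ℕ
  have hU : (U : Filter ℕ) ≤ atTop := by
    rw [← Nat.cofinite_eq_atTop]
    exact hyperfilter_le_cofinite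
  have hh0 : Tendsto h U (𝓝 0) := tendsto_one_div_add_atTop_nhds_zero_nat.mono_left hU
  let m : ℝ → ProbabilityMeasure (Torus d) := fun t => (U.map fun n => M n ⌊t / h n⌋₊).lim
  have hm : ∀ t, Tendsto (fun n => M n ⌊t / h n⌋₊) U (𝓝 (m t)) := fun t =>
    (U.map fun n => M n ⌊t / h n⌋₊).le_nhds_lim
  have hm0 : m 0 = m₀ := by
    refine tendsto_nhds_unique (hm 0) ?_
    simp [hM0]
  have hflow : IsFlowCurve σ T b m := by
    intro g hg ε hε
    obtain ⟨K, hK0, H⟩ := exists_chain_flow_expansion hT hσ hb hg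
    obtain ⟨δ, hδ, H⟩ := H (ε / 2) (half_pos hε)
    refine ⟨min δ (ε / 2 / (K + 1)), by positivity, fun s hs t ht hst hts => ?_⟩
    have hint : ∀ {g : Torus d → ℝ}, Continuous g → ∀ t, Tendsto
        (fun n => ∫ x, g x ∂(M n ⌊t / h n⌋₊ : Measure (Torus d))) U
        (𝓝 (∫ x, g x ∂(m t : Measure (Torus d)))) := fun hg t =>
      ((continuous_integral_probabilityMeasure hg).tendsto _).comp (hm t)
    have hgen : Continuous (generator σ (b s) g) :=
      (hb.generator hT σ (hg.smoothOnCylinder T)).continuous hs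
    have l1 := (((hint hg.continuous t).sub (hint hg.continuous s)).sub
      ((hint hgen s).const_mul (t - s))).abs
    have l2 : Tendsto (fun n => (t - s + h n) * (K * (√(h n) + h n) + ε / 2 + K * (t - s + h n)) +
        K * h n) U (𝓝 ((t - s + 0) * (K * (√0 + 0) + ε / 2 + K * (t - s + 0)) + K * 0)) :=
      ((hh0.const_add _).mul ((((hh0.sqrt.add hh0).const_mul K).add_const _).add
        ((hh0.const_add _).const_mul K))).add (hh0.const_mul K)
    have l3 := le_of_tendsto_of_tendsto l1 l2 (by
      filter_upwards [hh0.eventually (gt_mem_nhds hδ)] with n hn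
      exact H (h n) (hh n) (hh1 n) hn.le (M n) (hM n) s hs t ht hst
        (hts.trans (min_le_left _ _)))
    refine l3.trans ?_
    have e1 : 0 ≤ t - s := sub_nonneg.2 hst
    have e2 : K * (t - s) ≤ ε / 2 := by
      have := hts.trans (min_le_right _ _)
      rw [le_div_iff₀ (by positivity)] at this
      linarith
    simp only [Real.sqrt_zero, add_zero, mul_zero, zero_add]
    rw [mul_comm ε]
    exact mul_le_mul_of_nonneg_left (by linarith) e1
  exact ⟨m, hm0 ▸ hflow.isFokkerPlanckSolution hT hb⟩

end Existence

/-! ### Fourier series of smooth functions on the torus -/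

namespace Torus

open UnitAddTorus

variable {d : ℕ}

/-- The Haar probability measure of the torus. -/
noncomputable def haar (d : ℕ) : Measure (Torus d) := Measure.pi fun _ => AddCircle.haarAddCircle

instance instIsProbabilityMeasureHaar : IsProbabilityMeasure (haar d) := by
  unfold haar; infer_instance

instance instIsAddHaarMeasureHaar : Measure.IsAddLeftInvariant (haar d) := by
  unfold haar; infer_instance

lemma mFourierCoeff_eq_integral_haar (f : Torus d → ℂ) (k : Fin d → ℤ) :
    mFourierCoeff f k = ∫ x, mFourier (-k) x * f x ∂haar d := rfl

lemma mFourier_add_single (k : Fin d → ℤ) (i : Fin d) (x : Torus d) (s : ℝ) :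
    mFourier k (x + Pi.single i (s : UnitAddCircle)) =
      Complex.exp (2 * Real.pi * Complex.I * k i * s) * mFourier k x := by
  have h0 : ∑ j, (k j : ℂ) * ((s • (Pi.single i 1 : Fin d → ℝ)) j : ℂ) = k i * s := by
    rw [Finset.sum_eq_single i]
    · simp
    · intro j _ hj; simp [hj]
    · simp
  rw [mFourier_add_apply, ← proj_smul_single, mFourier_proj, h0, mul_assoc _ (k i : ℂ), mul_comm]

lemma mFourierCoeff_translate (f : Torus d → ℂ) (k : Fin d → ℤ) (i : Fin d) (s : ℝ) :
    mFourierCoeff (fun x => f (x + Pi.single i (s : UnitAddCircle))) k =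
      Complex.exp (2 * Real.pi * Complex.I * k i * s) * mFourierCoeff f k := by
  simp only [mFourierCoeff_eq_integral_haar]
  rw [← integral_const_mul, ← integral_add_right_eq_self (fun x =>
    Complex.exp (2 * Real.pi * Complex.I * k i * s) * (mFourier (-k) x * f x))
    (Pi.single i (s : UnitAddCircle))]
  refine integral_congr_ae (Eventually.of_forall fun x => ?_)
  beta_reduce
  rw [mFourier_add_single, ← mul_assoc, ← mul_assoc, ← Complex.exp_add]
  simp

lemma hasDerivAt_integral_of_continuous {X : Type*} [TopologicalSpace X] [MeasurableSpace X]
    [BorelSpace X] [TopologicalSpace.MetrizableSpace X] [CompactSpace X] (μ : Measure X)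
    [IsFiniteMeasure μ] {F F' : ℝ → X → ℂ} {C : ℝ} (hF : ∀ s, Continuous (F s))
    (hF' : ∀ s, Continuous (F' s)) (hC : ∀ s x, ‖F' s x‖ ≤ C)
    (hd : ∀ x s, HasDerivAt (fun s => F s x) (F' s x) s) (s : ℝ) :
    HasDerivAt (fun s => ∫ x, F s x ∂μ) (∫ x, F' s x ∂μ) s :=
  (hasDerivAt_integral_of_dominated_loc_of_deriv_le (s := univ) (bound := fun _ => C) univ_mem
    (Eventually.of_forall fun s => (hF s).aestronglyMeasurable)
    ((hF s).integrable_of_compactSpace _) (hF' s).aestronglyMeasurable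
    (Eventually.of_forall fun x s _ => hC s x) (integrable_const _)
    (Eventually.of_forall fun x s _ => hd x s)).2

/-- Obtained by differentiating the Fourier coefficients of the translates. -/
lemma mFourierCoeff_partialDeriv {g : Torus d → ℝ} (hg : Smooth g) (k : Fin d → ℤ) (i : Fin d) :
    mFourierCoeff (fun x => (partialDeriv i g x : ℂ)) k =
      2 * Real.pi * Complex.I * k i * mFourierCoeff (fun x => (g x : ℂ)) k := by
  obtain ⟨C, hC0, hC⟩ := ((hg.partialDeriv i).smoothOnCylinder 0).exists_bound
  have hd : ∀ (x : Torus d) (s : ℝ),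
      HasDerivAt (fun s : ℝ => g (x + Pi.single i (s : UnitAddCircle)))
      (partialDeriv i g (x + Pi.single i (s : UnitAddCircle))) s := fun x s => by
    have := (hg.smoothOnCylinder 1).hasDerivAt_single (f := fun _ => g) (t := 0) (by simp) x i s
    exact this
  have hcont : ∀ p : Torus d → ℝ, Continuous p → ∀ s : ℝ, Continuous fun x : Torus d =>
      mFourier (-k) x * (p (x + Pi.single i (s : UnitAddCircle)) : ℂ) := by
    intro p hp s
    have h : Continuous fun x : Torus d => x + Pi.single i (s : UnitAddCircle) :=
      continuous_add_const _
    have h' : Continuous fun x : Torus d => p (x + Pi.single i (s : UnitAddCircle)) := hp.comp h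
    fun_prop
  have hc1 := hcont g hg.continuous
  have hc2 := hcont (partialDeriv i g) (hg.partialDeriv i).continuous
  have hb : ∀ (s : ℝ) (x : Torus d),
      ‖mFourier (-k) x * (partialDeriv i g (x + Pi.single i (s : UnitAddCircle)) : ℂ)‖ ≤ C := by
    intro s x
    rw [norm_mul, norm_mFourier_apply, one_mul, Complex.norm_real]
    exact hC 0 (by simp) _
  have hd' : ∀ (x : Torus d) (s : ℝ),
      HasDerivAt (fun s : ℝ => mFourier (-k) x * (g (x + Pi.single i (s : UnitAddCircle)) : ℂ))
      (mFourier (-k) x * (partialDeriv i g (x + Pi.single i (s : UnitAddCircle)) : ℂ)) s :=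
    fun x s =>
    ((hd x s).ofReal_comp).const_mul _
  have h1 := hasDerivAt_integral_of_continuous (haar d) hc1 hc2 hb hd' 0
  have h2 : HasDerivAt (fun s : ℝ => Complex.exp (2 * Real.pi * Complex.I * k i * s) *
      mFourierCoeff (fun x => (g x : ℂ)) k)
      (2 * Real.pi * Complex.I * k i * mFourierCoeff (fun x => (g x : ℂ)) k) 0 := by
    have h3 : HasDerivAt (fun s : ℝ => 2 * Real.pi * Complex.I * k i * (s : ℂ))
        (2 * Real.pi * Complex.I * k i) 0 := by
      simpa using (Complex.ofRealCLM.hasDerivAt (x := (0 : ℝ))).const_mul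
        (2 * Real.pi * Complex.I * k i)
    simpa using h3.cexp.mul_const (mFourierCoeff (fun x => (g x : ℂ)) k)
  have h3 : (fun s : ℝ => ∫ x, mFourier (-k) x * (g (x + Pi.single i (s : UnitAddCircle)) : ℂ)
      ∂haar d) = fun s : ℝ => Complex.exp (2 * Real.pi * Complex.I * k i * s) *
      mFourierCoeff (fun x => (g x : ℂ)) k :=
    funext fun s => by
      rw [← mFourierCoeff_translate (fun x => (g x : ℂ)) k i s, mFourierCoeff_eq_integral_haar]
  rw [h3] at h1
  have h4 := h1.unique h2
  rw [← h4, mFourierCoeff_eq_integral_haar]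
  have h0 : ∀ x : Torus d, x + Pi.single i (((0 : ℝ) : UnitAddCircle)) = x := fun x => by simp
  simp only [h0]

variable {T : ℝ} {f : ℝ → Torus d → ℝ}

/-- Applying `∏ (1 - ∂ᵢ²)` multiplies the Fourier coefficients by `∏ (1 + 4 π² kᵢ²)`. -/
lemma SmoothOnCylinder.exists_mFourierCoeff_eq (hT : 0 < T) (hf : SmoothOnCylinder T f)
    (s : Finset (Fin d)) :
    ∃ g : ℝ → Torus d → ℝ, SmoothOnCylinder T g ∧ ∀ t ∈ Icc 0 T, ∀ k : Fin d → ℤ,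
      mFourierCoeff (fun x => (g t x : ℂ)) k =
        (∏ i ∈ s, (1 + 4 * Real.pi ^ 2 * (k i : ℝ) ^ 2) : ℝ) *
          mFourierCoeff (fun x => (f t x : ℂ)) k := by
  induction s using Finset.induction_on with
  | empty => exact ⟨f, hf, fun t _ k => by simp⟩
  | insert i s hi ih =>
    obtain ⟨g, hg, hgk⟩ := ih
    refine ⟨fun t x => g t x - Torus.partialDeriv i (Torus.partialDeriv i (g t)) x,
      hg.sub ((hg.partialDeriv hT i).partialDeriv hT i), fun t ht k => ?_⟩
    have hgs := hg.smooth ht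
    have hc1 : Continuous fun x => mFourier (-k) x * (g t x : ℂ) := by
      have := hgs.continuous
      fun_prop
    have hc2 : Continuous fun x =>
        mFourier (-k) x * (Torus.partialDeriv i (Torus.partialDeriv i (g t)) x : ℂ) := by
      have := ((hgs.partialDeriv i).partialDeriv i).continuous
      fun_prop
    have h1 : mFourierCoeff (fun x => ((g t x - Torus.partialDeriv i
        (Torus.partialDeriv i (g t)) x : ℝ) : ℂ)) k = mFourierCoeff (fun x => (g t x : ℂ)) k -
        mFourierCoeff (fun x => (Torus.partialDeriv i (Torus.partialDeriv i (g t)) x : ℂ)) k := by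
      simp only [mFourierCoeff_eq_integral_haar, Complex.ofReal_sub, mul_sub]
      exact integral_sub (hc1.integrable_of_compactSpace _) (hc2.integrable_of_compactSpace _)
    rw [h1, mFourierCoeff_partialDeriv (hgs.partialDeriv i), mFourierCoeff_partialDeriv hgs,
      hgk t ht, Finset.prod_insert hi]
    push_cast
    linear_combination (-(4 * Real.pi ^ 2 * (k i : ℂ) ^ 2 * (∏ i ∈ s, (1 + 4 * (Real.pi : ℂ) ^ 2 *
      (k i : ℂ) ^ 2)) * mFourierCoeff (fun x => (f t x : ℂ)) k)) * Complex.I_sq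

lemma summable_prod_inv_one_add_sq :
    Summable fun k : Fin d → ℤ => ∏ i, (1 + 4 * Real.pi ^ 2 * (k i : ℝ) ^ 2)⁻¹ := by
  have h1 : Summable fun k : ℤ => (1 + 4 * Real.pi ^ 2 * (k : ℝ) ^ 2)⁻¹ := by
    have := (Real.summable_one_div_int_pow (p := 2)).2 one_lt_two
    refine Summable.of_norm_bounded_eventually this ?_
    filter_upwards [(Set.finite_singleton (0 : ℤ)).compl_mem_cofinite] with k hk
    have hk0 : (k : ℝ) ≠ 0 := by exact_mod_cast hk
    have hk2 : 0 < (k : ℝ) ^ 2 := by positivity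
    rw [Real.norm_of_nonneg (by positivity), one_div]
    refine inv_anti₀ hk2 ?_
    have h9 : (9 : ℝ) ≤ Real.pi ^ 2 := by nlinarith [Real.pi_gt_three]
    nlinarith
  have hpos : ∀ k : ℤ, 0 ≤ (1 + 4 * Real.pi ^ 2 * (k : ℝ) ^ 2)⁻¹ := fun k => by positivity
  refine summable_of_sum_le (c := ∏ _i : Fin d, ∑' k : ℤ, (1 + 4 * Real.pi ^ 2 * (k : ℝ) ^ 2)⁻¹)
    (fun k => Finset.prod_nonneg fun i _ => hpos _) fun s => ?_
  classical
  calc ∑ k ∈ s, ∏ i, (1 + 4 * Real.pi ^ 2 * (k i : ℝ) ^ 2)⁻¹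
      ≤ ∑ k ∈ Fintype.piFinset fun i => s.image fun k : Fin d → ℤ => k i,
        ∏ i, (1 + 4 * Real.pi ^ 2 * (k i : ℝ) ^ 2)⁻¹ := by
        refine Finset.sum_le_sum_of_subset_of_nonneg (fun k hk => ?_) fun k _ _ =>
          Finset.prod_nonneg fun i _ => hpos _
        exact Fintype.mem_piFinset.2 fun i => Finset.mem_image_of_mem _ hk
    _ = ∏ i, ∑ k ∈ s.image (fun k : Fin d → ℤ => k i), (1 + 4 * Real.pi ^ 2 * (k : ℝ) ^ 2)⁻¹ :=
        (Finset.prod_univ_sum (fun i => s.image fun k : Fin d → ℤ => k i)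
          fun _ (k : ℤ) => (1 + 4 * Real.pi ^ 2 * (k : ℝ) ^ 2)⁻¹).symm
    _ ≤ _ := Finset.prod_le_prod (fun i _ => Finset.sum_nonneg fun k _ => hpos k)
        fun i _ => h1.sum_le_tsum _ fun k _ => hpos k

/-- Smooth families are uniformly bounded in the Wiener algebra: a continuous linear functional
is controlled on them by its values at the exponentials. -/
lemma SmoothOnCylinder.exists_wiener_bound (hT : 0 < T) (hf : SmoothOnCylinder T f) :
    ∃ A, 0 ≤ A ∧ ∀ t ∈ Icc 0 T, ∀ F : C(Torus d, ℂ), (∀ x, F x = f t x) →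
      ∀ (L : C(Torus d, ℂ) →L[ℂ] ℂ) (S : ℝ), (∀ k, ‖L (mFourier k)‖ ≤ S) → ‖L F‖ ≤ A * S := by
  obtain ⟨g, hg, hgk⟩ := hf.exists_mFourierCoeff_eq hT Finset.univ
  obtain ⟨B, hB0, hB⟩ := hg.exists_bound
  set w : (Fin d → ℤ) → ℝ := fun k => ∏ i, (1 + 4 * Real.pi ^ 2 * (k i : ℝ) ^ 2)⁻¹ with hw
  have hw0 : ∀ k, 0 ≤ w k := fun k => Finset.prod_nonneg fun i _ => by positivity
  have hws : Summable w := summable_prod_inv_one_add_sq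
  refine ⟨B * ∑' k, w k, mul_nonneg hB0 (tsum_nonneg hw0), fun t ht F hF L S hS => ?_⟩
  have hFf : ⇑F = fun x => (f t x : ℂ) := funext hF
  have hcoef : ∀ k, ‖mFourierCoeff F k‖ ≤ B * w k := fun k => by
    have h1 : ‖mFourierCoeff (fun x => (g t x : ℂ)) k‖ ≤ B := by
      rw [mFourierCoeff_eq_integral_haar]
      have := norm_integral_le_of_norm_le_const (μ := haar d) (C := B)
        (f := fun x => mFourier (-k) x * (g t x : ℂ)) (Eventually.of_forall fun x => by
          rw [norm_mul, norm_mFourier_apply, one_mul, Complex.norm_real]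
          exact hB t ht x)
      simpa using this
    have hpos : 0 < ∏ i, (1 + 4 * Real.pi ^ 2 * (k i : ℝ) ^ 2) :=
      Finset.prod_pos fun i _ => by positivity
    rw [hgk t ht, norm_mul, Complex.norm_real, Real.norm_of_nonneg hpos.le, ← hFf] at h1
    rw [hw]
    beta_reduce
    rw [Finset.prod_inv_distrib, ← div_eq_mul_inv, le_div_iff₀ hpos]
    linarith
  have hsum : Summable (mFourierCoeff F) :=
    Summable.of_norm_bounded (hws.mul_left B) hcoef
  have h1 := L.hasSum (hasSum_mFourier_series_of_summable hsum)
  rw [← h1.tsum_eq, mul_assoc, ← tsum_mul_right, ← tsum_mul_left]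
  refine tsum_of_norm_bounded (((hws.mul_right S).mul_left B).hasSum) fun k => ?_
  rw [map_smul, smul_eq_mul, norm_mul, ← mul_assoc]
  exact mul_le_mul (hcoef k) (hS k) (norm_nonneg _) (mul_nonneg hB0 (hw0 k))

end Torus

/-! ### A weak form of the fundamental theorem of calculus -/

/-- If `u' = v` on `(0, T)` with `u 0 = 0`, in duality with the smooth functions vanishing at `T`,
then `u` is the primitive of `v`. -/
lemma ae_eq_integral_of_forall_integral_deriv_mul_add {T : ℝ} {u v : ℝ → ℝ}
    (hT : 0 < T) (hu : IntervalIntegrable u volume 0 T) (hv : IntervalIntegrable v volume 0 T)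
    (h : ∀ a : ℝ → ℝ, ContDiff ℝ ∞ a → a T = 0 →
      ∫ t in (0 : ℝ)..T, (deriv a t * u t + a t * v t) = 0) :
    ∀ᵐ t, t ∈ Ioo 0 T → u t = ∫ r in (0 : ℝ)..t, v r := by
  set V : ℝ → ℝ := fun t => ∫ r in (0 : ℝ)..t, v r with hV
  have hVac : AbsolutelyContinuousOnInterval V 0 T :=
    hv.absolutelyContinuousOnInterval_intervalIntegral (by simp)
  have hVi : IntervalIntegrable V volume 0 T := hVac.continuousOn.intervalIntegrable
  have key : ∀ η : ℝ → ℝ, ContDiff ℝ ∞ η → ∫ t in (0 : ℝ)..T, η t * (u t - V t) = 0 := by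
    intro η hη
    -- test with the primitive of `η` that vanishes at `T`
    set a : ℝ → ℝ := fun t => ∫ r in T..t, η r with ha
    have had : ∀ t, HasDerivAt a (η t) t := fun t =>
      intervalIntegral.integral_hasDerivAt_right (hη.continuous.intervalIntegrable _ _)
        (hη.continuous.stronglyMeasurableAtFilter _ _) hη.continuous.continuousAt
    have hda : deriv a = η := funext fun t => (had t).deriv
    have hac : ContDiff ℝ ∞ a := by
      refine contDiff_infty_iff_deriv.2 ⟨fun t => (had t).differentiableAt, ?_⟩
      rwa [hda]
    have haT : a T = 0 := by simp [ha]
    have haac : AbsolutelyContinuousOnInterval a 0 T :=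
      (hac.contDiffOn.of_le (by simp)).absolutelyContinuousOnInterval
    have h1 := h a hac haT
    have h2 := haac.integral_deriv_mul_eq_sub hVac
    rw [haT, hda] at h2
    simp only [hV, intervalIntegral.integral_same, mul_zero, zero_mul, sub_zero] at h2
    have h3 : ∫ t in (0 : ℝ)..T, (η t * V t + a t * deriv V t) =
        ∫ t in (0 : ℝ)..T, (η t * V t + a t * v t) := by
      refine intervalIntegral.integral_congr_ae ?_
      filter_upwards [hv.ae_hasDerivAt_integral] with t ht ht'
      rw [(ht (uIoc_subset_uIcc ht') 0 (by simp)).deriv]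
    have hi : ∀ w : ℝ → ℝ, IntervalIntegrable w volume 0 T → ∀ c : ℝ → ℝ, Continuous c →
        IntervalIntegrable (fun t => c t * w t) volume 0 T := fun w hw c hc =>
      hw.continuousOn_mul hc.continuousOn
    rw [hda] at h1
    have h4 : ∀ t, η t * (u t - V t) = (η t * u t + a t * v t) - (η t * V t + a t * v t) :=
      fun t => by ring
    simp only [h4]
    rw [intervalIntegral.integral_sub ((hi u hu η hη.continuous).add (hi v hv a hac.continuous))
      ((hi V hVi η hη.continuous).add (hi v hv a hac.continuous)), h1, ← h3, sub_eq_zero]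
    exact h2.symm
  have hint : IntegrableOn (fun t => u t - V t) (Ioo 0 T) := by
    have := (hu.sub hVi).1
    exact this.mono_set Ioo_subset_Ioc_self
  have := isOpen_Ioo.ae_eq_zero_of_integral_contDiff_smul_eq_zero (f := fun t => u t - V t)
    (μ := volume) hint.locallyIntegrableOn fun η hη _ hηs => by
    rw [← key η hη, ← integral_Icc_eq_integral_of_tsupport_subset hT.le hηs]
    rfl
  filter_upwards [this] with t ht ht'
  exact sub_eq_zero.1 (ht ht')

/-! ### Polynomials in the Fourier coefficients of a measure as test functions -/

section Moments

open Torus UnitAddTorus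

variable {d p : ℕ} {σ T : ℝ}

/-- The function `m ↦ ∫ e_k dm` on the space of probability measures on the torus. -/
noncomputable def moment (k : Fin d → ℤ) (m : ProbabilityMeasure (Torus d)) : ℂ :=
  ∫ x, mFourier k x ∂(m : Measure (Torus d))

/-- The monomial `m ↦ ∏ⱼ ∫ e_{k j} dm`. -/
noncomputable def momentProd (k : Fin p → Fin d → ℤ) (m : ProbabilityMeasure (Torus d)) : ℂ :=
  ∏ j, moment (k j) m

/-- The monomial `momentProd k` with its `j`-th factor removed. -/
noncomputable def momentCofactor (k : Fin p → Fin d → ℤ) (j : Fin p)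
    (m : ProbabilityMeasure (Torus d)) : ℂ :=
  ∏ i ∈ Finset.univ.erase j, moment (k i) m

lemma continuous_moment (k : Fin d → ℤ) : Continuous (moment k) :=
  continuous_integral_probabilityMeasure (mFourier k).continuous

lemma continuous_momentProd (k : Fin p → Fin d → ℤ) : Continuous (momentProd k) :=
  continuous_finsetProd _ fun j _ => continuous_moment (k j)

lemma continuous_momentCofactor (k : Fin p → Fin d → ℤ) (j : Fin p) :
    Continuous (momentCofactor k j) :=
  continuous_finsetProd _ fun i _ => continuous_moment (k i)

lemma norm_moment_le (k : Fin d → ℤ) (m : ProbabilityMeasure (Torus d)) : ‖moment k m‖ ≤ 1 := by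
  simpa [moment] using norm_integral_le_of_norm_le_const (μ := (m : Measure (Torus d)))
    (Eventually.of_forall fun x => (norm_mFourier_apply k x).le)

lemma norm_momentProd_le (k : Fin p → Fin d → ℤ) (m : ProbabilityMeasure (Torus d)) :
    ‖momentProd k m‖ ≤ 1 := by
  rw [momentProd, norm_prod]
  exact Finset.prod_le_one (fun _ _ => norm_nonneg _) fun j _ => norm_moment_le (k j) m

lemma norm_momentCofactor_le (k : Fin p → Fin d → ℤ) (j : Fin p)
    (m : ProbabilityMeasure (Torus d)) : ‖momentCofactor k j m‖ ≤ 1 := by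
  rw [momentCofactor, norm_prod]
  exact Finset.prod_le_one (fun _ _ => norm_nonneg _) fun i _ => norm_moment_le (k i) m

lemma moment_mul_momentCofactor (k : Fin p → Fin d → ℤ) (j : Fin p)
    (m : ProbabilityMeasure (Torus d)) :
    moment (k j) m * momentCofactor k j m = momentProd k m :=
  Finset.mul_prod_erase _ (fun i => moment (k i) m) (Finset.mem_univ j)

lemma momentCofactor_mul_moment (k : Fin p → Fin d → ℤ) (j : Fin p) (l : Fin d → ℤ)
    (m : ProbabilityMeasure (Torus d)) :
    momentCofactor k j m * moment l m = momentProd (Function.update k j l) m := by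
  rw [← moment_mul_momentCofactor _ j, Function.update_self, mul_comm]
  congr 1
  refine Finset.prod_congr rfl fun i hi => ?_
  rw [Function.update_of_ne (Finset.ne_of_mem_erase hi)]

lemma moment_mixDirac (k : Fin d → ℤ) (m : ProbabilityMeasure (Torus d)) (x : Torus d)
    (θ : unitInterval) :
    moment k (mixDirac m x θ) = moment k m + ((θ : ℝ) : ℂ) * (mFourier k x - moment k m) := by
  have h : moment k (diracProba x) = mFourier k x := integral_dirac _ _
  rw [mixDirac_eq_mixture, ← h]
  simp only [moment]
  have hco : ∀ r : ℝ, (RCLike.ofReal r : ℂ) = (r : ℂ) := fun _ => rfl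
  rw [integral_mixture_projIcc (mFourier k).continuous, projIcc_val, hco, hco]
  push_cast
  ring

/-- Sums of products of a continuous function of a parameter and a smooth function have jointly
continuous iterated derivatives. -/
lemma continuousOn_iteratedFDerivWithin_sum {Z E κ : Type*} [TopologicalSpace Z]
    [NormedAddCommGroup E] [NormedSpace ℝ E] [Fintype κ] {C : κ → Z → ℝ}
    (hC : ∀ i, Continuous (C i)) {f : κ → E → ℝ} {s : Set E} (hf : ∀ i, ContDiffOn ℝ ∞ (f i) s)
    (hs : UniqueDiffOn ℝ s) (n : ℕ) :
    ContinuousOn (fun q : Z × E =>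
      iteratedFDerivWithin ℝ n (fun p => ∑ i, C i q.1 * f i p) s q.2) (univ ×ˢ s) := by
  have h1 : ContinuousOn (fun q : Z × E => ∑ i, C i q.1 • iteratedFDerivWithin ℝ n (f i) s q.2)
      (univ ×ˢ s) := by
    refine continuousOn_finsetSum _ fun i _ => ContinuousOn.smul
      ((hC i).comp continuous_fst).continuousOn ?_
    exact ((hf i).continuousOn_iteratedFDerivWithin (by exact_mod_cast le_top) hs).comp
      continuous_snd.continuousOn fun q hq => hq.2
  refine h1.congr ?_
  rintro ⟨z, x⟩ ⟨-, hx⟩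
  have hfx : ∀ i, ContDiffWithinAt ℝ n (f i) s x := fun i =>
    ((hf i) x hx).of_le (by exact_mod_cast le_top)
  have h2 : (fun p => ∑ i, C i z * f i p) = ∑ i, C i z • f i := by
    ext p
    simp
  beta_reduce
  rw [h2, iteratedFDerivWithin_sum_apply (f := fun i => C i z • f i) hs hx
    fun i _ => (hfx i).const_smul (C i z)]
  exact Finset.sum_congr rfl fun i _ => iteratedFDerivWithin_const_smul_apply (hfx i) hs hx

lemma trig_eq_re_add_im (ζ : ℂ) (k : Fin d → ℤ) (x : Torus d) :
    trig ζ k x = ζ.re * trig 1 k x + ζ.im * trig Complex.I k x := by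
  simp [trig, Complex.mul_re]
  ring

/-- Products of a smooth function of time and of a function on the space of measures whose
derivative is a trigonometric polynomial, with continuous coefficients, are smooth test
functions. -/
lemma isSmoothTestFunction_mul {ι : Type*} [Fintype ι] (hT : 0 < T)
    {Ψ : ProbabilityMeasure (Torus d) → ℝ} (hΨ : Continuous Ψ)
    {c : ι → ProbabilityMeasure (Torus d) → ℂ} (hc : ∀ i, Continuous (c i)) {l : ι → Fin d → ℤ}
    (hlim : ∀ m x, Tendsto (diracQuotient Ψ m x) (𝓝[>] (0 : unitInterval))
      (𝓝 (∑ i, trig (c i m) (l i) x))) {a : ℝ → ℝ} (ha : ContDiff ℝ ∞ a) :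
    IsSmoothTestFunction T (fun t m => a t * Ψ m) ∧
      ∀ t m, gradM (fun m => a t * Ψ m) m = fun x => a t * ∑ i, trig (c i m) (l i) x := by
  have hlim' : ∀ t m x, Tendsto (diracQuotient (fun m => a t * Ψ m) m x) (𝓝[>] (0 : unitInterval))
      (𝓝 (a t * ∑ i, trig (c i m) (l i) x)) := fun t m x => by
    refine ((hlim m x).const_mul (a t)).congr fun θ => ?_
    simp only [diracQuotient]
    ring
  have hne : (𝓝[>] (0 : unitInterval)).NeBot := nhdsGT_neBot_of_exists_gt ⟨1, zero_lt_one⟩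
  have hgrad : ∀ t m, gradM (fun m => a t * Ψ m) m =
      fun x => a t * ∑ i, trig (c i m) (l i) x := fun t m => by
    ext x
    exact (hlim' t m x).limUnder_eq
  let f : ι × Bool → ℝ × (Fin d → ℝ) → ℝ := fun i p =>
    a p.1 * trig (if i.2 then 1 else Complex.I) (l i.1) (proj p.2)
  let C : ι × Bool → ProbabilityMeasure (Torus d) → ℝ := fun i m =>
    if i.2 then (c i.1 m).re else (c i.1 m).im
  have hf : ∀ i, ContDiff ℝ ∞ (f i) := fun i =>
    (ha.comp contDiff_fst).mul ((smooth_trig _ (l i.1)).comp contDiff_snd)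
  have hC : ∀ i, Continuous (C i) := by
    rintro ⟨i, _ | _⟩
    · exact Complex.continuous_im.comp (hc i)
    · exact Complex.continuous_re.comp (hc i)
  have hsum : ∀ m, (fun p : ℝ × (Fin d → ℝ) => gradM (fun m => a p.1 * Ψ m) m (proj p.2)) =
      fun p => ∑ i, C i m * f i p := fun m => by
    ext p
    rw [hgrad, Fintype.sum_prod_type]
    beta_reduce
    rw [Finset.mul_sum]
    refine Finset.sum_congr rfl fun i _ => ?_
    rw [trig_eq_re_add_im]
    simp [C, f]
    ring
  refine ⟨⟨fun m => (ha.mul contDiff_const).contDiffOn, fun k => ?_, fun t _ m x =>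
    ⟨_, hlim' t m x⟩, fun m => ?_, fun k => ?_⟩, hgrad⟩
  · have h1 : ContinuousOn (fun q : ℝ × ProbabilityMeasure (Torus d) =>
        iteratedDerivWithin k a (Icc 0 T) q.1 * Ψ q.2) (Icc 0 T ×ˢ univ) :=
      (((ha.contDiffOn.continuousOn_iteratedDerivWithin (by exact_mod_cast le_top)
        (uniqueDiffOn_Icc hT)).comp continuous_fst.continuousOn fun q hq => hq.1)).mul
        (hΨ.comp continuous_snd).continuousOn
    refine h1.congr fun q _ => ?_
    exact iteratedDerivWithin_mul_const_field a (Ψ q.2)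
  · have h : ContDiff ℝ ∞ fun p => ∑ i, C i m * f i p :=
      ContDiff.sum fun i _ => contDiff_const.mul (hf i)
    have := h.contDiffOn (s := Icc 0 T ×ˢ univ)
    rw [← hsum m] at this
    exact this
  · simp only [hsum]
    exact continuousOn_iteratedFDerivWithin_sum hC (fun i => (hf i).contDiffOn)
      (uniqueDiffOn_cylinder hT) k

/-- The coefficients of the derivative of `Re (ζ momentProd k)`; the second half of the index set
accounts for the constant term of the derivative. -/
noncomputable def momentGradCoeff (ζ : ℂ) (k : Fin p → Fin d → ℤ) (i : Fin p ⊕ Fin p)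
    (m : ProbabilityMeasure (Torus d)) : ℂ :=
  i.elim (fun j => ζ * momentCofactor k j m) fun _ => -(ζ * momentProd k m)

lemma continuous_momentGradCoeff (ζ : ℂ) (k : Fin p → Fin d → ℤ) (i : Fin p ⊕ Fin p) :
    Continuous (momentGradCoeff ζ k i) := by
  rcases i with j | j
  · exact (continuous_momentCofactor k j).const_mul ζ
  · exact ((continuous_momentProd k).const_mul ζ).neg

lemma tendsto_diracQuotient_momentProd (ζ : ℂ) (k : Fin p → Fin d → ℤ)
    (m : ProbabilityMeasure (Torus d)) (x : Torus d) :
    Tendsto (diracQuotient (fun m => (ζ * momentProd k m).re) m x) (𝓝[>] (0 : unitInterval))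
      (𝓝 (∑ i, trig (momentGradCoeff ζ k i m) (Sum.elim k 0 i) x)) := by
  have hd : HasDerivAt (fun θ : ℝ => ζ * ∏ j, (moment (k j) m + (θ : ℂ) *
      (mFourier (k j) x - moment (k j) m)))
      (ζ * ∑ j, momentCofactor k j m * (mFourier (k j) x - moment (k j) m)) 0 := by
    have h1 : ∀ j, HasDerivAt (fun θ : ℝ => moment (k j) m + (θ : ℂ) *
        (mFourier (k j) x - moment (k j) m)) (mFourier (k j) x - moment (k j) m) 0 := fun j => by
      have := ((Complex.ofRealCLM.hasDerivAt (x := (0 : ℝ))).mul_const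
        (mFourier (k j) x - moment (k j) m)).const_add (moment (k j) m)
      simpa using this
    have h2 := (HasDerivAt.fun_finsetProd (u := Finset.univ) fun j _ => h1 j).const_mul ζ
    simpa [momentCofactor] using h2
  have hre := Complex.reCLM.hasFDerivAt.comp_hasDerivAt (0 : ℝ) hd
  have hlim : ∑ i, trig (momentGradCoeff ζ k i m) (Sum.elim k 0 i) x =
      (ζ * ∑ j, momentCofactor k j m * (mFourier (k j) x - moment (k j) m)).re := by
    rw [Fintype.sum_sum_type, ← Finset.sum_add_distrib, Finset.mul_sum, Complex.re_sum]
    refine Finset.sum_congr rfl fun j _ => ?_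
    simp only [trig, momentGradCoeff, Sum.elim_inl, Sum.elim_inr, Pi.zero_apply,
      ← Complex.add_re]
    rw [← moment_mul_momentCofactor k j, show (0 : Fin d → ℤ) = 0 from rfl, mFourier_zero]
    congr 1
    simp only [ContinuousMap.one_apply]
    ring
  rw [hlim]
  have hs := hasDerivAt_iff_tendsto_slope.1 hre
  have hcoe : Tendsto (fun θ : unitInterval => (θ : ℝ)) (𝓝[>] (0 : unitInterval))
      (𝓝[≠] (0 : ℝ)) := by
    refine tendsto_nhdsWithin_iff.2 ⟨?_, ?_⟩
    · exact (continuous_subtype_val.tendsto (0 : unitInterval)).mono_left nhdsWithin_le_nhds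
    · filter_upwards [self_mem_nhdsWithin] with θ hθ
      exact (show (0 : ℝ) < θ from hθ).ne'
  refine (hs.comp hcoe).congr fun θ => ?_
  simp [diracQuotient, slope_def_field, momentProd, moment_mixDirac]

/-- The contribution of the drift `β` to the action of the generator on `momentProd k`. -/
noncomputable def momentDrift (β : Torus d → Fin d → ℝ) (k : Fin p → Fin d → ℤ)
    (m : ProbabilityMeasure (Torus d)) : ℂ :=
  ∑ j, ∑ i, (k j i : ℂ) * (momentCofactor k j m *
    ∫ x, (β x i : ℂ) * mFourier (k j) x ∂(m : Measure (Torus d)))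

/-- The rate at which diffusion damps `momentProd k`. -/
noncomputable def dampingRate (σ : ℝ) (k : Fin p → Fin d → ℤ) : ℝ :=
  4 * Real.pi ^ 2 * σ * ∑ j, ∑ i, (k j i : ℝ) ^ 2

lemma Torus.generator_sum_trig {ι : Type*} (s : Finset ι) (β : Torus d → Fin d → ℝ) (c : ι → ℂ)
    (l : ι → Fin d → ℤ) (x : Torus d) :
    generator σ β (fun x => ∑ i ∈ s, trig (c i) (l i) x) x =
      ∑ i ∈ s, generator σ β (trig (c i) (l i)) x := by
  classical
  induction s using Finset.induction_on with
  | empty =>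
    have h := Smooth.generator_const_mul (σ := σ) (β := β) (smooth_const (d := d) 0) 0 x
    simpa using h
  | insert i s hi ih =>
    have hs : Smooth fun x => ∑ i ∈ s, trig (c i) (l i) x :=
      ContDiff.sum fun i _ => smooth_trig (c i) (l i)
    have h := Smooth.generator_add (σ := σ) (β := β) (smooth_trig (c i) (l i)) hs 1 1 x
    simp only [one_mul] at h
    simp only [Finset.sum_insert hi]
    rw [h, ih]

lemma integral_generator_momentProd {β : Torus d → Fin d → ℝ} (hβ : Continuous β) (a : ℝ) (ζ : ℂ)
    (k : Fin p → Fin d → ℤ) (m : ProbabilityMeasure (Torus d)) :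
    ∫ x, generator σ β (fun x => a * ∑ i, trig (momentGradCoeff ζ k i m) (Sum.elim k 0 i) x) x
        ∂(m : Measure (Torus d)) =
      a * (ζ * (-(dampingRate σ k * momentProd k m) +
        2 * Real.pi * Complex.I * momentDrift β k m)).re := by
  have hβi : ∀ i, Continuous fun x => β x i := fun i => (continuous_apply i).comp hβ
  have hsym : ∀ l : Fin d → ℤ, Continuous fun x => symbol σ (β x) l * mFourier l x := fun l => by
    unfold symbol
    fun_prop
  have h1 : ∀ l : Fin d → ℤ, ∫ x, symbol σ (β x) l * mFourier l x ∂(m : Measure (Torus d)) =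
      -(4 * Real.pi ^ 2 * σ * ∑ i, (l i : ℂ) ^ 2) * moment l m + 2 * Real.pi * Complex.I *
        ∑ i, (l i : ℂ) * ∫ x, (β x i : ℂ) * mFourier l x ∂(m : Measure (Torus d)) := fun l => by
    have hi : ∀ i, Continuous fun x => (l i : ℂ) * ((β x i : ℂ) * mFourier l x) := fun i => by
      have := hβi i
      fun_prop
    have e : ∀ x, symbol σ (β x) l * mFourier l x =
        -(4 * Real.pi ^ 2 * σ * ∑ i, (l i : ℂ) ^ 2) * mFourier l x + 2 * Real.pi * Complex.I *
          ∑ i, (l i : ℂ) * ((β x i : ℂ) * mFourier l x) := fun x => by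
      rw [symbol, add_mul, mul_assoc (2 * Real.pi * Complex.I), Finset.sum_mul]
      congr 2
      exact Finset.sum_congr rfl fun i _ => by ring
    simp only [e]
    rw [integral_add (((mFourier l).continuous.const_mul _).integrable_of_compactSpace _)
      (((continuous_finsetSum _ fun i _ => hi i).const_mul _).integrable_of_compactSpace _),
      integral_const_mul, integral_const_mul,
      integral_finsetSum _ fun i _ => (hi i).integrable_of_compactSpace _]
    simp only [integral_const_mul]
    rfl
  have hre : ∀ (c : ℂ) (l : Fin d → ℤ), ∫ x, generator σ β (trig c l) x ∂(m : Measure (Torus d)) =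
      (c * ∫ x, symbol σ (β x) l * mFourier l x ∂(m : Measure (Torus d))).re := fun c l => by
    simp only [generator_trig]
    rw [← integral_const_mul, ← Complex.reCLM_apply, ← ContinuousLinearMap.integral_comp_comm]
    · rfl
    · exact ((hsym l).const_mul c).integrable_of_compactSpace _
  have hgc : ∀ (c : ℂ) (l : Fin d → ℤ), Continuous (generator σ β (trig c l)) := fun c l => by
    have : generator σ β (trig c l) = fun x => (c * (symbol σ (β x) l * mFourier l x)).re :=
      funext fun x => generator_trig σ β c l x
    rw [this]
    exact Complex.continuous_re.comp ((hsym l).const_mul c)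
  have hsm : Smooth fun x => ∑ i, trig (momentGradCoeff ζ k i m) (Sum.elim k 0 i) x :=
    ContDiff.sum fun i _ => smooth_trig _ _
  simp only [hsm.generator_const_mul, generator_sum_trig]
  rw [integral_const_mul, integral_finsetSum _ fun i _ => (hgc _ _).integrable_of_compactSpace _]
  congr 1
  simp only [hre, h1]
  rw [Fintype.sum_sum_type]
  simp only [momentGradCoeff, Sum.elim_inl, Sum.elim_inr, Pi.zero_apply, Int.cast_zero]
  simp only [ne_eq, OfNat.ofNat_ne_zero, not_false_eq_true, zero_pow, Finset.sum_const_zero,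
    mul_zero, zero_mul, neg_zero, add_zero, Complex.zero_re, ← Complex.re_sum]
  congr 1
  simp only [momentDrift, dampingRate, Complex.ofReal_mul, Complex.ofReal_sum, Complex.ofReal_pow,
    Complex.ofReal_ofNat, Complex.ofReal_intCast, Finset.mul_sum, Finset.sum_mul,
    ← Finset.sum_neg_distrib,
    ← Finset.sum_add_distrib]
  refine Finset.sum_congr rfl fun j _ => ?_
  rw [← moment_mul_momentCofactor k j]
  simp only [mul_add]
  exact Finset.sum_congr rfl fun i _ => by ring

end Moments

/-! ### The hierarchy of moment equations -/

section Hierarchy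

open Torus UnitAddTorus

variable {d p : ℕ} {σ T : ℝ} {b : ℝ → Torus d → Fin d → ℝ}
  {μ₀ : ProbabilityMeasure (ProbabilityMeasure (Torus d))}
  {ν ν' : ℝ → ProbabilityMeasure (ProbabilityMeasure (Torus d))}

lemma intervalIntegrable_integral_of_continuousOn (hT : 0 < T)
    (hν : AEMeasurable ν (volume.restrict (Icc 0 T)))
    {Φ : ℝ → ProbabilityMeasure (Torus d) → ℝ}
    (hΦ : ContinuousOn (fun q : ℝ × ProbabilityMeasure (Torus d) => Φ q.1 q.2) (Icc 0 T ×ˢ univ)) :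
    IntervalIntegrable (fun t => ∫ m, Φ t m ∂(ν t : Measure (ProbabilityMeasure (Torus d))))
      volume 0 T := by
  have hc : Continuous fun q : ℝ × ProbabilityMeasure (Torus d) => Φ (projIcc 0 T hT.le q.1) q.2 :=
    hΦ.comp_continuous (f := fun q : ℝ × ProbabilityMeasure (Torus d) =>
      ((projIcc 0 T hT.le q.1 : ℝ), q.2))
      (((continuous_subtype_val.comp continuous_projIcc).comp continuous_fst).prodMk continuous_snd)
      fun q => ⟨(projIcc 0 T hT.le q.1).2, mem_univ _⟩
  have hG := continuous_integral_parametric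
    (G := fun (t : ℝ) (m : ProbabilityMeasure (Torus d)) => Φ (projIcc 0 T hT.le t) m) hc
  have hm : AEStronglyMeasurable (fun t => (t, ν t)) (volume.restrict (Icc 0 T)) :=
    (aemeasurable_id.prodMk hν).aestronglyMeasurable
  have h1 := hG.comp_aestronglyMeasurable hm
  obtain ⟨C, hC⟩ := (isCompact_Icc.prod isCompact_univ).exists_bound_of_continuousOn hΦ
  have hint : IntegrableOn (fun t => ∫ m, Φ (projIcc 0 T hT.le t) m
      ∂(ν t : Measure (ProbabilityMeasure (Torus d)))) (Icc 0 T) := by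
    refine Integrable.of_bound h1 C (Eventually.of_forall fun t => ?_)
    exact abs_integral_le_of_forall_abs_le (fun m => hC (projIcc 0 T hT.le t, m)
      ⟨(projIcc 0 T hT.le t).2, mem_univ _⟩) (ν t)
  rw [intervalIntegrable_iff_integrableOn_Icc_of_le hT.le]
  refine hint.congr_fun (fun t ht => ?_) measurableSet_Icc
  simp only [projIcc_of_mem _ ht]

lemma continuousOn_momentDrift (hb : SmoothOnCylinder T b) (k : Fin p → Fin d → ℤ) :
    ContinuousOn (fun q : ℝ × ProbabilityMeasure (Torus d) => momentDrift (b q.1) k q.2)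
      (Icc 0 T ×ˢ univ) := by
  unfold momentDrift
  refine continuousOn_finsetSum _ fun j _ => continuousOn_finsetSum _ fun i _ =>
    continuousOn_const.mul (ContinuousOn.mul ?_ ?_)
  · exact ((continuous_momentCofactor k j).comp continuous_snd).continuousOn
  · refine continuousOn_integral_parametric
      (G := fun (t : ℝ) (x : Torus d) => (b t x i : ℂ) * mFourier (k j) x) ?_
    exact (Complex.continuous_ofReal.comp_continuousOn (hb.component i).continuousOn).mul
      ((mFourier (k j)).continuous.comp continuous_snd).continuousOn

/-- Testing a weak solution with `a t * Re (ζ momentProd k)`. -/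
lemma IsWeakSolution.moment_equation (hT : 0 < T) (hb : SmoothOnCylinder T b)
    (hν : IsWeakSolution σ T b μ₀ ν) (ζ : ℂ) (k : Fin p → Fin d → ℤ) {a : ℝ → ℝ}
    (ha : ContDiff ℝ ∞ a) (haT : a T = 0) :
    ∫ t in (0 : ℝ)..T, (deriv a t * ∫ m, (ζ * momentProd k m).re
          ∂(ν t : Measure (ProbabilityMeasure (Torus d)))
        + a t * (∫ m, (ζ * (2 * Real.pi * Complex.I * momentDrift (b t) k m)).re
          ∂(ν t : Measure (ProbabilityMeasure (Torus d)))
          - dampingRate σ k * ∫ m, (ζ * momentProd k m).re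
          ∂(ν t : Measure (ProbabilityMeasure (Torus d))))) =
      -(a 0 * ∫ m, (ζ * momentProd k m).re ∂(μ₀ : Measure (ProbabilityMeasure (Torus d)))) := by
  have hZ : Continuous fun m : ProbabilityMeasure (Torus d) => (ζ * momentProd k m).re :=
    Complex.continuous_re.comp ((continuous_momentProd k).const_mul ζ)
  obtain ⟨hφ, hgrad⟩ := isSmoothTestFunction_mul (ι := Fin p ⊕ Fin p) hT hZ
    (continuous_momentGradCoeff ζ k) (tendsto_diracQuotient_momentProd ζ k) ha
  have hD : ∀ t ∈ Icc 0 T, Continuous fun m : ProbabilityMeasure (Torus d) =>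
      (ζ * (2 * Real.pi * Complex.I * momentDrift (b t) k m)).re := fun t ht => by
    have : Continuous fun m => momentDrift (b t) k m :=
      (continuousOn_momentDrift hb k).comp_continuous (f := fun m => (t, m)) (by fun_prop)
        fun _ => ⟨ht, mem_univ _⟩
    exact Complex.continuous_re.comp ((this.const_mul _).const_mul ζ)
  have h := hν.dual _ hφ fun m => by simp [haT]
  rw [sub_eq_zero] at h
  rw [← integral_const_mul, ← h, ← intervalIntegral.integral_neg]
  refine intervalIntegral.integral_congr fun t ht => ?_
  rw [uIcc_of_le hT.le] at ht
  have hder : ∀ m : ProbabilityMeasure (Torus d),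
      derivWithin (fun s => a s * (ζ * momentProd k m).re) (Icc 0 T) t =
        deriv a t * (ζ * momentProd k m).re := fun m => by
    have h1 := ((ha.differentiable (by simp) t).hasDerivAt.mul_const
      (ζ * momentProd k m).re).hasDerivWithinAt (s := Icc 0 T)
    exact h1.derivWithin (uniqueDiffOn_Icc hT t ht)
  have hDZ : Continuous fun m : ProbabilityMeasure (Torus d) =>
      (ζ * (2 * Real.pi * Complex.I * momentDrift (b t) k m)).re -
        dampingRate σ k * (ζ * momentProd k m).re := (hD t ht).sub (hZ.const_mul _)
  simp only [hder, hgrad, integral_generator_momentProd (hb.continuous ht)]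
  rw [← integral_neg, ← integral_const_mul, ← integral_const_mul (dampingRate σ k),
    ← integral_sub ((hD t ht).integrable_of_compactSpace _)
      ((hZ.const_mul _).integrable_of_compactSpace _), ← integral_const_mul,
    ← integral_add ((hZ.const_mul _).integrable_of_compactSpace _)
      ((hDZ.const_mul _).integrable_of_compactSpace _)]
  refine integral_congr_ae (Eventually.of_forall fun m => ?_)
  simp only [mul_add, mul_neg, Complex.add_re, Complex.neg_re]
  rw [mul_left_comm ζ (dampingRate σ k : ℂ), Complex.re_ofReal_mul]
  ring

/-- The functional `f ↦ ∫ (∏_{i ≠ j} ∫ e_{k i} dm) (∫ f e_{k j} dm) n(dm)`. -/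
noncomputable def momentFunctional (k : Fin p → Fin d → ℤ) (j : Fin p)
    (n : ProbabilityMeasure (ProbabilityMeasure (Torus d))) : C(Torus d, ℂ) →L[ℂ] ℂ :=
  have hc : ∀ f : C(Torus d, ℂ), Continuous fun m : ProbabilityMeasure (Torus d) =>
      momentCofactor k j m * ∫ x, f x * mFourier (k j) x ∂(m : Measure (Torus d)) := fun f =>
    (continuous_momentCofactor k j).mul (continuous_integral_probabilityMeasure
      (f.continuous.mul (mFourier (k j)).continuous))
  have hi : ∀ (f : C(Torus d, ℂ)) (m : ProbabilityMeasure (Torus d)),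
      Integrable (fun x => f x * mFourier (k j) x) (m : Measure (Torus d)) := fun f m =>
    (f.continuous.mul (mFourier (k j)).continuous).integrable_of_compactSpace _
  LinearMap.mkContinuous
    { toFun := fun f => ∫ m : ProbabilityMeasure (Torus d), momentCofactor k j m *
        ∫ x, f x * mFourier (k j) x ∂(m : Measure (Torus d))
        ∂(n : Measure (ProbabilityMeasure (Torus d)))
      map_add' := fun f g => by
        rw [← integral_add ((hc f).integrable_of_compactSpace _)
          ((hc g).integrable_of_compactSpace _)]
        simp only [← mul_add, ← integral_add (hi f _) (hi g _), ← add_mul,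
          ContinuousMap.add_apply]
      map_smul' := fun c f => by
        simp only [ContinuousMap.smul_apply, smul_eq_mul, mul_assoc, integral_const_mul,
          mul_left_comm _ c, RingHom.id_apply] } 1 fun f => by
    have h1 : ∀ m : ProbabilityMeasure (Torus d),
        ‖∫ x, f x * mFourier (k j) x ∂(m : Measure (Torus d))‖ ≤ ‖f‖ := fun m => by
      simpa using norm_integral_le_of_norm_le_const (μ := (m : Measure (Torus d)))
        (f := fun x => f x * mFourier (k j) x) (C := ‖f‖) (Eventually.of_forall fun x => by
          rw [norm_mul, norm_mFourier_apply, mul_one]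
          exact f.norm_coe_le_norm x)
    have h2 := norm_integral_le_of_norm_le_const (μ := (n : Measure (ProbabilityMeasure (Torus d))))
      (f := fun m : ProbabilityMeasure (Torus d) => momentCofactor k j m *
        ∫ x, f x * mFourier (k j) x ∂(m : Measure (Torus d))) (C := ‖f‖)
      (Eventually.of_forall fun m => by
        rw [norm_mul]
        calc _ ≤ 1 * ‖f‖ := mul_le_mul (norm_momentCofactor_le k j m) (h1 m) (norm_nonneg _)
              zero_le_one
          _ = ‖f‖ := one_mul _)
    simpa using h2

lemma momentFunctional_mFourier (k : Fin p → Fin d → ℤ) (j : Fin p)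
    (n : ProbabilityMeasure (ProbabilityMeasure (Torus d))) (l : Fin d → ℤ) :
    momentFunctional k j n (mFourier l) = ∫ m, momentProd (Function.update k j (l + k j)) m
      ∂(n : Measure (ProbabilityMeasure (Torus d))) := by
  simp only [momentFunctional, LinearMap.mkContinuous_apply, LinearMap.coe_mk, AddHom.coe_mk,
    ← momentCofactor_mul_moment, moment, mFourier_add]

lemma integral_momentDrift {β : Torus d → Fin d → ℝ} (B : Fin d → C(Torus d, ℂ))
    (hB : ∀ i x, B i x = β x i) (k : Fin p → Fin d → ℤ)
    (n : ProbabilityMeasure (ProbabilityMeasure (Torus d))) :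
    ∫ m, momentDrift β k m ∂(n : Measure (ProbabilityMeasure (Torus d))) =
      ∑ j, ∑ i, (k j i : ℂ) * momentFunctional k j n (B i) := by
  have hc : ∀ j i, Continuous fun m : ProbabilityMeasure (Torus d) =>
      (k j i : ℂ) * (momentCofactor k j m *
        ∫ x, B i x * mFourier (k j) x ∂(m : Measure (Torus d))) := fun j i =>
    continuous_const.mul ((continuous_momentCofactor k j).mul
      (continuous_integral_probabilityMeasure
      ((B i).continuous.mul (mFourier (k j)).continuous)))
  simp only [momentDrift, ← hB]
  rw [integral_finsetSum _ fun j _ => (continuous_finsetSum _ fun i _ =>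
    hc j i).integrable_of_compactSpace _]
  refine Finset.sum_congr rfl fun j _ => ?_
  rw [integral_finsetSum _ fun i _ => (hc j i).integrable_of_compactSpace _]
  refine Finset.sum_congr rfl fun i _ => ?_
  rw [integral_const_mul]
  rfl

/-- The drift couples the moments of degree `p` among themselves, with a loss of one derivative. -/
lemma exists_momentDrift_bound (hT : 0 < T) (hb : SmoothOnCylinder T b) :
    ∃ A, 0 ≤ A ∧ ∀ t ∈ Icc 0 T, ∀ (n n' : ProbabilityMeasure (ProbabilityMeasure (Torus d)))
      (p : ℕ) (S : ℝ), (∀ k : Fin p → Fin d → ℤ,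
        ‖∫ m, momentProd k m ∂(n : Measure (ProbabilityMeasure (Torus d))) -
          ∫ m, momentProd k m ∂(n' : Measure (ProbabilityMeasure (Torus d)))‖ ≤ S) →
      ∀ k : Fin p → Fin d → ℤ,
        ‖∫ m, momentDrift (b t) k m ∂(n : Measure (ProbabilityMeasure (Torus d))) -
          ∫ m, momentDrift (b t) k m ∂(n' : Measure (ProbabilityMeasure (Torus d)))‖
          ≤ A * (∑ j, ∑ i, |(k j i : ℝ)|) * S := by
  choose A hA0 hA using fun i => (hb.component i).exists_wiener_bound hT
  refine ⟨∑ i, A i, Finset.sum_nonneg fun i _ => hA0 i, fun t ht n n' p S hS k => ?_⟩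
  have hbc : ∀ i, Continuous fun x => (b t x i : ℂ) := fun i =>
    Complex.continuous_ofReal.comp ((hb.component i).continuous ht)
  let B : Fin d → C(Torus d, ℂ) := fun i => ⟨fun x => (b t x i : ℂ), hbc i⟩
  have hS0 : 0 ≤ S := (norm_nonneg _).trans (hS k)
  rw [integral_momentDrift B (fun _ _ => rfl), integral_momentDrift B (fun _ _ => rfl),
    ← Finset.sum_sub_distrib, Finset.mul_sum, Finset.sum_mul]
  refine (norm_sum_le _ _).trans (Finset.sum_le_sum fun j _ => ?_)
  rw [← Finset.sum_sub_distrib, Finset.mul_sum, Finset.sum_mul]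
  refine (norm_sum_le _ _).trans (Finset.sum_le_sum fun i _ => ?_)
  have h1 := hA i t ht (B i) (fun _ => rfl) (momentFunctional k j n - momentFunctional k j n') S
    fun l => by
      rw [sub_apply, momentFunctional_mFourier, momentFunctional_mFourier]
      exact hS _
  have h2 : A i * S ≤ (∑ i, A i) * S := mul_le_mul_of_nonneg_right
    (Finset.single_le_sum (fun i _ => hA0 i) (Finset.mem_univ i)) hS0
  rw [← mul_sub, norm_mul, Complex.norm_intCast, mul_right_comm, mul_comm]
  exact mul_le_mul_of_nonneg_right (h1.trans h2) (abs_nonneg _)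

end Hierarchy

/-! ### Uniqueness of weak solutions -/

section WeakUniqueness

open Torus UnitAddTorus

variable {d p : ℕ} {σ T : ℝ} {b : ℝ → Torus d → Fin d → ℝ}
  {μ₀ : ProbabilityMeasure (ProbabilityMeasure (Torus d))}
  {ν ν' : ℝ → ProbabilityMeasure (ProbabilityMeasure (Torus d))}

/-- Duhamel's formula for the moments of the difference of two weak solutions. -/
lemma IsWeakSolution.ae_duhamel (hT : 0 < T) (hb : SmoothOnCylinder T b)
    (hν : IsWeakSolution σ T b μ₀ ν) (hν' : IsWeakSolution σ T b μ₀ ν') (ζ : ℂ)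
    (k : Fin p → Fin d → ℤ) :
    ∀ᵐ t, t ∈ Ioo 0 T → Real.exp (dampingRate σ k * t) *
        (∫ m, (ζ * momentProd k m).re ∂(ν t : Measure (ProbabilityMeasure (Torus d))) -
          ∫ m, (ζ * momentProd k m).re ∂(ν' t : Measure (ProbabilityMeasure (Torus d)))) =
      ∫ r in (0 : ℝ)..t, Real.exp (dampingRate σ k * r) *
        (∫ m, (ζ * (2 * Real.pi * Complex.I * momentDrift (b r) k m)).re
            ∂(ν r : Measure (ProbabilityMeasure (Torus d))) -
          ∫ m, (ζ * (2 * Real.pi * Complex.I * momentDrift (b r) k m)).re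
            ∂(ν' r : Measure (ProbabilityMeasure (Torus d)))) := by
  set κ := dampingRate σ k
  have hZ : ContinuousOn (fun q : ℝ × ProbabilityMeasure (Torus d) => (ζ * momentProd k q.2).re)
      (Icc 0 T ×ˢ univ) :=
    (Complex.continuous_re.comp (((continuous_momentProd k).comp
      continuous_snd).const_mul ζ)).continuousOn
  have hD : ContinuousOn (fun q : ℝ × ProbabilityMeasure (Torus d) =>
      (ζ * (2 * Real.pi * Complex.I * momentDrift (b q.1) k q.2)).re) (Icc 0 T ×ˢ univ) :=
    Complex.continuous_re.comp_continuousOn (continuousOn_const.mul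
      (continuousOn_const.mul (continuousOn_momentDrift hb k)))
  have iU := intervalIntegrable_integral_of_continuousOn
    (Φ := fun _ m => (ζ * momentProd k m).re) hT hν.aemeasurable hZ
  have iU' := intervalIntegrable_integral_of_continuousOn
    (Φ := fun _ m => (ζ * momentProd k m).re) hT hν'.aemeasurable hZ
  have iV := intervalIntegrable_integral_of_continuousOn
    (Φ := fun t m => (ζ * (2 * Real.pi * Complex.I * momentDrift (b t) k m)).re) hT
    hν.aemeasurable hD
  have iV' := intervalIntegrable_integral_of_continuousOn
    (Φ := fun t m => (ζ * (2 * Real.pi * Complex.I * momentDrift (b t) k m)).re) hT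
    hν'.aemeasurable hD
  have heq := fun {a : ℝ → ℝ} => hν.moment_equation hT hb ζ k (a := a)
  have heq' := fun {a : ℝ → ℝ} => hν'.moment_equation hT hb ζ k (a := a)
  set U := fun t => ∫ m, (ζ * momentProd k m).re
    ∂(ν t : Measure (ProbabilityMeasure (Torus d)))
  set U' := fun t => ∫ m, (ζ * momentProd k m).re
    ∂(ν' t : Measure (ProbabilityMeasure (Torus d)))
  set V := fun t => ∫ m, (ζ * (2 * Real.pi * Complex.I * momentDrift (b t) k m)).re
    ∂(ν t : Measure (ProbabilityMeasure (Torus d)))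
  set V' := fun t => ∫ m, (ζ * (2 * Real.pi * Complex.I * momentDrift (b t) k m)).re
    ∂(ν' t : Measure (ProbabilityMeasure (Torus d)))
  have hexp : ContDiff ℝ ∞ fun t : ℝ => Real.exp (κ * t) :=
    Real.contDiff_exp.comp (contDiff_const.mul contDiff_id)
  have hexpd : ∀ t : ℝ, HasDerivAt (fun t : ℝ => Real.exp (κ * t)) (κ * Real.exp (κ * t)) t :=
    fun t => by
      have := ((hasDerivAt_id t).const_mul κ).exp
      simpa [mul_comm] using! this
  refine ae_eq_integral_of_forall_integral_deriv_mul_add hT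
    (u := fun t => Real.exp (κ * t) * (U t - U' t)) (v := fun t => Real.exp (κ * t) * (V t - V' t))
    ((iU.sub iU').continuousOn_mul hexp.continuous.continuousOn)
    ((iV.sub iV').continuousOn_mul hexp.continuous.continuousOn) fun α hα hαT => ?_
  -- the factor `exp (κ t)` absorbs the damping term
  set a : ℝ → ℝ := fun t => Real.exp (κ * t) * α t with ha
  have haC : ContDiff ℝ ∞ a := hexp.mul hα
  have haT : a T = 0 := by simp [ha, hαT]
  have had : ∀ t, deriv a t = κ * a t + Real.exp (κ * t) * deriv α t := fun t => by
    have := ((hexpd t).mul (hα.differentiable (by simp) t).hasDerivAt).deriv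
    simp only [ha]
    refine Eq.trans this ?_
    ring
  have hdac : Continuous (deriv a) := haC.continuous_deriv (by simp)
  have h1 := heq haC haT
  have h2 := heq' haC haT
  have hi : ∀ {U V : ℝ → ℝ}, IntervalIntegrable U volume 0 T → IntervalIntegrable V volume 0 T →
      IntervalIntegrable (fun t => deriv a t * U t + a t * (V t - κ * U t)) volume 0 T :=
    fun hU hV => (hU.continuousOn_mul hdac.continuousOn).add
      ((hV.sub (hU.const_mul κ)).continuousOn_mul haC.continuous.continuousOn)
  have h3 : ∫ t in (0 : ℝ)..T, ((deriv a t * U t + a t * (V t - κ * U t)) -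
      (deriv a t * U' t + a t * (V' t - κ * U' t))) = 0 := by
    rw [intervalIntegral.integral_sub (hi iU iV) (hi iU' iV'), sub_eq_zero]
    exact h1.trans h2.symm
  refine Eq.trans ?_ h3
  refine intervalIntegral.integral_congr fun t _ => ?_
  rw [had]
  simp only [ha]
  ring

/-- The derivative lost by the drift is absorbed by the diffusion. -/
lemma drift_le_dampingRate (hσ : 0 < σ) (A : ℝ) (k : Fin p → Fin d → ℤ) :
    2 * Real.pi * (A * ∑ j, ∑ i, |(k j i : ℝ)|) ≤
      (dampingRate σ k + 4 * (p * d * (A ^ 2 / σ))) / 4 := by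
  have h : ∀ x : ℝ, 2 * Real.pi * A * |x| ≤ Real.pi ^ 2 * σ * x ^ 2 + A ^ 2 / σ := fun x => by
    have h1 : 0 ≤ (Real.pi * σ * |x| - A) ^ 2 / σ := by positivity
    have h2 : (Real.pi * σ * |x| - A) ^ 2 / σ =
        Real.pi ^ 2 * σ * x ^ 2 + A ^ 2 / σ - 2 * Real.pi * A * |x| := by
      rw [← sq_abs x]
      field_simp
      ring
    linarith
  have h3 : ∑ j, ∑ i, 2 * Real.pi * A * |(k j i : ℝ)| ≤
      ∑ j, ∑ i, (Real.pi ^ 2 * σ * (k j i : ℝ) ^ 2 + A ^ 2 / σ) :=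
    Finset.sum_le_sum fun j _ => Finset.sum_le_sum fun i _ => h _
  simp only [Finset.sum_add_distrib, ← Finset.mul_sum, Finset.sum_const, Finset.card_univ,
    Fintype.card_fin, nsmul_eq_mul] at h3
  rw [dampingRate]
  linarith

/-- Two weak solutions with the same initial value have the same moments at almost every time. In
the norm `sup_{t, k} exp (-λ t) |u_k t|`, with `λ` large, the moment hierarchy is a contraction:
iterating it makes the difference of the moments arbitrarily small. -/
lemma IsWeakSolution.ae_integral_momentProd_eq (hT : 0 < T) (hσ : 0 < σ)
    (hb : SmoothOnCylinder T b) (hν : IsWeakSolution σ T b μ₀ ν)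
    (hν' : IsWeakSolution σ T b μ₀ ν') (p : ℕ) :
    ∀ᵐ t, t ∈ Ioo 0 T → ∀ k : Fin p → Fin d → ℤ,
      ∫ m, momentProd k m ∂(ν t : Measure (ProbabilityMeasure (Torus d))) =
        ∫ m, momentProd k m ∂(ν' t : Measure (ProbabilityMeasure (Torus d))) := by
  obtain ⟨A, hA0, hA⟩ := exists_momentDrift_bound hT hb
  -- for this rate, the drift term is at most a quarter of `dampingRate σ k + Λ`
  set Λ : ℝ := 4 * (p * d * (A ^ 2 / σ)) with hΛ
  have hre : ∀ (ζ : ℂ) {f : ProbabilityMeasure (Torus d) → ℂ}, Continuous f →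
      ∀ n : ProbabilityMeasure (ProbabilityMeasure (Torus d)),
      ∫ m, (ζ * f m).re ∂(n : Measure (ProbabilityMeasure (Torus d))) =
        (ζ * ∫ m, f m ∂(n : Measure (ProbabilityMeasure (Torus d)))).re := fun ζ f hf n => by
    rw [← integral_const_mul, ← Complex.reCLM_apply, ← ContinuousLinearMap.integral_comp_comm]
    · rfl
    · exact (hf.const_mul ζ).integrable_of_compactSpace _
  set F : ℝ → (Fin p → Fin d → ℤ) → ℂ := fun t k =>
    ∫ m, momentProd k m ∂(ν t : Measure (ProbabilityMeasure (Torus d))) -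
      ∫ m, momentProd k m ∂(ν' t : Measure (ProbabilityMeasure (Torus d))) with hF
  -- one iteration halves the bound, the real part (`ζ = 1`) and the imaginary part (`ζ = -I`)
  -- contributing a quarter each
  have step : ∀ N : ℝ, 0 ≤ N → (∀ᵐ t, t ∈ Ioo 0 T → ∀ k, ‖F t k‖ ≤ N * Real.exp (Λ * t)) →
      ∀ᵐ t, t ∈ Ioo 0 T → ∀ k, ‖F t k‖ ≤ N / 2 * Real.exp (Λ * t) := by
    intro N hN hFN
    have hζ : ∀ ζ : ℂ, ‖ζ‖ = 1 → ∀ᵐ t, t ∈ Ioo 0 T → ∀ k,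
        |(ζ * F t k).re| ≤ N / 4 * Real.exp (Λ * t) := by
      intro ζ hζ1
      have hall := ae_all_iff.2 fun k : Fin p → Fin d → ℤ => hν.ae_duhamel hT hb hν' ζ k
      filter_upwards [hall] with t ht htI k
      have h1 := ht k htI
      set κ := dampingRate σ k with hκ
      rw [hre ζ (continuous_momentProd k), hre ζ (continuous_momentProd k), ← Complex.sub_re,
        ← mul_sub] at h1
      have h2 : ∀ᵐ r, r ∈ Ioc 0 t → ‖Real.exp (κ * r) *
          (∫ m, (ζ * (2 * Real.pi * Complex.I * momentDrift (b r) k m)).re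
            ∂(ν r : Measure (ProbabilityMeasure (Torus d))) -
          ∫ m, (ζ * (2 * Real.pi * Complex.I * momentDrift (b r) k m)).re
            ∂(ν' r : Measure (ProbabilityMeasure (Torus d))))‖ ≤
          N / 4 * ((κ + Λ) * Real.exp ((κ + Λ) * r)) := by
        filter_upwards [hFN] with r hr hrt
        have hrT : r ∈ Ioo 0 T := ⟨hrt.1, hrt.2.trans_lt htI.2⟩
        have hrI : r ∈ Icc 0 T := Ioo_subset_Icc_self hrT
        have hDc : Continuous fun m => momentDrift (b r) k m :=
          (continuousOn_momentDrift hb k).comp_continuous (f := fun m => (r, m)) (by fun_prop)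
            fun _ => ⟨hrI, mem_univ _⟩
        rw [hre ζ (hDc.const_mul _), hre ζ (hDc.const_mul _), ← Complex.sub_re, ← mul_sub,
          integral_const_mul, integral_const_mul, ← mul_sub, norm_mul,
          Real.norm_of_nonneg (Real.exp_nonneg _)]
        have h3 := hA r hrI (ν r) (ν' r) p (N * Real.exp (Λ * r)) (hr hrT) k
        set D := ∫ m, momentDrift (b r) k m ∂(ν r : Measure (ProbabilityMeasure (Torus d))) -
          ∫ m, momentDrift (b r) k m ∂(ν' r : Measure (ProbabilityMeasure (Torus d)))
        have h4 : ‖(ζ * (2 * Real.pi * Complex.I * D)).re‖ ≤ 2 * Real.pi * ‖D‖ := by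
          refine (Complex.abs_re_le_norm _).trans (le_of_eq ?_)
          rw [norm_mul, hζ1, one_mul, norm_mul, norm_mul, norm_mul, Complex.norm_I, mul_one,
            Complex.norm_ofNat, Complex.norm_real, Real.norm_of_nonneg Real.pi_pos.le]
        have h5 := drift_le_dampingRate hσ A k
        have h6 : 2 * Real.pi * ‖D‖ ≤ (κ + Λ) / 4 * (N * Real.exp (Λ * r)) := by
          calc 2 * Real.pi * ‖D‖ ≤ 2 * Real.pi * (A * (∑ j, ∑ i, |(k j i : ℝ)|) *
                (N * Real.exp (Λ * r))) := mul_le_mul_of_nonneg_left h3 (by positivity)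
            _ = 2 * Real.pi * (A * (∑ j, ∑ i, |(k j i : ℝ)|)) * (N * Real.exp (Λ * r)) := by ring
            _ ≤ _ := mul_le_mul_of_nonneg_right h5 (by positivity)
        have h7 := mul_le_mul_of_nonneg_left (h4.trans h6) (Real.exp_nonneg (κ * r))
        refine h7.trans (le_of_eq ?_)
        rw [add_mul κ Λ r, Real.exp_add]
        ring
      have hprim : ∀ r : ℝ, HasDerivAt (fun r => N / 4 * Real.exp ((κ + Λ) * r))
          (N / 4 * ((κ + Λ) * Real.exp ((κ + Λ) * r))) r := fun r => by
        have := (((hasDerivAt_id r).const_mul (κ + Λ)).exp).const_mul (N / 4)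
        simpa [mul_comm] using! this
      have hcont : Continuous fun r : ℝ => N / 4 * ((κ + Λ) * Real.exp ((κ + Λ) * r)) := by
        fun_prop
      have h8 := intervalIntegral.norm_integral_le_of_norm_le htI.1.le h2
        (hcont.intervalIntegrable _ _)
      rw [← h1, intervalIntegral.integral_eq_sub_of_hasDerivAt (fun r _ => hprim r)
        (hcont.intervalIntegrable _ _), norm_mul, Real.norm_of_nonneg (Real.exp_nonneg _),
        Real.norm_eq_abs] at h8
      have h9 : N / 4 * Real.exp ((κ + Λ) * t) - N / 4 * Real.exp ((κ + Λ) * 0) ≤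
          Real.exp (κ * t) * (N / 4 * Real.exp (Λ * t)) := by
        rw [add_mul κ Λ t, Real.exp_add]
        have : 0 ≤ N / 4 * Real.exp ((κ + Λ) * 0) := by positivity
        linarith
      exact le_of_mul_le_mul_left (h8.trans h9) (Real.exp_pos _)
    filter_upwards [hζ 1 (by simp), hζ (-Complex.I) (by simp)] with t h1 h2 ht k
    have h1 := h1 ht k
    have h2 := h2 ht k
    rw [one_mul] at h1
    have h3 : (-Complex.I * F t k).re = (F t k).im := by simp
    rw [h3] at h2
    have := Complex.norm_le_abs_re_add_abs_im (F t k)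
    linarith
  have iter : ∀ n : ℕ, ∀ᵐ t, t ∈ Ioo 0 T → ∀ k, ‖F t k‖ ≤ 2 / 2 ^ n * Real.exp (Λ * t) := by
    intro n
    induction n with
    | zero =>
      refine Eventually.of_forall fun t ht k => ?_
      have hM : ∀ n : ProbabilityMeasure (ProbabilityMeasure (Torus d)),
          ‖∫ m, momentProd k m ∂(n : Measure (ProbabilityMeasure (Torus d)))‖ ≤ 1 := fun n => by
        simpa using norm_integral_le_of_norm_le_const
          (μ := (n : Measure (ProbabilityMeasure (Torus d))))
          (Eventually.of_forall fun m => norm_momentProd_le k m)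
      have h1 : ‖F t k‖ ≤ 1 + 1 := (norm_sub_le _ _).trans (add_le_add (hM _) (hM _))
      have h2 : 1 ≤ Real.exp (Λ * t) := Real.one_le_exp (mul_nonneg (by positivity) ht.1.le)
      rw [pow_zero, div_one]
      linarith
    | succ n ih =>
      have := step _ (by positivity) ih
      rwa [show (2 : ℝ) / 2 ^ n / 2 = 2 / 2 ^ (n + 1) by rw [pow_succ]; field_simp] at this
  filter_upwards [ae_all_iff.2 iter] with t ht htI k
  have hlim : Tendsto (fun n : ℕ => 2 / 2 ^ n * Real.exp (Λ * t)) atTop (𝓝 0) := by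
    have h := ((tendsto_pow_atTop_nhds_zero_of_lt_one (r := (1 / 2 : ℝ)) (by norm_num)
      (by norm_num)).const_mul 2).mul_const (Real.exp (Λ * t))
    simp only [mul_zero, zero_mul] at h
    refine h.congr fun n => ?_
    rw [one_div, inv_pow, ← div_eq_mul_inv]
  have h0 : ‖F t k‖ ≤ 0 := ge_of_tendsto' hlim fun n => ht n htI k
  exact sub_eq_zero.1 (norm_le_zero_iff.1 h0)

/-- `momentProd k` as a continuous function. -/
noncomputable def momentProdMap (k : Fin p → Fin d → ℤ) : C(ProbabilityMeasure (Torus d), ℂ) :=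
  ⟨momentProd k, continuous_momentProd k⟩

/-- The set of all monomials in the Fourier coefficients of a measure. -/
def momentMonomials (d : ℕ) : Set C(ProbabilityMeasure (Torus d), ℂ) :=
  {f | ∃ (p : ℕ) (k : Fin p → Fin d → ℤ), f = momentProdMap k}

/-- The star subalgebra of polynomials in the Fourier coefficients of a measure. -/
noncomputable def momentSubalgebra (d : ℕ) :
    StarSubalgebra ℂ C(ProbabilityMeasure (Torus d), ℂ) where
  toSubalgebra := Algebra.adjoin ℂ (momentMonomials d)
  star_mem' := by
    change Algebra.adjoin ℂ (momentMonomials d) ≤ star (Algebra.adjoin ℂ (momentMonomials d))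
    refine Algebra.adjoin_le ?_
    rintro _ ⟨p, k, rfl⟩
    refine Algebra.subset_adjoin ⟨p, fun j => -k j, ?_⟩
    ext m
    simp only [momentProdMap, ContinuousMap.star_apply, ContinuousMap.coe_mk, momentProd, moment,
      mFourier_neg, integral_conj, star_prod, RCLike.star_def]

lemma momentSubalgebra_coe :
    Subalgebra.toSubmodule (momentSubalgebra d).toSubalgebra =
      Submodule.span ℂ (momentMonomials d) := by
  refine Algebra.adjoin_eq_span_of_subset ℂ (Subset.trans (b := momentMonomials d) (fun x hx =>
    Submonoid.closure_induction (fun _ h => h) ⟨0, 0, ?_⟩ ?_ hx) Submodule.subset_span)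
  · ext m
    simp [momentProdMap, momentProd]
  · rintro _ _ _ _ ⟨p, k, rfl⟩ ⟨q, l, rfl⟩
    refine ⟨p + q, Fin.append k l, ?_⟩
    ext m
    simp [momentProdMap, momentProd, Fin.prod_univ_add]

lemma momentSubalgebra_topologicalClosure : (momentSubalgebra d).topologicalClosure = ⊤ := by
  refine ContinuousMap.starSubalgebra_topologicalClosure_eq_top_of_separatesPoints _ ?_
  intro m n hmn
  have : ∃ k, moment k m ≠ moment k n := by
    by_contra! h
    exact hmn (ext_of_integral_mFourier h)
  obtain ⟨k, hk⟩ := this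
  refine ⟨_, ⟨momentProdMap fun _ : Fin 1 => k, Algebra.subset_adjoin ⟨1, _, rfl⟩, rfl⟩, ?_⟩
  simpa [momentProdMap, momentProd] using hk

/-- A probability measure on the space of probability measures on the torus is determined by the
integrals of the monomials in the Fourier coefficients. -/
lemma ext_of_integral_momentProd {n n' : ProbabilityMeasure (ProbabilityMeasure (Torus d))}
    (h : ∀ (p : ℕ) (k : Fin p → Fin d → ℤ),
      ∫ m, momentProd k m ∂(n : Measure (ProbabilityMeasure (Torus d))) =
        ∫ m, momentProd k m ∂(n' : Measure (ProbabilityMeasure (Torus d)))) : n = n' := by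
  let J : ProbabilityMeasure (ProbabilityMeasure (Torus d)) →
      C(ProbabilityMeasure (Torus d), ℂ) → ℂ := fun n f =>
    ∫ m, f m ∂(n : Measure (ProbabilityMeasure (Torus d)))
  have hc : ∀ n, Continuous (J n) := fun n =>
    (continuous_integral_parametric (Y := C(ProbabilityMeasure (Torus d), ℂ)) (G := fun f m => f m)
      (by fun_prop)).comp (f := fun f => (f, n)) (by fun_prop)
  have hcl : IsClosed {f | J n f = J n' f} := isClosed_eq (hc n) (hc n')
  have hsub : ((momentSubalgebra d : StarSubalgebra ℂ C(ProbabilityMeasure (Torus d), ℂ)) :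
      Set C(ProbabilityMeasure (Torus d), ℂ)) ⊆ {f | J n f = J n' f} := by
    intro f hf
    have hf' : f ∈ Submodule.span ℂ (momentMonomials d) := by
      rw [← momentSubalgebra_coe]
      exact hf
    clear hf
    induction hf' using Submodule.span_induction with
    | mem f hf => obtain ⟨p, k, rfl⟩ := hf; exact h p k
    | zero => simp [J]
    | add f g _ _ hf hg =>
      simp only [mem_ofPred_eq, J, ContinuousMap.add_apply] at hf hg ⊢
      rw [integral_add (f.continuous.integrable_of_compactSpace _)
        (g.continuous.integrable_of_compactSpace _), integral_add
        (f.continuous.integrable_of_compactSpace _) (g.continuous.integrable_of_compactSpace _),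
        hf, hg]
    | smul c f _ hf =>
      simp only [mem_ofPred_eq, J, ContinuousMap.smul_apply] at hf ⊢
      rw [integral_smul, integral_smul, hf]
  have hcl' := closure_minimal hsub hcl
  refine ProbabilityMeasure.ext_of_forall_integral fun f => ?_
  have hf : (⟨fun m => (f m : ℂ), by fun_prop⟩ : C(ProbabilityMeasure (Torus d), ℂ)) ∈
      (momentSubalgebra d).topologicalClosure := by
    rw [momentSubalgebra_topologicalClosure]
    trivial
  have := hcl' hf
  simp only [mem_ofPred_eq, J, ContinuousMap.coe_mk, integral_complex_ofReal] at this
  exact_mod_cast this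

/-- Weak solutions are unique, up to null sets of times. -/
theorem IsWeakSolution.ae_eq (hT : 0 < T) (hσ : 0 < σ) (hb : SmoothOnCylinder T b)
    (hν : IsWeakSolution σ T b μ₀ ν) (hν' : IsWeakSolution σ T b μ₀ ν') :
    ∀ᵐ t ∂(volume.restrict (Icc 0 T)), ν t = ν' t := by
  rw [← restrict_Ioo_eq_restrict_Icc, ae_restrict_iff' measurableSet_Ioo]
  filter_upwards [ae_all_iff.2 fun p => hν.ae_integral_momentProd_eq hT hσ hb hν' p] with t ht htI
  exact ext_of_integral_momentProd fun p k => ht p htI k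

end WeakUniqueness

/-! ### The Fokker-Planck flow -/

section Flow

open Torus

variable {d : ℕ} {σ T : ℝ} {b : ℝ → Torus d → Fin d → ℝ} {m₀ : ProbabilityMeasure (Torus d)}
  {m m' : ℝ → ProbabilityMeasure (Torus d)}

/-- A solution of the Fokker-Planck equation, seen as a curve of Dirac masses, is a weak
solution. -/
lemma IsFokkerPlanckSolution.isWeakSolution_diracProba (hT : 0 < T) (hb : SmoothOnCylinder T b)
    (hm : IsFokkerPlanckSolution σ T b m₀ m) :
    IsWeakSolution σ T b (diracProba m₀) fun t => diracProba (m t) where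
  aemeasurable := (continuous_diracProba.comp_continuousOn hm.continuousOn).aemeasurable
    measurableSet_Icc
  dual := fun φ hφ hφT => by
    have h := hφ.integral_along_solution hT hb hm
    rw [hφT, hm.initial, zero_sub] at h
    have hd : ∀ (f : ProbabilityMeasure (Torus d) → ℝ) (n : ProbabilityMeasure (Torus d)),
        ∫ n', f n' ∂((diracProba n : ProbabilityMeasure (ProbabilityMeasure (Torus d))) :
          Measure (ProbabilityMeasure (Torus d))) = f n := fun f n => integral_dirac f n
    simp only [hd]
    rw [sub_eq_zero, ← neg_eq_iff_eq_neg.2 h, ← intervalIntegral.integral_neg]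
    refine intervalIntegral.integral_congr fun t _ => ?_
    ring

/-- Uniqueness for the Fokker-Planck equation. -/
theorem IsFokkerPlanckSolution.eqOn (hT : 0 < T) (hσ : 0 < σ) (hb : SmoothOnCylinder T b)
    (hm : IsFokkerPlanckSolution σ T b m₀ m) (hm' : IsFokkerPlanckSolution σ T b m₀ m') :
    EqOn m m' (Icc 0 T) := by
  refine Measure.eqOn_Icc_of_ae_eq (μ := volume) hT.ne ?_ hm.continuousOn hm'.continuousOn
  filter_upwards [(hm.isWeakSolution_diracProba hT hb).ae_eq hT hσ hb
    (hm'.isWeakSolution_diracProba hT hb)] with t ht using injective_diracProba ht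

lemma isFokkerPlanckSolution_flow (hT : 0 < T) (hσ : 0 < σ) (hb : SmoothOnCylinder T b)
    (m₀ : ProbabilityMeasure (Torus d)) :
    IsFokkerPlanckSolution σ T b m₀ fun t => fokkerPlanckFlow σ T b t m₀ := by
  have h := exists_isFokkerPlanckSolution hT hσ hb m₀
  simp only [fokkerPlanckFlow, dif_pos h]
  exact h.choose_spec

/-- At a fixed time, the flow depends continuously on the initial value: limits of solutions are
solutions, by the uniform expansion, and solutions are unique. -/
lemma continuous_fokkerPlanckFlow (hT : 0 < T) (hσ : 0 < σ) (hb : SmoothOnCylinder T b) {t : ℝ}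
    (ht : t ∈ Icc 0 T) : Continuous (fokkerPlanckFlow σ T b t) := by
  rw [continuous_iff_ultrafilter]
  intro m₀ U hU
  let m : ℝ → ProbabilityMeasure (Torus d) := fun t => (U.map (fokkerPlanckFlow σ T b t)).lim
  have hm : ∀ t, Tendsto (fokkerPlanckFlow σ T b t) U (𝓝 (m t)) := fun t =>
    (U.map (fokkerPlanckFlow σ T b t)).le_nhds_lim
  have hsol := isFokkerPlanckSolution_flow hT hσ hb
  have hm0 : m 0 = m₀ := by
    refine tendsto_nhds_unique (hm 0) ?_
    have : fokkerPlanckFlow σ T b 0 = id := funext fun n => (hsol n).initial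
    rw [this]
    exact hU
  have hflow : IsFlowCurve σ T b m := by
    intro g hg ε hε
    obtain ⟨δ, hδ, H⟩ := exists_uniform_expansion (σ := σ) hT hb hg hε
    refine ⟨δ, hδ, fun s hs t ht hst hts => ?_⟩
    have hint : ∀ {g : Torus d → ℝ}, Continuous g → ∀ t, Tendsto
        (fun n => ∫ x, g x ∂(fokkerPlanckFlow σ T b t n : Measure (Torus d))) U
        (𝓝 (∫ x, g x ∂(m t : Measure (Torus d)))) := fun hg t =>
      ((continuous_integral_probabilityMeasure hg).tendsto _).comp (hm t)
    have hgen : Continuous (generator σ (b s) g) :=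
      (hb.generator hT σ (hg.smoothOnCylinder T)).continuous hs
    exact le_of_tendsto (((hint hg.continuous t).sub (hint hg.continuous s)).sub
      ((hint hgen s).const_mul (t - s))).abs
      (Eventually.of_forall fun n => H n _ (hsol n) s hs t ht hst hts)
  have hms := hflow.isFokkerPlanckSolution hT hb
  rw [hm0] at hms
  have := hms.eqOn hT hσ hb (hsol m₀) ht
  beta_reduce at this
  rw [← this]
  exact hm t

lemma continuousOn_fokkerPlanckFlow (hT : 0 < T) (hσ : 0 < σ) (hb : SmoothOnCylinder T b) :
    ContinuousOn (fun q : ℝ × ProbabilityMeasure (Torus d) => fokkerPlanckFlow σ T b q.1 q.2)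
      (Icc 0 T ×ˢ univ) := by
  refine continuousOn_iff_forall_smooth.2 fun g hg => ?_
  obtain ⟨C, hC0, hC⟩ := (hb.generator hT σ (hg.smoothOnCylinder T)).exists_bound
  have h1 : ∀ t ∈ Icc 0 T, ContinuousOn (fun n : ProbabilityMeasure (Torus d) =>
      ∫ x, g x ∂(fokkerPlanckFlow σ T b t n : Measure (Torus d))) univ := fun t ht =>
    ((continuous_integral_probabilityMeasure hg.continuous).comp
      (continuous_fokkerPlanckFlow hT hσ hb ht)).continuousOn
  have h2 : ∀ n ∈ (univ : Set (ProbabilityMeasure (Torus d))), LipschitzOnWith ⟨C, hC0⟩ (fun t =>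
      ∫ x, g x ∂(fokkerPlanckFlow σ T b t n : Measure (Torus d))) (Icc 0 T) := by
    intro n _
    refine LipschitzOnWith.of_dist_le_mul fun t ht s hs => ?_
    have h := (isFokkerPlanckSolution_flow hT hσ hb n).integral_sub_integral hT hb hg hs ht
    beta_reduce at h
    rw [Real.dist_eq, Real.dist_eq, h]
    have h' := intervalIntegral.norm_integral_le_of_norm_le_const (a := s) (b := t) (C := C)
      (f := fun r => ∫ x, generator σ (b r) g x ∂(fokkerPlanckFlow σ T b r n : Measure (Torus d)))
      fun r hr => abs_integral_le_of_forall_abs_le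
        (hC r ((uIcc_subset_Icc hs ht) (uIoc_subset_uIcc hr))) _
    exact h'
  exact continuousOn_prod_of_continuousOn_lipschitzOnWith
    (fun q : ℝ × ProbabilityMeasure (Torus d) =>
      ∫ x, g x ∂(fokkerPlanckFlow σ T b q.1 q.2 : Measure (Torus d))) ⟨C, hC0⟩ h1 h2

/-- The flow, with the time clamped to `[0, T]`. -/
lemma continuous_fokkerPlanckFlow_projIcc (hT : 0 < T) (hσ : 0 < σ) (hb : SmoothOnCylinder T b) :
    Continuous (fun q : ℝ × ProbabilityMeasure (Torus d) =>
      fokkerPlanckFlow σ T b (projIcc 0 T hT.le q.1) q.2) :=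
  (continuousOn_fokkerPlanckFlow hT hσ hb).comp_continuous
    (f := fun q : ℝ × ProbabilityMeasure (Torus d) => ((projIcc 0 T hT.le q.1 : ℝ), q.2))
    (((continuous_subtype_val.comp continuous_projIcc).comp continuous_fst).prodMk continuous_snd)
    fun q => ⟨(projIcc 0 T hT.le q.1).2, mem_univ _⟩

end Flow

/-! ### The push-forward of the initial law by the flow -/

section PushForward

open Torus

variable {d : ℕ} {σ T : ℝ} {b : ℝ → Torus d → Fin d → ℝ}

lemma intervalIntegral_integral_swap_of_continuous {X : Type*} [TopologicalSpace X]
    [MeasurableSpace X] [BorelSpace X] [TopologicalSpace.MetrizableSpace X] [CompactSpace X]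
    (μ : Measure X) [IsFiniteMeasure μ] {G : ℝ → X → ℝ}
    (hG : Continuous fun q : ℝ × X => G q.1 q.2) (hT : 0 ≤ T) :
    ∫ t in (0 : ℝ)..T, ∫ x, G t x ∂μ = ∫ x, (∫ t in (0 : ℝ)..T, G t x) ∂μ := by
  simp only [intervalIntegral.integral_of_le hT]
  refine integral_integral_swap ?_
  obtain ⟨C, hC⟩ := (isCompact_Icc.prod isCompact_univ).exists_bound_of_continuousOn
    (s := Icc 0 T ×ˢ (univ : Set X)) hG.continuousOn
  have : SecondCountableTopology X := by
    let := TopologicalSpace.metrizableSpaceMetric X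
    infer_instance
  refine Integrable.of_bound hG.aestronglyMeasurable C ?_
  have h1 : ∀ᵐ t ∂(volume.restrict (Ioc 0 T)), t ∈ Icc 0 T :=
    (ae_restrict_mem measurableSet_Ioc).mono fun t ht => Ioc_subset_Icc_self ht
  have h2 := (Measure.quasiMeasurePreserving_fst (μ := volume.restrict (Ioc 0 T)) (ν := μ)).ae h1
  filter_upwards [h2] with q hq
  exact hC q ⟨hq, mem_univ _⟩

/-- The push-forward of `μ₀` by the Fokker-Planck flow (with time clamped to `[0, T]`). -/
noncomputable def pushFlow (hT : 0 < T) (hσ : 0 < σ) (hb : SmoothOnCylinder T b)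
    (μ₀ : ProbabilityMeasure (ProbabilityMeasure (Torus d))) (t : ℝ) :
    ProbabilityMeasure (ProbabilityMeasure (Torus d)) :=
  μ₀.map (f := fokkerPlanckFlow σ T b (projIcc 0 T hT.le t))
    (continuous_fokkerPlanckFlow hT hσ hb (projIcc 0 T hT.le t).2).measurable.aemeasurable

lemma integral_pushFlow (hT : 0 < T) (hσ : 0 < σ) (hb : SmoothOnCylinder T b)
    (μ₀ : ProbabilityMeasure (ProbabilityMeasure (Torus d))) (t : ℝ)
    {f : ProbabilityMeasure (Torus d) → ℝ} (hf : Continuous f) :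
    ∫ m, f m ∂(pushFlow hT hσ hb μ₀ t : Measure (ProbabilityMeasure (Torus d))) =
      ∫ m, f (fokkerPlanckFlow σ T b (projIcc 0 T hT.le t) m)
        ∂(μ₀ : Measure (ProbabilityMeasure (Torus d))) :=
  integral_map (continuous_fokkerPlanckFlow hT hσ hb
    (projIcc 0 T hT.le t).2).measurable.aemeasurable hf.aestronglyMeasurable

lemma continuous_pushFlow (hT : 0 < T) (hσ : 0 < σ) (hb : SmoothOnCylinder T b)
    (μ₀ : ProbabilityMeasure (ProbabilityMeasure (Torus d))) :
    Continuous (pushFlow hT hσ hb μ₀) := by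
  refine ProbabilityMeasure.continuous_iff_forall_continuousMap_continuous_integral.2 fun f => ?_
  simp only [integral_pushFlow hT hσ hb μ₀ _ f.continuous]
  have h := continuous_integral_parametric
    (G := fun (t : ℝ) (m : ProbabilityMeasure (Torus d)) =>
      f (fokkerPlanckFlow σ T b (projIcc 0 T hT.le t) m))
    (f.continuous.comp (continuous_fokkerPlanckFlow_projIcc hT hσ hb))
  exact h.comp (f := fun t => (t, μ₀)) (by fun_prop)

/-- The push-forward of the initial law by the flow is a weak solution: integrate over the initial
law the fundamental theorem of calculus along each solution. -/
theorem isWeakSolution_pushFlow (hT : 0 < T) (hσ : 0 < σ) (hb : SmoothOnCylinder T b)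
    (μ₀ : ProbabilityMeasure (ProbabilityMeasure (Torus d))) :
    IsWeakSolution σ T b μ₀ (pushFlow hT hσ hb μ₀) where
  aemeasurable := (continuous_pushFlow hT hσ hb μ₀).measurable.aemeasurable
  dual := fun φ hφ hφT => by
    have hsol := isFokkerPlanckSolution_flow hT hσ hb
    set Φ : ℝ → ProbabilityMeasure (Torus d) → ℝ := fun t m =>
      -derivWithin (fun s => φ s m) (Icc 0 T) t
        - ∫ x, generator σ (b t) (gradM (φ t) m) x ∂(m : Measure (Torus d)) with hΦ
    have hgen : ContinuousOn (fun q : ℝ × ProbabilityMeasure (Torus d) =>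
        ∫ x, generator σ (b q.1) (gradM (φ q.1) q.2) x ∂(q.2 : Measure (Torus d)))
        (Icc 0 T ×ˢ univ) := by
      have h1 := continuousOn_integral_parametric
        (G := fun (z : ℝ × ℝ × ProbabilityMeasure (Torus d)) (x : Torus d) =>
          generator σ (b z.1) (gradM (φ z.2.1) z.2.2) x)
        (hφ.continuousOn_generator_gradM (σ := σ) hT hb)
      have hf : ContinuousOn (fun q : ℝ × ProbabilityMeasure (Torus d) =>
        ((q.1, q.1, q.2), q.2)) (Icc 0 T ×ˢ univ) := by fun_prop
      have hmaps : MapsTo (fun q : ℝ × ProbabilityMeasure (Torus d) =>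
        ((q.1, q.1, q.2), q.2)) (Icc 0 T ×ˢ univ) ((Icc 0 T ×ˢ (Icc 0 T ×ˢ univ)) ×ˢ univ) :=
        fun q hq => ⟨⟨hq.1, hq.1, mem_univ _⟩, mem_univ _⟩
      have h := h1.comp hf hmaps
      exact h
    have hΦc : ContinuousOn (fun q : ℝ × ProbabilityMeasure (Torus d) => Φ q.1 q.2)
        (Icc 0 T ×ˢ univ) := hφ.continuousOn_derivWithin.neg.sub hgen
    have hG : Continuous fun q : ℝ × ProbabilityMeasure (Torus d) =>
        Φ (projIcc 0 T hT.le q.1) (fokkerPlanckFlow σ T b (projIcc 0 T hT.le q.1) q.2) :=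
      hΦc.comp_continuous (f := fun q : ℝ × ProbabilityMeasure (Torus d) =>
        ((projIcc 0 T hT.le q.1 : ℝ), fokkerPlanckFlow σ T b (projIcc 0 T hT.le q.1) q.2))
        (((continuous_subtype_val.comp continuous_projIcc).comp continuous_fst).prodMk
          (continuous_fokkerPlanckFlow_projIcc hT hσ hb))
        fun q => ⟨(projIcc 0 T hT.le q.1).2, mem_univ _⟩
    have h1 : ∫ t in (0 : ℝ)..T, ∫ m, Φ t m
        ∂(pushFlow hT hσ hb μ₀ t : Measure (ProbabilityMeasure (Torus d))) =
        ∫ t in (0 : ℝ)..T, ∫ m,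
          Φ (projIcc 0 T hT.le t) (fokkerPlanckFlow σ T b (projIcc 0 T hT.le t) m)
          ∂(μ₀ : Measure (ProbabilityMeasure (Torus d))) := by
      refine intervalIntegral.integral_congr fun t ht => ?_
      rw [uIcc_of_le hT.le] at ht
      have hΦt : Continuous (Φ t) := hΦc.comp_continuous (f := fun m => (t, m)) (by fun_prop)
        fun _ => ⟨ht, mem_univ _⟩
      rw [integral_pushFlow hT hσ hb μ₀ t hΦt, projIcc_of_mem _ ht]
    have h2 : ∀ m, ∫ t in (0 : ℝ)..T,
        Φ (projIcc 0 T hT.le t) (fokkerPlanckFlow σ T b (projIcc 0 T hT.le t) m) = φ 0 m := by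
      intro m
      have h := hφ.integral_along_solution hT hb (hsol m)
      rw [hφT, (hsol m).initial, zero_sub] at h
      rw [← neg_eq_iff_eq_neg.2 h, ← intervalIntegral.integral_neg]
      refine intervalIntegral.integral_congr fun t ht => ?_
      rw [uIcc_of_le hT.le] at ht
      simp only [hΦ, projIcc_of_mem _ ht]
      ring
    rw [sub_eq_zero, h1, intervalIntegral_integral_swap_of_continuous _ (G := fun t m =>
      Φ (projIcc 0 T hT.le t) (fokkerPlanckFlow σ T b (projIcc 0 T hT.le t) m)) hG hT.le]
    simp only [h2]

end PushForward

theorem mainTheorem5 (d : ℕ) (σ T : ℝ) (hσ : 0 < σ) (hT : 0 < T)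
    (b : ℝ → Torus d → Fin d → ℝ) (hb : Torus.SmoothOnCylinder T b)
    (μ₀ : ProbabilityMeasure (ProbabilityMeasure (Torus d))) :
    -- the Fokker-Planck flow is well defined on `[0, T]`
    (∀ m₀ : ProbabilityMeasure (Torus d),
      IsFokkerPlanckSolution σ T b m₀ (fun t => fokkerPlanckFlow σ T b t m₀) ∧
      ∀ m : ℝ → ProbabilityMeasure (Torus d), IsFokkerPlanckSolution σ T b m₀ m →
        ∀ t ∈ Icc 0 T, m t = fokkerPlanckFlow σ T b t m₀) ∧
    (∀ t ∈ Icc 0 T, Measurable (fokkerPlanckFlow σ T b t)) ∧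
    -- the push-forward of `μ₀` by the flow is the unique solution
    ∃ μ : ℝ → ProbabilityMeasure (ProbabilityMeasure (Torus d)),
      (∀ t ∈ Icc 0 T, (μ t : Measure (ProbabilityMeasure (Torus d))) =
        Measure.map (fokkerPlanckFlow σ T b t) (μ₀ : Measure (ProbabilityMeasure (Torus d)))) ∧
      ContinuousOn μ (Icc 0 T) ∧
      IsWeakSolution σ T b μ₀ μ ∧
      ∀ ν : ℝ → ProbabilityMeasure (ProbabilityMeasure (Torus d)),
        IsWeakSolution σ T b μ₀ ν →
          (∀ᵐ t ∂(volume.restrict (Icc 0 T)), ν t = μ t) ∧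
          (ContinuousOn ν (Icc 0 T) → ∀ t ∈ Icc 0 T, ν t = μ t) := by
  have hsol := isWeakSolution_pushFlow hT hσ hb μ₀
  have hcont := (continuous_pushFlow hT hσ hb μ₀).continuousOn (s := Icc 0 T)
  refine ⟨fun m₀ => ⟨isFokkerPlanckSolution_flow hT hσ hb m₀, fun m hm t ht =>
    hm.eqOn hT hσ hb (isFokkerPlanckSolution_flow hT hσ hb m₀) ht⟩,
    fun t ht => (continuous_fokkerPlanckFlow hT hσ hb ht).measurable,
    pushFlow hT hσ hb μ₀, fun t ht => ?_, hcont, hsol, fun ν hν => ⟨hν.ae_eq hT hσ hb hsol,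
      fun hc => Measure.eqOn_Icc_of_ae_eq (μ := volume) hT.ne (hν.ae_eq hT hσ hb hsol) hc hcont⟩⟩
  rw [pushFlow, ProbabilityMeasure.toMeasure_map, projIcc_of_mem _ ht]
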